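/- Let $p$ be a prime and let $\mathcal O$ be a complete discrete valuation ring or a field, with maximal ideal $J(\mathcal O)$ and algebraically closed residue field $k=\mathcal O/J(\mathcal O)$ of characteristic $p$ (so $\mathcal O=k$ is allowed). Let $P$ be a finite $p$-group. An interior $P$-algebra over $\mathcal O$ is an (associative, unital) $\mathcal O$-algebra $A$ with a group homomorphism $P\to A^\times$; the image of $u\in P$ in $A$ is again denoted by $u$. The group $P$ acts on $A$ by conjugation, $a\mapsto uau^{-1}$, and $A^Q$ denotes the subalgebra of fixed points of a subgroup $Q\le P$. Put $$A(P)=A^P\Big/\Big(\sum_{Q<P}\mathrm{Tr}_Q^P(A^Q)+J(\mathcal O)A^P\Big),\qquad \mathrm{Tr}_Q^P(a)=\sum_{x\in[P/Q]}xax^{-1},$$ where $Q$ runs over the proper subgroups of $P$ and $[P/Q]$ is a set of representatives of the left cosets of $Q$ in $P$. Let $A$ and $B$ be interior $P$-algebras over $\mathcal O$ which are free of finite rank as $\mathcal O$-modules, such that $1_A$ is a primitive idempotent of $A^P$ and $1_B$ is a primitive idempotent of $B^P$. Let $V$ be an indecomposable $\mathcal OP$-module which is free of finite rank over $\mathcal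 O$, and let $S=\mathrm{End}_{\mathcal O}(V)$, an interior $P$-algebra through the action of $P$ on $V$. Regard $S\otimes_{\mathcal O}B$ as an interior $P$-algebra through $u\mapsto u\otimes u$. Assume that: 1. there is an embedding of interior $P$-algebras $g:A\to S\otimes_{\mathcal O}B$, that is, an injective, $\mathcal O$-linear, multiplicative (not necessarily unital) map $g$ with $g(ua)=u\,g(a)$ and $g(au)=g(a)\,u$ for all $u\in P$, $a\in A$, whose image is $g(1_A)(S\otimes_{\mathcal O}B)g(1_A)$; 2. $A$ and $B$ have $\mathcal O$-bases which are stable under conjugation by $P$; 3. $A$ admits a nondegenerate symmetric $\mathcal O$-linear form, that is, an $\mathcal O$-linear map $\mu:A\to\mathcal O$ such that $\mu(ab)=\mu(ba)$ for all $a,b\in A$ and such that $a\mapsto(b\mapsto\mu(ab))$ is an isomorphism $A\to\mathrm{Hom}_{\mathcal O}(A,\mathcal O)$; 4. $A(P)\neq0$. Then $V$ is an endopermutation $\mathcal OP$-module, that is, $\mathrm{End}_{\mathcal O}(V)$ has an $\mathcal O$-basis which is stable under conjugation by $P$. -/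

import Mathlib

open scoped TensorProduct

noncomputable section

namespace GAlg

/-! ### Modules with a group action: relative traces and the Brauer quotient -/

section Modules

variable {O G M : Type*} [CommRing O] [Group G] [AddCommGroup M] [Module O M]

/-- The submodule `M^H` of fixed points of a subgroup `H`. -/
def fixedBy (ρ : Representation O G M) (H : Subgroup G) : Submodule O M where
  carrier := {m | ∀ h ∈ H, ρ h m = m}
  zero_mem' := fun h _ => map_zero (ρ h)
  add_mem' := fun hv hw h hh => by rw [map_add, hv h hh, hw h hh]
  smul_mem' := fun c v hv h hh => by rw [map_smul, hv h hh]

/-- On an `H`-fixed element the value `ρ x m` depends only on the left coset `x H`. -/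
theorem apply_eq_of_mk_eq (ρ : Representation O G M) (H : Subgroup G) (m : fixedBy ρ H) {x y : G}
    (hxy : (QuotientGroup.mk x : G ⧸ H) = QuotientGroup.mk y) : ρ x m = ρ y m := by
  have h : ρ (x⁻¹ * y) (m : M) = m := m.2 _ (QuotientGroup.eq.mp hxy)
  calc ρ x (m : M) = ρ x (ρ (x⁻¹ * y) (m : M)) := by rw [h]
    _ = ρ y m := by rw [← Module.End.mul_apply, ← map_mul, mul_inv_cancel_left]

variable [Finite G]

/-- The sum of `ρ x m` over a set of representatives `x` of the left cosets of `H` in `G`. -/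
def cosetSum (ρ : Representation O G M) (H : Subgroup G) : fixedBy ρ H →ₗ[O] M :=
  letI : Fintype (G ⧸ H) := Fintype.ofFinite _
  ∑ x : G ⧸ H, (ρ x.out).domRestrict (fixedBy ρ H)

theorem cosetSum_mem_invariants (ρ : Representation O G M) (H : Subgroup G) (m : fixedBy ρ H) :
    cosetSum ρ H m ∈ ρ.invariants := by
  intro g
  letI : Fintype (G ⧸ H) := Fintype.ofFinite _
  simp only [cosetSum, LinearMap.sum_apply, LinearMap.domRestrict_apply, map_sum]
  refine Fintype.sum_equiv (MulAction.toPerm g) _ _ fun x => ?_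
  rw [← Module.End.mul_apply, ← map_mul]
  refine apply_eq_of_mk_eq ρ H m ?_
  rw [MulAction.toPerm_apply, QuotientGroup.out_eq']
  conv_rhs => rw [← QuotientGroup.out_eq' x]
  rfl

/-- The relative trace map `Tr_H^G : M^H → M^G`. -/
def relTrace (ρ : Representation O G M) (H : Subgroup G) : fixedBy ρ H →ₗ[O] ρ.invariants :=
  (cosetSum ρ H).codRestrict ρ.invariants (cosetSum_mem_invariants ρ H)

variable [IsLocalRing O]

/-- The kernel of the Brauer map `M^G → M(G)`: the submodule
`∑_{H < G} Tr_H^G(M^H) + J(O) M^G` of `M^G`. -/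
def brauerKer (ρ : Representation O G M) : Submodule O ρ.invariants :=
  (⨆ H : {H : Subgroup G // H < ⊤}, LinearMap.range (relTrace ρ H.1)) ⊔
    IsLocalRing.maximalIdeal O • (⊤ : Submodule O ρ.invariants)

/-- The Brauer quotient `M(G)`. -/
abbrev BrauerQuotient (ρ : Representation O G M) : Type _ :=
  ρ.invariants ⧸ brauerKer ρ

end Modules

section Bases

variable {O G M : Type*} [CommRing O] [Group G] [AddCommGroup M] [Module O M]

/-- `M` has an `O`-basis which is stable under the action of `G`. -/
def HasStableBasis (ρ : Representation O G M) : Prop :=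
  ∃ X : Set M, LinearIndepOn O id X ∧ Submodule.span O X = ⊤ ∧ ∀ g : G, ∀ x ∈ X, ρ g x ∈ X

/-- `M` is an indecomposable `OG`-module: it is nonzero, and in every decomposition of `M` as a
direct sum of two `G`-stable `O`-submodules one of the two is zero. -/
def IsIndecomposable (ρ : Representation O G M) : Prop :=
  Nontrivial M ∧ ∀ U W : Subrepresentation ρ, IsCompl U W → U = ⊥ ∨ W = ⊥

end Bases

/-! ### Interior `G`-algebras

An interior `G`-algebra over `O` is an `O`-algebra `A` together with a group homomorphism
`σ : G →* Aˣ`, its structure homomorphism. -/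

section Algebras

variable {O G A B V : Type*} [CommRing O] [Group G] [Ring A] [Algebra O A] [Ring B] [Algebra O B]
  [AddCommGroup V] [Module O V]

/-- The conjugation action `a ↦ σ g * a * (σ g)⁻¹` of `G` on an interior `G`-algebra. -/
def conj (σ : G →* Aˣ) : Representation O G A where
  toFun g := LinearMap.mulLeftRight O ((σ g : A), ((σ g)⁻¹ : Aˣ))
  map_one' := by ext a; simp
  map_mul' g h := by ext a; simp [mul_assoc]

theorem conj_apply (σ : G →* Aˣ) (g : G) (a : A) :
    conj (O := O) σ g a = σ g * a * ((σ g)⁻¹ : Aˣ) := by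
  simp [conj]

/-- The subalgebra `A^G` of elements of an interior `G`-algebra fixed by conjugation. -/
def fixedSubalgebra (O : Type*) [CommRing O] [Algebra O A] (σ : G →* Aˣ) : Subalgebra O A where
  carrier := {a | ∀ g, conj (O := O) σ g a = a}
  mul_mem' {a b} ha hb g := by
    have ha := ha g
    have hb := hb g
    rw [conj_apply, Units.mul_inv_eq_iff_eq_mul] at *
    rw [← mul_assoc, ha, mul_assoc, hb, mul_assoc]
  add_mem' ha hb g := by rw [map_add, ha g, hb g]
  algebraMap_mem' r g := by
    rw [conj_apply, ← Algebra.commutes, mul_assoc, Units.mul_inv, mul_one]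

/-- The interior `G`-algebra structure of `End_O(V)`, for an `OG`-module `V`. -/
def endStr (ρ : Representation O G V) : G →* (Module.End O V)ˣ :=
  MonoidHom.toHomUnits ρ

/-- The diagonal interior `G`-algebra structure `g ↦ σ g ⊗ τ g` of `A ⊗ B`. -/
def tensorStr (O : Type*) [CommRing O] [Algebra O A] [Algebra O B]
    (σ : G →* Aˣ) (τ : G →* Bˣ) : G →* (A ⊗[O] B)ˣ :=
  MonoidHom.toHomUnits
    { toFun := fun g => (σ g : A) ⊗ₜ[O] (τ g : B)
      map_one' := by simp [Algebra.TensorProduct.one_def]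
      map_mul' := fun g h => by simp }

/-- A (not necessarily unitary) homomorphism of `O`-algebras `f : A → B` is an embedding of
interior `G`-algebras if it is compatible with the left and right multiplication by the elements
of `G`, is injective, and its image is `f(1) B f(1)`. -/
structure IsInteriorEmbedding (σ : G →* Aˣ) (τ : G →* Bˣ) (f : A →ₙₐ[O] B) : Prop where
  map_left : ∀ (g : G) (a : A), f (σ g * a) = τ g * f a
  map_right : ∀ (g : G) (a : A), f (a * σ g) = f a * τ g
  injective : Function.Injective f
  range_eq : Set.range f = {x | ∃ b : B, x = f 1 * b * f 1}

/-- `A` admits a nondegenerate symmetric `O`-linear form, that is, a linear form `μ` with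
`μ (a * b) = μ (b * a)` for which `a ↦ (b ↦ μ (a * b))` is an isomorphism from `A` onto its
`O`-dual. -/
def IsSymmetricAlgebra (O A : Type*) [CommRing O] [Ring A] [Algebra O A] : Prop :=
  ∃ μ : A →ₗ[O] O, (∀ a b : A, μ (a * b) = μ (b * a)) ∧
    Function.Bijective ((LinearMap.mul O A).compr₂ μ)

/-- `V` is an endopermutation module: `End_O(V)` is a permutation module under conjugation.
To be used for `O`-free modules of finite rank. -/
def IsEndopermutation (ρ : Representation O G V) : Prop :=
  HasStableBasis (conj (O := O) (endStr ρ))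

/-- A primitive idempotent of a ring: a nonzero idempotent which is not the sum of two nonzero
orthogonal idempotents. -/
def IsPrimitiveIdempotent {R : Type*} [Ring R] (e : R) : Prop :=
  IsIdempotentElem e ∧ e ≠ 0 ∧ ∀ e₁ e₂ : R, IsIdempotentElem e₁ → IsIdempotentElem e₂ →
    e₁ * e₂ = 0 → e₂ * e₁ = 0 → e₁ + e₂ = e → e₁ = 0 ∨ e₂ = 0

end Algebras

end GAlg

end

open scoped TensorProduct
noncomputable section
namespace GAlg

/-! ### Finite algebras over a complete local ring: lifting idempotents and locality. -/

section Complete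

/-! Put `S = End_O(V)`. For a `p`-group, a direct summand of a permutation module is again a
permutation module (`exists_permBasis_of_sum_eq`). It therefore suffices to write the identity map
of `S` as a sum of relative traces to `P` of rank one maps `s ↦ ξ(s) v`, with `ξ` and `v` fixed by a
subgroup. Induction on the subgroup and Nakayama's lemma (`fixedBy_le_traceRankOne`) reduce this to
a statement for each `Q ≤ P`: modulo the kernel of the Brauer map at `Q`, the identity of `S` is a
sum of `Q`-invariant rank one maps (`one_mem_rankOneKer`).

Fix `Q`, and let `L` be the ideal of those elements of `S(Q) ⊗ S(Q)ᵒᵖ` which act on `S`, by left and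
right multiplication, as such sums. The stable basis of `B` gives `(S ⊗ B)(Q) = S(Q) ⊗ B(Q)`; let
`e` be the idempotent of `S(Q) ⊗ B(Q)` given by `g(1)`. For a `Q`-invariant form `t` on `B` and `b ∈
B^Q`, the map `s ↦ (id ⊗ t)(g(1) (s ⊗ b) g(1))` factors through the permutation module `A`, so it
produces an element of `L` (`theta_map_one_mem_rankOneKer`, `brBimod_sandwich`).

Now expand `e` in matrix units of the semisimple quotient of `S(Q)`, with entries in `B(Q)`. If `x c
y ≠ 0` for an entry `x` at block `i`, an entry `y` at block `j` and some `c ∈ B(Q)`, then `ε_i ⊗ ε_j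
∈ L`, where the `ε_i` lift the block identities. On the other hand `a ⊗ b ∈ L` forces `a x b = 0`
for `x` in the radical of `S(Q)`: invariant forms on `S` are given by the trace form, and elements
nilpotent in `S(Q)` have trace in `J(O)`. Hence two distinct blocks linked in this way satisfy `ε_i
S(Q) ε_j = 0`, and the contributions of different blocks to `e` generate ideals annihilating each
other.

The corner of `e` is `A(Q)`, which is indecomposable as an algebra because `A^P` is local and `A(P)
≠ 0` (`br_centrallyIndecomposable`). So `e` is concentrated in one block. But every block occurs in
`e`: at `P` the algebra `S(P) ⊗ B(P)` has only trivial idempotents, so `g(1)` becomes `1` there, and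
some `(id ⊗ t)(g(1))` is a unit of `S^P` (`exists_slice_isUnit`). Thus `S(Q)` has a single block,
which `e = e²` links to itself, and `1 ⊗ 1 ∈ L` (`one_mem_of_sandwich_mem`). -/

theorem isAdicComplete_of_finite {R : Type*} (M : Type*) [CommRing R] [IsNoetherianRing R]
    (I : Ideal R) [IsAdicComplete I R] [AddCommGroup M] [Module R M] [Module.Finite R M] :
    IsAdicComplete I M := by
  have h1 : IsHausdorff I M := IsHausdorff.of_le_jacobson I M (IsAdicComplete.le_jacobson_bot I)
  refine { h1, AdicCompletion.of_surjective_iff.mp ?_ with }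
  intro y
  -- Since `M` is finite, its completion is covered by `R̂ ⊗ M`, and `R̂` is covered by `R`.
  obtain ⟨z, rfl⟩ := AdicCompletion.ofTensorProduct_surjective_of_finite I M y
  induction z with
  | zero => exact ⟨0, by simp⟩
  | add a b ha hb =>
    obtain ⟨u, hu⟩ := ha
    obtain ⟨v, hv⟩ := hb
    exact ⟨u + v, by rw [map_add, map_add, hu, hv]⟩
  | tmul r m =>
    obtain ⟨r, rfl⟩ := AdicCompletion.of_surjective I R r
    refine ⟨r • m, ?_⟩
    rw [AdicCompletion.ofTensorProduct_tmul]
    ext n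
    simp
    rfl

/-- Idempotents of a finite commutative algebra over a complete ring lift modulo the ideal. -/
theorem exists_idempotent_sub_mem {R Λ : Type*} [CommRing R] [IsNoetherianRing R] (I : Ideal R)
    [IsAdicComplete I R] [CommRing Λ] [Algebra R Λ] [Module.Finite R Λ] (a : Λ)
    (ha : a ^ 2 - a ∈ I.map (algebraMap R Λ)) :
    ∃ e : Λ, IsIdempotentElem e ∧ e - a ∈ I.map (algebraMap R Λ) := by
  have h1 : IsAdicComplete I Λ := isAdicComplete_of_finite Λ I
  have h2 : IsAdicComplete (I.map (algebraMap R Λ)) Λ :=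
    (IsAdicComplete.map_algebraMap_iff I Λ).mpr h1
  have h3 := IsAdicComplete.henselianRing Λ (I.map (algebraMap R Λ))
  have hm : (Polynomial.X ^ 2 - Polynomial.X : Polynomial Λ).Monic := by
    nontriviality Λ
    apply Polynomial.monic_X_pow_sub
    simp
  obtain ⟨e, he, hea⟩ := h3.is_henselian (Polynomial.X ^ 2 - Polynomial.X) hm a
    (by simpa using ha) (by
      refine IsUnit.of_mul_eq_one
        (Ideal.Quotient.mk _ (Polynomial.eval a
          (Polynomial.derivative (Polynomial.X ^ 2 - Polynomial.X)))) ?_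
      rw [← map_mul, ← map_one (Ideal.Quotient.mk _), Ideal.Quotient.mk_eq_mk_iff_sub_mem]
      -- The derivative `2a - 1` is its own inverse modulo the ideal.
      have : Polynomial.eval a (Polynomial.derivative (Polynomial.X ^ 2 - Polynomial.X)) *
        Polynomial.eval a (Polynomial.derivative (Polynomial.X ^ 2 - Polynomial.X)) - 1
        = 4 * (a ^ 2 - a) := by
        simp
        ring
      rw [this]
      exact Ideal.mul_mem_left _ _ ha)
  refine ⟨e, ?_, hea⟩
  simpa [Polynomial.IsRoot, sub_eq_zero, pow_two, IsIdempotentElem] using he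

/-- In a finite commutative algebra with only trivial idempotents over a complete local ring every
element is a unit or nilpotent modulo the maximal ideal. -/
theorem isUnit_or_pow_mem_comm {R Λ : Type*} [CommRing R] [IsNoetherianRing R] [IsLocalRing R]
    [IsAdicComplete (IsLocalRing.maximalIdeal R) R] [CommRing Λ] [Algebra R Λ] [Module.Finite R Λ]
    (hΛ : ∀ e : Λ, IsIdempotentElem e → e = 0 ∨ e = 1) (a : Λ) :
    IsUnit a ∨ ∃ n, a ^ n ∈ (IsLocalRing.maximalIdeal R).map (algebraMap R Λ) := by
  set I := IsLocalRing.maximalIdeal R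
  set I' := I.map (algebraMap R Λ)
  have hart : IsArtinianRing (Λ ⧸ I') := by
    have : IsArtinian (R ⧸ I) (Λ ⧸ I') := by
      let _ : Field (R ⧸ I) := Ideal.Quotient.field I
      have : Module.Finite (R ⧸ I) (Λ ⧸ I') := by
        have : Module.Finite R (Λ ⧸ I') := Module.Finite.of_surjective
          (Ideal.Quotient.mkₐ R I').toLinearMap Ideal.Quotient.mk_surjective
        exact Module.Finite.of_restrictScalars_finite R _ _
      infer_instance
    exact isArtinian_of_tower (R ⧸ I) this
  obtain ⟨n, hn⟩ := IsArtinian.exists_pow_succ_smul_dvd (R := Λ ⧸ I') (M := Λ ⧸ I')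
    (Ideal.Quotient.mk I' a) 1
  obtain ⟨b, hb⟩ := hn
  obtain ⟨b, rfl⟩ := Ideal.Quotient.mk_surjective b
  set π := Ideal.Quotient.mk I'
  -- Fitting's argument: the powers of `a` stabilize in the Artinian quotient, so `a ^ n * b ^ n` is
  -- idempotent there. Its lift is `0` or `1`, which makes `a` nilpotent or invertible modulo `I'`;
  -- units then lift because `I'` lies in the Jacobson radical.
  have hb' : π a ^ n = π a ^ n * (π a * π b) := by
    simp only [smul_eq_mul, mul_one] at hb
    calc _ = π a ^ n.succ * π b := hb.symm
      _ = _ := by rw [pow_succ, mul_assoc]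
  have hb2 : ∀ m, π a ^ n = π a ^ n * (π a * π b) ^ m := by
    intro m
    induction m with
    | zero => simp
    | succ m ih => rw [pow_succ, ← mul_assoc, ← ih, ← hb']
  have hidem : (a ^ n * b ^ n) ^ 2 - a ^ n * b ^ n ∈ I' := by
    rw [← Ideal.Quotient.eq_zero_iff_mem, map_sub, sub_eq_zero]
    have := hb2 n
    simp only [map_mul, map_pow]
    calc _ = (π a ^ n * (π a * π b) ^ n) * π b ^ n := by ring
      _ = _ := by rw [← this]
  obtain ⟨e, he, hea⟩ := exists_idempotent_sub_mem I _ hidem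
  rw [← Ideal.Quotient.eq_zero_iff_mem, map_sub, sub_eq_zero] at hea
  rcases hΛ e he with rfl | rfl
  · right
    refine ⟨n, ?_⟩
    rw [← Ideal.Quotient.eq_zero_iff_mem, map_pow, hb2 n, mul_pow]
    simp only [map_zero, map_mul, map_pow] at hea
    change π a ^ n * (π a ^ n * π b ^ n) = 0
    rw [show π a ^ n * π b ^ n = 0 from hea.symm, mul_zero]
  · left
    have : IsAdicComplete I' Λ :=
      (IsAdicComplete.map_algebraMap_iff I Λ).mpr (isAdicComplete_of_finite Λ I)
    have := isLocalHom_of_le_jacobson_bot I' (IsAdicComplete.le_jacobson_bot I')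
    refine isUnit_of_map_unit π a ?_
    rcases n with _ | n
    · exact IsUnit.of_mul_eq_one _ (by simpa using hb'.symm)
    · refine IsUnit.of_mul_eq_one (π (a ^ n * b ^ (n + 1))) ?_
      rw [← map_mul, ← map_one π, hea]
      congr 1
      ring

/-- In a finite algebra with only trivial idempotents over a complete local ring every
element is a unit or nilpotent modulo the maximal ideal. -/
theorem isUnit_or_pow_mem {R Λ : Type*} [CommRing R] [IsNoetherianRing R] [IsLocalRing R]
    [IsAdicComplete (IsLocalRing.maximalIdeal R) R] [Ring Λ] [Algebra R Λ] [Module.Finite R Λ]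
    (hΛ : ∀ e : Λ, IsIdempotentElem e → e = 0 ∨ e = 1) (a : Λ) :
    IsUnit a ∨ ∃ n, a ^ n ∈ IsLocalRing.maximalIdeal R • (⊤ : Submodule R Λ) := by
  -- The commutative subalgebra `R[a]` is again finite, and its idempotents are idempotents of `Λ`.
  have := Algebra.isMulCommutative_adjoin R (s := {a}) (by simp)
  let _ : CommRing (Algebra.adjoin R {a}) := inferInstance
  have ha : a ∈ Algebra.adjoin R {a} := Algebra.self_mem_adjoin_singleton R a
  have : Module.Finite R (Algebra.adjoin R {a}) :=
    Module.Finite.of_injective (Algebra.adjoin R {a}).val.toLinearMap Subtype.val_injective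
  rcases isUnit_or_pow_mem_comm (R := R) (Λ := Algebra.adjoin R {a}) (fun e he => by
    rcases hΛ e (congrArg Subtype.val he) with h | h
    · exact Or.inl (Subtype.ext h)
    · exact Or.inr (Subtype.ext h)) ⟨a, ha⟩ with h | ⟨n, hn⟩
  · exact Or.inl (h.map (Algebra.adjoin R {a}).val)
  · refine Or.inr ⟨n, ?_⟩
    have h2 : (Algebra.adjoin R {a}).val.toLinearMap (⟨a, ha⟩ ^ n) ∈
        Submodule.map (Algebra.adjoin R {a}).val.toLinearMap
          (IsLocalRing.maximalIdeal R • (⊤ : Submodule R (Algebra.adjoin R {a}))) := by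
      refine Submodule.mem_map_of_mem ?_
      rw [Ideal.smul_top_eq_map]
      exact hn
    rw [Submodule.map_smul''] at h2
    exact (Submodule.smul_mono le_rfl le_top :
      _ ≤ IsLocalRing.maximalIdeal R • (⊤ : Submodule R Λ)) h2

end Complete

/-! ### Finite-dimensional algebras modulo nilpotent ideals. -/

section FiniteDimensional

variable {k : Type*} [Field k]

/-- The kernel of `f` is a nilpotent ideal, witnessed by a finite filtration. -/
def HasNilpotentKer {R S : Type*} [Ring R] [Algebra k R] [Ring S] [Algebra k S]
    (f : R →ₐ[k] S) : Prop :=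
  ∃ (F : ℕ → Submodule k R) (m : ℕ), F 0 = ⊤ ∧ F m = ⊥ ∧
    ∀ x y j, f x = 0 → y ∈ F j → x * y ∈ F (j + 1) ∧ y * x ∈ F (j + 1)

/-- A finite-dimensional algebra over an algebraically closed field is, modulo a nilpotent ideal,
a product of matrix algebras. -/
theorem exists_algHom_pi_matrix [IsAlgClosed k] (R : Type*) [Ring R] [Algebra k R]
    [FiniteDimensional k R] :
    ∃ (n : ℕ) (d : Fin n → ℕ) (π : R →ₐ[k] Π i, Matrix (Fin (d i)) (Fin (d i)) k),
      (∀ i, NeZero (d i)) ∧ Function.Surjective π ∧ HasNilpotentKer π := by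
  have := IsArtinianRing.of_finite k R
  have h1 : IsSemisimpleRing (R ⧸ Ring.jacobson R) := IsSemiprimaryRing.isSemisimpleRing
  have : FiniteDimensional k (R ⧸ Ring.jacobson R) := Module.Finite.of_surjective
    (Ideal.Quotient.mkₐ k (Ring.jacobson R)).toLinearMap Ideal.Quotient.mk_surjective
  obtain ⟨n, d, hd, ⟨e⟩⟩ :=
    IsSemisimpleRing.exists_algEquiv_pi_matrix_of_isAlgClosed k (R ⧸ Ring.jacobson R)
  refine ⟨n, d, e.toAlgHom.comp (Ideal.Quotient.mkₐ k (Ring.jacobson R)), hd,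
    e.surjective.comp Ideal.Quotient.mk_surjective, ?_⟩
  obtain ⟨m, hm⟩ := IsSemiprimaryRing.isNilpotent (R := R)
  refine ⟨fun j => (Ring.jacobson R ^ j).restrictScalars k, m, ?_, ?_, fun x y j hx hy => ?_⟩
  · simp [Submodule.pow_zero, Ideal.one_eq_top]
  · simp [hm]
  · have hx : x ∈ Ring.jacobson R := by simpa [Ideal.Quotient.eq_zero_iff_mem] using hx
    constructor
    · change _ ∈ Ring.jacobson R ^ (j + 1)
      rw [Ideal.IsTwoSided.pow_succ]
      exact Ideal.mul_mem_mul hx hy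
    · change _ ∈ Ring.jacobson R ^ (j + 1)
      rw [Submodule.pow_succ]
      exact Ideal.mul_mem_mul hy hx

variable {R S C D : Type*} [Ring R] [Algebra k R] [Ring S] [Algebra k S] [Ring C] [Algebra k C]
  [Ring D] [Algebra k D]

theorem HasNilpotentKer.isNilpotent {f : R →ₐ[k] S} (hf : HasNilpotentKer f) {x : R}
    (hx : f x = 0) : IsNilpotent x := by
  obtain ⟨F, m, h0, hm, h⟩ := hf
  have : ∀ j, x ^ j ∈ F j := by
    intro j
    induction j with
    | zero => simp [h0]
    | succ j ih => rw [pow_succ]; exact (h x _ j hx ih).2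
  exact ⟨m, by simpa [hm] using this m⟩

theorem HasNilpotentKer.op {f : R →ₐ[k] S} (hf : HasNilpotentKer f) :
    HasNilpotentKer (AlgHom.op f) := by
  obtain ⟨F, m, h0, hm, h⟩ := hf
  refine ⟨fun j => (F j).comap (MulOpposite.opLinearEquiv k).symm.toLinearMap, m, by simp [h0], ?_,
    fun x y j hx hy => ?_⟩
  · ext x
    simp [hm]
  · have := h x.unop y.unop j (by simpa using hx) (by simpa using hy)
    simpa using this.symm

/-- By right exactness the kernel of `f ⊗ id` is spanned by tensors `r ⊗ c` with `f r = 0`, and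
multiplying by these moves the filtration `F j ⊗ C` one step down. -/
theorem HasNilpotentKer.isNilpotent_tensor_id {f : R →ₐ[k] S} (hf : HasNilpotentKer f)
    (hs : Function.Surjective f) {z : R ⊗[k] C}
    (hz : Algebra.TensorProduct.map f (AlgHom.id k C) z = 0) : IsNilpotent z := by
  obtain ⟨F, m, h0, hm, h⟩ := hf
  let W : ℕ → Submodule k (R ⊗[k] C) := fun j =>
    Submodule.span k {t | ∃ r ∈ F j, ∃ c, t = r ⊗ₜ[k] c}
  have hzk : z ∈ Submodule.span k {t | ∃ r, f r = 0 ∧ ∃ c, t = r ⊗ₜ[k] c} := by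
    have h1 : z ∈ LinearMap.range (LinearMap.rTensor C (LinearMap.ker f.toLinearMap).subtype) := by
      have := (rTensor_exact C (LinearMap.exact_subtype_ker_map f.toLinearMap)
        (by exact hs)).linearMap_ker_eq
      rw [← this]
      exact hz
    clear hz
    obtain ⟨w, rfl⟩ := h1
    induction w with
    | zero => simp
    | add a b ha hb => rw [map_add]; exact add_mem ha hb
    | tmul r c => exact Submodule.subset_span ⟨r, r.2, c, rfl⟩
  have key : ∀ j, z ^ j ∈ W j := by
    intro j
    induction j with
    | zero =>
      rw [pow_zero, Algebra.TensorProduct.one_def]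
      exact Submodule.subset_span ⟨1, by simp [h0], 1, rfl⟩
    | succ j ih =>
      rw [pow_succ]
      generalize z ^ j = w at ih
      refine Submodule.span_induction₂ (p := fun a b _ _ => a * b ∈ W (j + 1)) ?_ ?_ ?_ ?_ ?_ ?_ ?_ ih hzk
      · rintro _ _ ⟨r, hr, c, rfl⟩ ⟨r', hr', c', rfl⟩
        rw [Algebra.TensorProduct.tmul_mul_tmul]
        exact Submodule.subset_span ⟨_, (h r' r j hr' hr).2, _, rfl⟩
      · intros; simp
      · intros; simp
      · intro x y z _ _ _ h1 h2; rw [add_mul]; exact add_mem h1 h2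
      · intro x y z _ _ _ h1 h2; rw [mul_add]; exact add_mem h1 h2
      · intro r x y _ _ h1; rw [smul_mul_assoc]; exact Submodule.smul_mem _ _ h1
      · intro r x y _ _ h1; rw [mul_smul_comm]; exact Submodule.smul_mem _ _ h1
  refine ⟨m, ?_⟩
  have := key m
  have hW : W m = ⊥ := by
    rw [Submodule.span_eq_bot]
    rintro _ ⟨r, hr, c, rfl⟩
    rw [hm, Submodule.mem_bot] at hr
    rw [hr, TensorProduct.zero_tmul]
  simpa [hW] using this

theorem HasNilpotentKer.isNilpotent_tensor {f : R →ₐ[k] S} (hf : HasNilpotentKer f)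
    (hs : Function.Surjective f) {g : C →ₐ[k] D} (hg : HasNilpotentKer g)
    (hgs : Function.Surjective g) {z : R ⊗[k] C}
    (hz : Algebra.TensorProduct.map f g z = 0) : IsNilpotent z := by
  have h1 : Algebra.TensorProduct.map f (AlgHom.id k D)
      (Algebra.TensorProduct.map (AlgHom.id k R) g z) = 0 := by
    rw [← hz, ← AlgHom.comp_apply, ← Algebra.TensorProduct.map_comp]
    rfl
  obtain ⟨m, hm⟩ := hf.isNilpotent_tensor_id hs h1
  rw [← map_pow] at hm
  have h2 : Algebra.TensorProduct.map g (AlgHom.id k R)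
      (Algebra.TensorProduct.comm k R C (z ^ m)) = 0 := by
    have : Algebra.TensorProduct.map g (AlgHom.id k R)
      (Algebra.TensorProduct.comm k R C (z ^ m)) = Algebra.TensorProduct.comm k R D
        (Algebra.TensorProduct.map (AlgHom.id k R) g (z ^ m)) := by
      generalize z ^ m = w
      induction w with
      | zero => simp
      | add a b ha hb => simp only [map_add, ha, hb]
      | tmul a b => simp
    rw [this, hm, map_zero]
  obtain ⟨l, hl⟩ := hg.isNilpotent_tensor_id hgs h2
  rw [← map_pow, EmbeddingLike.map_eq_zero_iff, ← pow_mul] at hl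
  exact ⟨_, hl⟩

/-- An idempotent which is congruent to a nilpotent element modulo the kernel of `f` lies in the
kernel of `f`. -/
theorem _root_.IsIdempotentElem.map_eq_zero_of_isNilpotent {R S : Type*} [Ring R] [Ring S]
    {f : R →+* S} {e n : R} (he : IsIdempotentElem e) (hn : IsNilpotent n) (h : f e = f n) :
    f e = 0 := by
  obtain ⟨m, hm⟩ := hn
  have h1 : f e ^ (m + 1) = f e := by
    rw [← map_pow, he.pow_succ_eq]
  rw [← h1, h, ← map_pow, pow_succ, hm, zero_mul, map_zero]

theorem eq_zero_of_isIdempotentElem_of_isNilpotent {R : Type*} [Ring R] {e : R}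
    (he : IsIdempotentElem e) (hn : IsNilpotent e) : e = 0 :=
  he.map_eq_zero_of_isNilpotent (f := RingHom.id R) hn rfl

/-- A finite-dimensional algebra with only trivial idempotents over an algebraically closed field
is the sum of the scalars and a nilpotent ideal. -/
theorem exists_algHom_of_trivial_idempotents [IsAlgClosed k] [Nontrivial R]
    [FiniteDimensional k R] (h : ∀ e : R, IsIdempotentElem e → e = 0 ∨ e = 1) :
    ∃ r : R →ₐ[k] k, HasNilpotentKer r := by
  classical
  obtain ⟨n, d, π, hd, hs, hnil⟩ := exists_algHom_pi_matrix (k := k) R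
  have hn : 0 < n := by
    rcases Nat.eq_zero_or_pos n with rfl | h0
    · have := hnil.isNilpotent (x := 1) (Subsingleton.elim _ _)
      exact absurd this not_isNilpotent_one
    · exact h0
  set i : Fin n := ⟨0, hn⟩
  have := hd i
  -- The idempotent `u` lifts to `R`, where only `0` and `1` are available, so `u = 1`: there is a
  -- single block, of size one.
  set u : Π i, Matrix (Fin (d i)) (Fin (d i)) k := Pi.single i (Matrix.single 0 0 1)
  have hu : IsIdempotentElem u := by
    simp [IsIdempotentElem, u, ← Pi.single_mul]
  obtain ⟨e, he, heu⟩ := exists_isIdempotentElem_eq_of_ker_isNilpotent π.toRingHom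
    (fun x hx => hnil.isNilpotent hx) u (RingHom.mem_range.mpr (hs u)) hu
  have h1 : u = 1 := by
    rcases h e he with rfl | rfl
    · exfalso
      have h2 : u i 0 0 = 0 := by rw [← heu]; simp
      simp [u] at h2
    · rw [← heu]; simp
  have key : ∀ x : Π i, Matrix (Fin (d i)) (Fin (d i)) k,
      x = Pi.single i (Matrix.single 0 0 (x i 0 0)) := by
    intro x
    conv_lhs => rw [← one_mul x, ← mul_one (1 * x), ← h1]
    funext j
    by_cases hj : j = i
    · subst hj
      simp [u]
    · simp [u, Pi.single_eq_of_ne hj]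
  let r : R →ₐ[k] k := AlgHom.ofLinearMap
    { toFun := fun x => π x i 0 0
      map_add' := by simp
      map_smul' := by simp } (by simp) (by
        intro x y
        simp only [LinearMap.coe_mk, AddHom.coe_mk, map_mul]
        rw [key (π x), key (π y)]
        simp)
  refine ⟨r, ?_⟩
  obtain ⟨F, m, h0, hm, hF⟩ := hnil
  refine ⟨F, m, h0, hm, fun x y j hx hy => hF x y j ?_ hy⟩
  rw [key (π x), show π x i 0 0 = 0 from hx]
  simp

/-- The kernel of `r ⊗ r' : R ⊗ C → k` is nil, so it contains no nonzero idempotent; apply this to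
`e` or to `1 - e`. It matters that both residue algebras are `k` itself. -/
theorem tensor_idempotent_trivial {r : R →ₐ[k] k} (hr : HasNilpotentKer r)
    {r' : C →ₐ[k] k} (hr' : HasNilpotentKer r') (e : R ⊗[k] C) (he : IsIdempotentElem e) :
    e = 0 ∨ e = 1 := by
  have hs : Function.Surjective r := fun c => ⟨algebraMap k R c, by simp⟩
  have hs' : Function.Surjective r' := fun c => ⟨algebraMap k C c, by simp⟩
  have key : ∀ e : R ⊗[k] C, IsIdempotentElem e →
      Algebra.TensorProduct.lid k k (Algebra.TensorProduct.map r r' e) = 0 → e = 0 := by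
    intro e he h
    rw [EmbeddingLike.map_eq_zero_iff] at h
    exact eq_zero_of_isIdempotentElem_of_isNilpotent he (hr.isNilpotent_tensor hs hr' hs' h)
  have h1 : IsIdempotentElem (Algebra.TensorProduct.lid k k (Algebra.TensorProduct.map r r' e)) :=
    (he.map (Algebra.TensorProduct.map r r')).map (Algebra.TensorProduct.lid k k)
  rcases IsIdempotentElem.iff_eq_zero_or_one.mp h1 with h | h
  · exact Or.inl (key e he h)
  · refine Or.inr (sub_eq_zero.mp (key (1 - e) he.one_sub ?_)).symm
    rw [map_sub, map_sub, h]
    simp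

end FiniteDimensional

/-! ### The trace of a `p`-th power in characteristic `p`. -/

section Trace

open Polynomial in
-- In characteristic `p`, `det(X - M) ^ p = det(X ^ p - M ^ p)`. So the characteristic polynomial of
-- `M ^ p` arises from that of `M` by applying Frobenius to the coefficients.
theorem trace_pow_char {K n : Type*} [Field K] [Fintype n] [DecidableEq n] (p : ℕ) [Fact p.Prime]
    [CharP K p] (M : Matrix n n K) : (M ^ p).trace = M.trace ^ p := by
  cases isEmpty_or_nonempty n
  · simp [Matrix.trace, (Fact.out : p.Prime).ne_zero]
  have h : expand K p (M ^ p).charpoly = M.charpoly ^ p := by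
    unfold Matrix.charpoly
    rw [AlgHom.map_det, ← Matrix.coe_detMonoidHom,
      ← (Matrix.detMonoidHom : Matrix n n K[X] →* K[X]).map_pow]
    apply congr_arg Matrix.det
    refine matPolyEquiv.injective ?_
    rw [map_pow, Matrix.matPolyEquiv_charmatrix, sub_pow_char_of_commute _ ((Polynomial.C M).commute_X),
      ← Polynomial.C_pow]
    exact (id (matPolyEquiv_eq_X_pow_sub_C p M) :)
  rw [← Polynomial.map_frobenius_expand p, Polynomial.map_expand] at h
  have h2 := Polynomial.expand_injective (Fact.out : p.Prime).pos h
  rw [Matrix.trace_eq_neg_charpoly_coeff, Matrix.trace_eq_neg_charpoly_coeff, h2,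
    Polynomial.coeff_map, ← map_neg, frobenius_def]

end Trace

/-! ### Relative traces between subgroups and kernels of Brauer maps. -/

section Traces

variable {O P M N : Type*} [CommRing O] [Group P] [AddCommGroup M] [Module O M]
  [AddCommGroup N] [Module O N]

theorem fixedBy_anti (ρ : Representation O P M) {R Q : Subgroup P} (h : R ≤ Q) :
    fixedBy ρ Q ≤ fixedBy ρ R := fun _ hm q hq => hm q (h hq)

theorem apply_eq_apply_of_mk_eq {ρ : Representation O P M} {R : Subgroup P} {m : M}
    (hm : m ∈ fixedBy ρ R) {x y : P} (h : (QuotientGroup.mk x : P ⧸ R) = QuotientGroup.mk y) :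
    ρ x m = ρ y m := apply_eq_of_mk_eq ρ R ⟨m, hm⟩ h

theorem apply_out {ρ : Representation O P M} {R : Subgroup P} {m : M}
    (hm : m ∈ fixedBy ρ R) (x : P) : ρ (QuotientGroup.mk x : P ⧸ R).out m = ρ x m :=
  apply_eq_apply_of_mk_eq hm (QuotientGroup.out_eq' _)

theorem apply_out_smul {ρ : Representation O P M} {R : Subgroup P} {m : M}
    (hm : m ∈ fixedBy ρ R) (g : P) (y : P ⧸ R) : ρ (g • y).out m = ρ g (ρ y.out m) := by
  rw [← Module.End.mul_apply, ← map_mul]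
  refine apply_eq_apply_of_mk_eq hm ?_
  rw [QuotientGroup.out_eq']
  conv_lhs => rw [← QuotientGroup.out_eq' y]
  rfl

variable [Finite P]

/-- The left cosets of `R` which meet `Q`. -/
def cosetsIn (R Q : Subgroup P) : Finset (P ⧸ R) :=
  (Set.toFinite {y : P ⧸ R | ∃ q ∈ Q, QuotientGroup.mk q = y}).toFinset

theorem mem_cosetsIn {R Q : Subgroup P} {y : P ⧸ R} :
    y ∈ cosetsIn R Q ↔ ∃ q ∈ Q, QuotientGroup.mk q = y := by
  simp [cosetsIn]

theorem out_mem_of_mem_cosetsIn {R Q : Subgroup P} (h : R ≤ Q) {y : P ⧸ R}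
    (hy : y ∈ cosetsIn R Q) : y.out ∈ Q := by
  obtain ⟨q, hq, rfl⟩ := mem_cosetsIn.mp hy
  have h1 : q⁻¹ * (QuotientGroup.mk q : P ⧸ R).out ∈ R :=
    QuotientGroup.eq.mp (QuotientGroup.out_eq' _).symm
  simpa using Q.mul_mem hq (h h1)

theorem smul_mem_cosetsIn {R Q : Subgroup P} {q : P} (hq : q ∈ Q) {y : P ⧸ R} :
    q • y ∈ cosetsIn R Q ↔ y ∈ cosetsIn R Q := by
  simp only [mem_cosetsIn]
  constructor
  · rintro ⟨q', hq', h⟩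
    exact ⟨q⁻¹ * q', Q.mul_mem (Q.inv_mem hq) hq', by rw [eq_inv_smul_iff.mpr h.symm]; rfl⟩
  · rintro ⟨q', hq', rfl⟩
    exact ⟨q * q', Q.mul_mem hq hq', rfl⟩

/-- The relative trace `Tr_R^Q` for subgroups `R ≤ Q` of `P`. -/
def tr (ρ : Representation O P M) (R Q : Subgroup P) : M →ₗ[O] M :=
  ∑ y ∈ cosetsIn R Q, ρ y.out

theorem tr_apply (ρ : Representation O P M) (R Q : Subgroup P) (m : M) :
    tr ρ R Q m = ∑ y ∈ cosetsIn R Q, ρ y.out m := by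
  simp [tr]

theorem tr_mem_fixedBy {ρ : Representation O P M} {R Q : Subgroup P} {m : M}
    (hm : m ∈ fixedBy ρ R) : tr ρ R Q m ∈ fixedBy ρ Q := by
  intro q hq
  rw [tr_apply, map_sum]
  refine Finset.sum_bij (fun y _ => q • y) (fun y hy => (smul_mem_cosetsIn hq).mpr hy)
    (fun y _ z _ h => smul_left_cancel q h) (fun y hy => ⟨q⁻¹ • y, ?_, by simp⟩) fun y _ => ?_
  · exact (smul_mem_cosetsIn (Q.inv_mem hq)).mpr hy
  · rw [apply_out_smul hm]

/-- The relative trace computed over an orbit. -/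
theorem sum_orbit_eq_tr {Y : Type*} [MulAction P Y] (ρ : Representation O P M)
    (Q : Subgroup P) (f : Y → M) (hf : ∀ q ∈ Q, ∀ y, f (q • y) = ρ q (f y)) (y : Y)
    (s : Finset Y) (hs : ∀ z, z ∈ s ↔ ∃ q ∈ Q, q • y = z) :
    ∑ z ∈ s, f z = tr ρ (MulAction.stabilizer P y ⊓ Q) Q (f y) := by
  rw [tr_apply]
  symm
  have hout : ∀ q ∈ Q, (QuotientGroup.mk q : P ⧸ (MulAction.stabilizer P y ⊓ Q)).out • y = q • y := by
    intro q hq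
    have h1 : q⁻¹ * (QuotientGroup.mk q : P ⧸ (MulAction.stabilizer P y ⊓ Q)).out ∈
        MulAction.stabilizer P y ⊓ Q := QuotientGroup.eq.mp (QuotientGroup.out_eq' _).symm
    have h2 := (Subgroup.mem_inf.mp h1).1
    rw [MulAction.mem_stabilizer_iff, mul_smul, inv_smul_eq_iff] at h2
    exact h2
  refine Finset.sum_bij (fun z _ => z.out • y) ?_ ?_ ?_ ?_
  · intro z hz
    exact (hs _).mpr ⟨z.out, out_mem_of_mem_cosetsIn inf_le_right hz, rfl⟩
  · intro z hz z' hz' h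
    rw [← QuotientGroup.out_eq' z, ← QuotientGroup.out_eq' z']
    refine QuotientGroup.eq.mpr (Subgroup.mem_inf.mpr ⟨?_, Q.mul_mem
      (Q.inv_mem (out_mem_of_mem_cosetsIn inf_le_right hz))
      (out_mem_of_mem_cosetsIn inf_le_right hz')⟩)
    rw [MulAction.mem_stabilizer_iff, mul_smul, inv_smul_eq_iff]
    exact h.symm
  · intro z hz
    obtain ⟨q, hq, rfl⟩ := (hs _).mp hz
    exact ⟨QuotientGroup.mk q, mem_cosetsIn.mpr ⟨q, hq, rfl⟩, hout q hq⟩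
  · intro z hz
    exact (hf _ (out_mem_of_mem_cosetsIn inf_le_right hz) y).symm

/-- The cosets of `R'` in `Q` are grouped according to the coset of `R` containing them. -/
theorem tr_trans {ρ : Representation O P M} {R' R Q : Subgroup P} (h : R' ≤ R) (h' : R ≤ Q)
    {m : M} (hm : m ∈ fixedBy ρ R') : tr ρ R Q (tr ρ R' R m) = tr ρ R' Q m := by
  classical
  rw [tr_apply, tr_apply ρ R' Q]
  have hmap : ∀ z ∈ cosetsIn R' Q, Subgroup.quotientMapOfLE h z ∈ cosetsIn R Q := by
    intro z hz
    obtain ⟨q, hq, rfl⟩ := mem_cosetsIn.mp hz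
    exact mem_cosetsIn.mpr ⟨q, hq, rfl⟩
  have hsm : ∀ (g : P) (z : P ⧸ R'), Subgroup.quotientMapOfLE h (g • z) =
      g • Subgroup.quotientMapOfLE h z := by
    intro g z
    induction z using QuotientGroup.induction_on
    rfl
  rw [← Finset.sum_fiberwise_of_maps_to hmap]
  refine Finset.sum_congr rfl fun y hy => ?_
  rw [tr_apply, map_sum]
  have hyQ := out_mem_of_mem_cosetsIn h' hy
  have hy1 : y.out • (QuotientGroup.mk 1 : P ⧸ R) = y := by
    conv_rhs => rw [← QuotientGroup.out_eq' y]
    rw [MulAction.Quotient.smul_mk]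
    simp
  have hR : ∀ r ∈ R, (QuotientGroup.mk r : P ⧸ R) = QuotientGroup.mk 1 := fun r hr =>
    QuotientGroup.eq.mpr (by simpa using hr)
  refine Finset.sum_bij (fun z _ => y.out • z) ?_ (fun y _ z _ h => smul_left_cancel _ h) ?_ ?_
  · intro z hz
    obtain ⟨r, hr, rfl⟩ := mem_cosetsIn.mp hz
    refine Finset.mem_filter.mpr ⟨(smul_mem_cosetsIn hyQ).mpr (mem_cosetsIn.mpr ⟨r, h' hr, rfl⟩), ?_⟩
    rw [hsm]
    change y.out • (QuotientGroup.mk r : P ⧸ R) = y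
    rw [hR r hr, hy1]
  · intro z hz
    obtain ⟨hz, hzy⟩ := Finset.mem_filter.mp hz
    refine ⟨y.out⁻¹ • z, ?_, by simp⟩
    induction z using QuotientGroup.induction_on with
    | _ g =>
    refine mem_cosetsIn.mpr ⟨y.out⁻¹ * g, ?_, rfl⟩
    change (QuotientGroup.mk g : P ⧸ R) = y at hzy
    rw [← QuotientGroup.out_eq' y] at hzy
    exact QuotientGroup.eq.mp hzy.symm
  · intro z hz
    rw [apply_out_smul hm]

/-- The submodule of `M^Q` generated by the relative traces from proper subgroups of `Q`. -/
def properTr (ρ : Representation O P M) (Q : Subgroup P) : Submodule O M :=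
  Submodule.span O {t | ∃ R < Q, ∃ m ∈ fixedBy ρ R, tr ρ R Q m = t}

theorem tr_mem_properTr {ρ : Representation O P M} {R Q : Subgroup P} (h : R < Q) {m : M}
    (hm : m ∈ fixedBy ρ R) : tr ρ R Q m ∈ properTr ρ Q :=
  Submodule.subset_span ⟨R, h, m, hm, rfl⟩

theorem properTr_le (ρ : Representation O P M) (Q : Subgroup P) :
    properTr ρ Q ≤ fixedBy ρ Q := by
  refine Submodule.span_le.mpr ?_
  rintro _ ⟨R, _, m, hm, rfl⟩
  exact tr_mem_fixedBy hm

/-- The sum of an equivariant family over a set without fixed points is a sum of proper traces. -/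
theorem sum_mem_properTr {Y : Type*} [MulAction P Y] (ρ : Representation O P M)
    (Q : Subgroup P) (f : Y → M) (hf : ∀ q ∈ Q, ∀ y, f (q • y) = ρ q (f y))
    (s : Finset Y) (hs : ∀ q ∈ Q, ∀ y ∈ s, q • y ∈ s) (hfix : ∀ y ∈ s, ∃ q ∈ Q, q • y ≠ y) :
    ∑ y ∈ s, f y ∈ properTr ρ Q := by
  classical
  induction s using Finset.strongInduction with
  | _ s ih =>
  rcases s.eq_empty_or_nonempty with rfl | ⟨y, hy⟩
  · simp
  set o : Finset Y := s.filter fun z => ∃ q ∈ Q, q • y = z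
  have ho : ∀ z, z ∈ o ↔ ∃ q ∈ Q, q • y = z := by
    intro z
    simp only [o, Finset.mem_filter, and_iff_right_iff_imp]
    rintro ⟨q, hq, rfl⟩
    exact hs q hq y hy
  have hyo : y ∈ o := (ho y).mpr ⟨1, Q.one_mem, one_smul _ _⟩
  have hos : o ⊆ s := Finset.filter_subset _ _
  rw [← Finset.sum_sdiff hos]
  refine add_mem (ih _ (Finset.sdiff_ssubset hos ⟨y, hyo⟩) ?_ ?_) ?_
  · intro q hq z hz
    rw [Finset.mem_sdiff] at hz ⊢
    refine ⟨hs q hq z hz.1, fun h => hz.2 ?_⟩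
    obtain ⟨q', hq', h'⟩ := (ho _).mp h
    exact (ho _).mpr ⟨q⁻¹ * q', Q.mul_mem (Q.inv_mem hq) hq', by
      rw [mul_smul, h', inv_smul_smul]⟩
  · intro z hz
    exact hfix z (Finset.mem_sdiff.mp hz).1
  · rw [sum_orbit_eq_tr ρ Q f hf y o ho]
    refine tr_mem_properTr (lt_of_le_of_ne inf_le_right fun h => ?_) ?_
    · obtain ⟨q, hq, hne⟩ := hfix y hy
      rw [inf_eq_right] at h
      exact hne (h hq)
    · intro g hg
      rw [← hf g hg.2, hg.1]

/-- Every `Q`-orbit which is not a point contributes a trace from the proper stabilizer. Hence only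
`Q`-fixed indices survive in a Brauer quotient; this is how permutation bases are used throughout.
-/
theorem sum_sub_sum_fixed_mem_properTr {Y : Type*} [Fintype Y] [MulAction P Y]
    (ρ : Representation O P M) (Q : Subgroup P) (f : Y → M)
    (hf : ∀ q ∈ Q, ∀ y, f (q • y) = ρ q (f y)) (s : Finset Y)
    (hs : ∀ y, y ∈ s ↔ ∀ q ∈ Q, q • y = y) :
    ∑ y, f y - ∑ y ∈ s, f y ∈ properTr ρ Q := by
  classical
  have h1 : ∑ y, f y - ∑ y ∈ s, f y = ∑ y ∈ Finset.univ \ s, f y := by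
    rw [← Finset.sum_sdiff (Finset.subset_univ s), add_sub_cancel_right]
  rw [h1]
  refine sum_mem_properTr ρ Q f hf _ ?_ ?_
  · intro q hq y hy
    rw [Finset.mem_sdiff, hs] at hy ⊢
    refine ⟨Finset.mem_univ _, fun h => hy.2 fun q' hq' => ?_⟩
    have := h (q * q' * q⁻¹) (Q.mul_mem (Q.mul_mem hq hq') (Q.inv_mem hq))
    rw [mul_smul, inv_smul_smul, mul_smul] at this
    exact smul_left_cancel q this
  · intro y hy
    rw [Finset.mem_sdiff, hs] at hy
    simpa using hy.2

omit [Finite P] in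
theorem map_mem_fixedBy {ρ : Representation O P M} {ρ' : Representation O P N} {Q : Subgroup P}
    {h : M →ₗ[O] N} (hh : ∀ q ∈ Q, ∀ m, h (ρ q m) = ρ' q (h m)) {m : M} (hm : m ∈ fixedBy ρ Q) :
    h m ∈ fixedBy ρ' Q := fun q hq => by rw [← hh q hq, hm q hq]

theorem map_tr {ρ : Representation O P M} {ρ' : Representation O P N} {R Q : Subgroup P}
    (hRQ : R ≤ Q) {h : M →ₗ[O] N} (hh : ∀ q ∈ Q, ∀ m, h (ρ q m) = ρ' q (h m)) (m : M) :
    h (tr ρ R Q m) = tr ρ' R Q (h m) := by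
  rw [tr_apply, tr_apply, map_sum]
  exact Finset.sum_congr rfl fun y hy => hh _ (out_mem_of_mem_cosetsIn hRQ hy) m

theorem map_mem_properTr {ρ : Representation O P M} {ρ' : Representation O P N} {Q : Subgroup P}
    {h : M →ₗ[O] N} (hh : ∀ q ∈ Q, ∀ m, h (ρ q m) = ρ' q (h m)) {m : M} (hm : m ∈ properTr ρ Q) :
    h m ∈ properTr ρ' Q := by
  suffices properTr ρ Q ≤ (properTr ρ' Q).comap h from this hm
  refine Submodule.span_le.mpr ?_
  rintro _ ⟨R, hR, m, hm, rfl⟩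
  rw [SetLike.mem_coe, Submodule.mem_comap, map_tr hR.le hh]
  exact tr_mem_properTr hR (map_mem_fixedBy (fun q hq => hh q (hR.le hq)) hm)

variable [IsLocalRing O]

/-- The kernel `∑_{R < Q} Tr_R^Q(M^R) + J(O) M^Q` of the Brauer map `M^Q → M(Q)`. -/
def brKer (ρ : Representation O P M) (Q : Subgroup P) : Submodule O M :=
  properTr ρ Q ⊔ IsLocalRing.maximalIdeal O • fixedBy ρ Q

theorem properTr_le_brKer (ρ : Representation O P M) (Q : Subgroup P) :
    properTr ρ Q ≤ brKer ρ Q := le_sup_left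

theorem smul_mem_brKer {ρ : Representation O P M} {Q : Subgroup P} {c : O}
    (hc : c ∈ IsLocalRing.maximalIdeal O) {m : M} (hm : m ∈ fixedBy ρ Q) : c • m ∈ brKer ρ Q :=
  Submodule.mem_sup_right (Submodule.smul_mem_smul hc hm)

theorem brKer_le (ρ : Representation O P M) (Q : Subgroup P) : brKer ρ Q ≤ fixedBy ρ Q :=
  sup_le (properTr_le ρ Q) Submodule.smul_le_right

theorem brKer_induction {ρ : Representation O P M} {Q : Subgroup P} {p : M → Prop}
    (htr : ∀ R < Q, ∀ m ∈ fixedBy ρ R, p (tr ρ R Q m))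
    (hsmul : ∀ c ∈ IsLocalRing.maximalIdeal O, ∀ m ∈ fixedBy ρ Q, p (c • m))
    (hadd : ∀ m n, p m → p n → p (m + n)) (h0 : p 0) (hs : ∀ (c : O) m, p m → p (c • m))
    {m : M} (hm : m ∈ brKer ρ Q) : p m := by
  let W : Submodule O M :=
    { carrier := {m | p m}, zero_mem' := h0, add_mem' := fun ha hb => hadd _ _ ha hb
      smul_mem' := fun c m hm => hs c m hm }
  have : brKer ρ Q ≤ W := by
    refine sup_le (Submodule.span_le.mpr ?_) (Submodule.smul_le.mpr ?_)
    · rintro _ ⟨R, hR, m, hm, rfl⟩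
      exact htr R hR m hm
    · exact hsmul
  exact this hm

theorem map_mem_brKer {ρ : Representation O P M} {ρ' : Representation O P N} {Q : Subgroup P}
    {h : M →ₗ[O] N} (hh : ∀ q ∈ Q, ∀ m, h (ρ q m) = ρ' q (h m)) {m : M} (hm : m ∈ brKer ρ Q) :
    h m ∈ brKer ρ' Q := by
  refine brKer_induction (p := fun m => h m ∈ brKer ρ' Q) ?_ ?_ ?_ ?_ ?_ hm
  · intro R hR m hm
    exact properTr_le_brKer _ _ (map_mem_properTr hh (tr_mem_properTr hR hm))
  · intro c hc m hm
    rw [map_smul]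
    exact smul_mem_brKer hc (map_mem_fixedBy hh hm)
  · intro m n hm hn
    rw [map_add]; exact add_mem hm hn
  · simp
  · intro c m hm
    rw [map_smul]; exact Submodule.smul_mem _ _ hm

/-- These cosets form a `Q`-orbit, whose size is a power of `p`; the exponent is not zero since `R ≠
Q`. -/
theorem dvd_card_cosetsIn {p : ℕ} [Fact p.Prime] (hP : IsPGroup p P) {R Q : Subgroup P}
    (h : R < Q) : p ∣ (cosetsIn R Q).card := by
  have hset : {y : P ⧸ R | ∃ q ∈ Q, QuotientGroup.mk q = y} =
      MulAction.orbit Q (QuotientGroup.mk 1 : P ⧸ R) := by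
    ext y
    constructor
    · rintro ⟨q, hq, rfl⟩
      exact ⟨⟨q, hq⟩, congrArg QuotientGroup.mk (mul_one q)⟩
    · rintro ⟨q, rfl⟩
      exact ⟨q, q.2, (congrArg QuotientGroup.mk (mul_one (q : P))).symm⟩
  have h1 : (cosetsIn R Q).card = Nat.card (MulAction.orbit Q (QuotientGroup.mk 1 : P ⧸ R)) := by
    rw [cosetsIn, ← Set.ncard_eq_toFinset_card _ (Set.toFinite _), hset, ← Nat.card_coe_set_eq]
  obtain ⟨n, hn⟩ := (hP.to_subgroup Q).card_orbit (QuotientGroup.mk 1 : P ⧸ R)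
  rw [h1, hn]
  refine dvd_pow_self p fun h0 => ?_
  rw [h0, pow_zero, ← h1, Finset.card_eq_one] at hn
  obtain ⟨y, hy⟩ := hn
  refine h.not_ge fun q hq => ?_
  have h2 : (QuotientGroup.mk 1 : P ⧸ R) ∈ cosetsIn R Q := mem_cosetsIn.mpr ⟨1, Q.one_mem, rfl⟩
  have h3 : (QuotientGroup.mk q : P ⧸ R) ∈ cosetsIn R Q := mem_cosetsIn.mpr ⟨q, hq, rfl⟩
  rw [hy, Finset.mem_singleton] at h2 h3
  simpa using QuotientGroup.eq.mp (h2.trans h3.symm)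

/-- A `Q`-invariant linear form maps the kernel of the Brauer map to the maximal ideal. -/
theorem form_mem_maximalIdeal {p : ℕ} [Fact p.Prime] (hP : IsPGroup p P)
    [CharP (IsLocalRing.ResidueField O) p] {ρ : Representation O P M} {Q : Subgroup P}
    {t : M →ₗ[O] O} (ht : ∀ q ∈ Q, ∀ m, t (ρ q m) = t m) {m : M} (hm : m ∈ brKer ρ Q) :
    t m ∈ IsLocalRing.maximalIdeal O := by
  refine brKer_induction (p := fun m => t m ∈ IsLocalRing.maximalIdeal O) ?_ ?_ ?_ ?_ ?_ hm
  · intro R hR m hm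
    have h1 : t (tr ρ R Q m) = ((cosetsIn R Q).card : O) * t m := by
      rw [tr_apply, map_sum, Finset.sum_congr rfl
        fun y hy => ht _ (out_mem_of_mem_cosetsIn hR.le hy) m]
      simp
    rw [h1]
    refine Ideal.mul_mem_right _ _ ?_
    rw [← IsLocalRing.residue_eq_zero_iff, map_natCast, CharP.cast_eq_zero_iff _ p]
    exact dvd_card_cosetsIn hP hR
  · intro c hc m hm
    rw [map_smul]
    exact Ideal.mul_mem_right _ _ hc
  · intro m n hm hn
    rw [map_add]; exact add_mem hm hn
  · simp
  · intro c m hm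
    rw [map_smul]; exact Ideal.mul_mem_left _ _ hm

end Traces

/-! ### Permutation bases and the Brauer quotient of a permutation module. -/

section StableBasis

variable {O P M : Type*} [CommRing O] [Group P] [AddCommGroup M] [Module O M]

/-- A basis of `M`, indexed by a `P`-set, which is permuted by `P`. -/
structure PermBasis (X : Type*) [MulAction P X] (ρ : Representation O P M) where
  basis : Module.Basis X O M
  apply_basis : ∀ g x, ρ g (basis x) = basis (g • x)

theorem HasStableBasis.exists_permBasis {ρ : Representation O P M} (h : HasStableBasis ρ) :
    ∃ (X : Set M) (_ : MulAction P X), Nonempty (PermBasis X ρ) := by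
  obtain ⟨X, hli, hsp, hst⟩ := h
  let act : MulAction P X :=
    { smul := fun g x => ⟨ρ g x, hst g x x.2⟩
      one_smul := fun x => Subtype.ext (by
        change ρ 1 (x : M) = x
        simp)
      mul_smul := fun g h x => Subtype.ext (by
        change ρ (g * h) (x : M) = ρ g (ρ h x)
        simp) }
  have hli' : LinearIndependent O (fun x : X => (x : M)) := hli
  refine ⟨X, act, ⟨⟨Module.Basis.mk (v := fun x : X => (x : M)) hli' (by simp [hsp]), ?_⟩⟩⟩
  intro g x
  rw [Module.Basis.mk_apply, Module.Basis.mk_apply]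
  rfl

namespace PermBasis

variable {X : Type*} [MulAction P X] {ρ : Representation O P M} (b : PermBasis X ρ)
include b

theorem repr_apply_smul (g : P) (m : M) (x : X) :
    b.basis.repr (ρ g m) (g • x) = b.basis.repr m x := by
  have h : (b.basis.coord (g • x)).comp (ρ g) = b.basis.coord x := by
    classical
    refine b.basis.ext fun y => ?_
    simp [b.apply_basis, Finsupp.single_apply]
  exact LinearMap.congr_fun h m

theorem coord_apply_of_fixed {Q : Subgroup P} {x : X} (hx : ∀ q ∈ Q, q • x = x) {q : P}
    (hq : q ∈ Q) (m : M) : b.basis.coord x (ρ q m) = b.basis.coord x m := by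
  have := b.repr_apply_smul q m x
  rwa [hx q hq] at this

theorem mem_fixedBy_iff {Q : Subgroup P} {m : M} :
    m ∈ fixedBy ρ Q ↔ ∀ q ∈ Q, ∀ x, b.basis.repr m (q • x) = b.basis.repr m x := by
  constructor
  · intro hm q hq x
    conv_lhs => rw [← hm q hq]
    exact b.repr_apply_smul q m x
  · intro h q hq
    refine b.basis.ext_elem fun x => ?_
    rw [← smul_inv_smul q x, b.repr_apply_smul, h q hq]

variable [Finite P] [Fintype X] [IsLocalRing O]

omit [IsLocalRing O] in
/-- An invariant element is, up to proper traces, the part of it supported on the fixed points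
of the basis. -/
theorem sub_sum_fixed_mem_properTr {Q : Subgroup P} {m : M} (hm : m ∈ fixedBy ρ Q) (s : Finset X)
    (hs : ∀ x, x ∈ s ↔ ∀ q ∈ Q, q • x = x) :
    m - ∑ x ∈ s, b.basis.repr m x • b.basis x ∈ properTr ρ Q := by
  have h := sum_sub_sum_fixed_mem_properTr ρ Q (fun x => b.basis.repr m x • b.basis x)
    (fun q hq x => by rw [b.mem_fixedBy_iff.mp hm q hq, (ρ q).map_smul, b.apply_basis]) s hs
  rwa [b.basis.sum_repr m] at h

/-- This says that the `Q`-fixed basis elements give a basis of `M(Q)` over the residue field.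
Coordinates at fixed points are invariant forms, so they send the kernel into the maximal ideal; the
other coordinates only contribute proper traces. -/
theorem mem_brKer_iff {p : ℕ} [Fact p.Prime] (hP : IsPGroup p P)
    [CharP (IsLocalRing.ResidueField O) p] {Q : Subgroup P} {m : M} (hm : m ∈ fixedBy ρ Q) :
    m ∈ brKer ρ Q ↔
      ∀ x, (∀ q ∈ Q, q • x = x) → b.basis.repr m x ∈ IsLocalRing.maximalIdeal O := by
  classical
  constructor
  · intro h x hx
    exact form_mem_maximalIdeal hP (t := b.basis.coord x)
      (fun q hq m => b.coord_apply_of_fixed hx hq m) h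
  · intro h
    set s : Finset X := Finset.univ.filter fun x => ∀ q ∈ Q, q • x = x
    have hs : ∀ x, x ∈ s ↔ ∀ q ∈ Q, q • x = x := by simp [s]
    rw [← sub_add_cancel m (∑ x ∈ s, b.basis.repr m x • b.basis x)]
    refine add_mem (properTr_le_brKer _ _ (b.sub_sum_fixed_mem_properTr hm s hs)) ?_
    refine sum_mem fun x hx => smul_mem_brKer (h x ((hs x).mp hx)) fun q hq => ?_
    rw [b.apply_basis, (hs x).mp hx q hq]

end PermBasis

end StableBasis

/-! ### The Brauer quotient of an interior algebra as an algebra over the residue field. -/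

section InteriorAlgebras

open IsLocalRing

variable {O P A : Type*} [CommRing O] [Group P] [Ring A] [Algebra O A]

theorem conj_mul (σ : P →* Aˣ) (g : P) (a b : A) :
    conj (O := O) σ g (a * b) = conj (O := O) σ g a * conj (O := O) σ g b := by
  simp [conj_apply, mul_assoc]

theorem conj_one (σ : P →* Aˣ) (g : P) : conj (O := O) σ g 1 = 1 := by
  simp [conj_apply]

theorem mul_mem_fixedBy {σ : P →* Aˣ} {Q : Subgroup P} {a b : A}
    (ha : a ∈ fixedBy (conj (O := O) σ) Q) (hb : b ∈ fixedBy (conj (O := O) σ) Q) :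
    a * b ∈ fixedBy (conj (O := O) σ) Q := fun q hq => by rw [conj_mul, ha q hq, hb q hq]

theorem one_mem_fixedBy (σ : P →* Aˣ) (Q : Subgroup P) : (1 : A) ∈ fixedBy (conj (O := O) σ) Q :=
  fun q _ => conj_one σ q

/-- The subalgebra `A^Q`. -/
def fixAlg (O : Type*) [CommRing O] [Algebra O A] (σ : P →* Aˣ) (Q : Subgroup P) :
    Subalgebra O A where
  carrier := fixedBy (conj (O := O) σ) Q
  mul_mem' := mul_mem_fixedBy
  add_mem' := add_mem
  algebraMap_mem' r := by
    rw [Algebra.algebraMap_eq_smul_one]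
    exact Submodule.smul_mem _ r (one_mem_fixedBy σ Q)

theorem mem_fixAlg {σ : P →* Aˣ} {Q : Subgroup P} {a : A} :
    a ∈ fixAlg O σ Q ↔ a ∈ fixedBy (conj (O := O) σ) Q := Iff.rfl

instance [IsNoetherianRing O] [Module.Finite O A] (σ : P →* Aˣ) (Q : Subgroup P) :
    Module.Finite O (fixAlg O σ Q) :=
  inferInstanceAs (Module.Finite O (Subalgebra.toSubmodule (fixAlg O σ Q)))

variable [Finite P]

theorem mul_tr {σ : P →* Aˣ} {R Q : Subgroup P} (h : R ≤ Q) {a : A}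
    (ha : a ∈ fixedBy (conj (O := O) σ) Q) (m : A) :
    a * tr (conj (O := O) σ) R Q m = tr (conj (O := O) σ) R Q (a * m) := by
  rw [tr_apply, tr_apply, Finset.mul_sum]
  refine Finset.sum_congr rfl fun y hy => ?_
  rw [conj_mul, ha _ (out_mem_of_mem_cosetsIn h hy)]

theorem tr_mul {σ : P →* Aˣ} {R Q : Subgroup P} (h : R ≤ Q) {a : A}
    (ha : a ∈ fixedBy (conj (O := O) σ) Q) (m : A) :
    tr (conj (O := O) σ) R Q m * a = tr (conj (O := O) σ) R Q (m * a) := by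
  rw [tr_apply, tr_apply, Finset.sum_mul]
  refine Finset.sum_congr rfl fun y hy => ?_
  rw [conj_mul, ha _ (out_mem_of_mem_cosetsIn h hy)]

variable [IsLocalRing O]

theorem mul_mem_brKer_left {σ : P →* Aˣ} {Q : Subgroup P} {a m : A}
    (ha : a ∈ fixedBy (conj (O := O) σ) Q) (hm : m ∈ brKer (conj (O := O) σ) Q) :
    a * m ∈ brKer (conj (O := O) σ) Q := by
  refine brKer_induction (p := fun m => a * m ∈ brKer (conj (O := O) σ) Q) ?_ ?_ ?_ ?_ ?_ hm
  · intro R hR m hm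
    rw [mul_tr hR.le ha]
    exact properTr_le_brKer _ _ (tr_mem_properTr hR
      (mul_mem_fixedBy (fixedBy_anti _ hR.le ha) hm))
  · intro c hc m hm
    rw [mul_smul_comm]
    exact smul_mem_brKer hc (mul_mem_fixedBy ha hm)
  · intro m n hm hn
    rw [mul_add]; exact add_mem hm hn
  · simp
  · intro c m hm
    rw [mul_smul_comm]; exact Submodule.smul_mem _ _ hm

theorem mul_mem_brKer_right {σ : P →* Aˣ} {Q : Subgroup P} {a m : A}
    (ha : a ∈ fixedBy (conj (O := O) σ) Q) (hm : m ∈ brKer (conj (O := O) σ) Q) :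
    m * a ∈ brKer (conj (O := O) σ) Q := by
  refine brKer_induction (p := fun m => m * a ∈ brKer (conj (O := O) σ) Q) ?_ ?_ ?_ ?_ ?_ hm
  · intro R hR m hm
    rw [tr_mul hR.le ha]
    exact properTr_le_brKer _ _ (tr_mem_properTr hR
      (mul_mem_fixedBy hm (fixedBy_anti _ hR.le ha)))
  · intro c hc m hm
    rw [smul_mul_assoc]
    exact smul_mem_brKer hc (mul_mem_fixedBy hm ha)
  · intro m n hm hn
    rw [add_mul]; exact add_mem hm hn
  · simp
  · intro c m hm
    rw [smul_mul_assoc]; exact Submodule.smul_mem _ _ hm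

/-- The kernel of the Brauer map `A^Q → A(Q)`, as an ideal. -/
def brIdeal (O : Type*) [CommRing O] [IsLocalRing O] [Algebra O A] (σ : P →* Aˣ)
    (Q : Subgroup P) : Ideal (fixAlg O σ Q) where
  carrier := {a | (a : A) ∈ brKer (conj (O := O) σ) Q}
  zero_mem' := (brKer (conj (O := O) σ) Q).zero_mem
  add_mem' := (brKer (conj (O := O) σ) Q).add_mem
  smul_mem' a _ hm := mul_mem_brKer_left (mem_fixAlg.mp a.2) hm

instance (σ : P →* Aˣ) (Q : Subgroup P) : (brIdeal O σ Q).IsTwoSided :=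
  ⟨fun b hm => mul_mem_brKer_right (mem_fixAlg.mp b.2) hm⟩

/-- The Brauer quotient `A(Q)` of an interior algebra. -/
def Br (O : Type*) [CommRing O] [IsLocalRing O] [Algebra O A] (σ : P →* Aˣ)
    (Q : Subgroup P) : Type _ := fixAlg O σ Q ⧸ brIdeal O σ Q

instance (σ : P →* Aˣ) (Q : Subgroup P) : Ring (Br O σ Q) :=
  inferInstanceAs (Ring (fixAlg O σ Q ⧸ brIdeal O σ Q))

instance (σ : P →* Aˣ) (Q : Subgroup P) : Algebra O (Br O σ Q) :=
  inferInstanceAs (Algebra O (fixAlg O σ Q ⧸ brIdeal O σ Q))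

/-- The Brauer map `A^Q → A(Q)`. -/
def br (O : Type*) [CommRing O] [IsLocalRing O] [Algebra O A] (σ : P →* Aˣ) (Q : Subgroup P) :
    fixAlg O σ Q →ₐ[O] Br O σ Q :=
  Ideal.Quotient.mkₐ O (brIdeal O σ Q)

theorem br_surjective (σ : P →* Aˣ) (Q : Subgroup P) : Function.Surjective (br O σ Q) :=
  Ideal.Quotient.mkₐ_surjective O _

theorem br_eq_zero_iff {σ : P →* Aˣ} {Q : Subgroup P} {a : fixAlg O σ Q} :
    br O σ Q a = 0 ↔ (a : A) ∈ brKer (conj (O := O) σ) Q :=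
  Ideal.Quotient.eq_zero_iff_mem

theorem br_eq_iff {σ : P →* Aˣ} {Q : Subgroup P} {a b : fixAlg O σ Q} :
    br O σ Q a = br O σ Q b ↔ (a - b : A) ∈ brKer (conj (O := O) σ) Q := by
  rw [← sub_eq_zero, ← map_sub, br_eq_zero_iff]
  rfl

theorem algebraMap_br_eq_zero (σ : P →* Aˣ) (Q : Subgroup P) {c : O} (hc : c ∈ maximalIdeal O) :
    algebraMap O (Br O σ Q) c = 0 := by
  rw [← (br O σ Q).commutes, br_eq_zero_iff, Algebra.algebraMap_eq_smul_one]
  exact smul_mem_brKer hc (one_mem_fixedBy σ Q)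

instance (σ : P →* Aˣ) (Q : Subgroup P) : Algebra (ResidueField O) (Br O σ Q) :=
  RingHom.toAlgebra' (Ideal.Quotient.lift (maximalIdeal O) (algebraMap O (Br O σ Q))
    fun _ hc => algebraMap_br_eq_zero σ Q hc) (by
      intro c x
      obtain ⟨c, rfl⟩ := residue_surjective c
      exact Algebra.commutes c x)

instance (σ : P →* Aˣ) (Q : Subgroup P) : IsScalarTower O (ResidueField O) (Br O σ Q) :=
  IsScalarTower.of_algebraMap_eq fun _ => rfl

theorem residue_smul {W : Type*} [AddCommGroup W] [Module O W] [Module (ResidueField O) W]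
    [IsScalarTower O (ResidueField O) W] (c : O) (x : W) : residue O c • x = c • x := by
  rw [← ResidueField.algebraMap_eq, algebraMap_smul]

instance [IsNoetherianRing O] [Module.Finite O A] (σ : P →* Aˣ) (Q : Subgroup P) :
    FiniteDimensional (ResidueField O) (Br O σ Q) :=
  have : Module.Finite O (Br O σ Q) :=
    Module.Finite.of_surjective (br O σ Q).toLinearMap (br_surjective σ Q)
  Module.Finite.of_restrictScalars_finite O _ _

theorem nontrivial_br_iff {σ : P →* Aˣ} {Q : Subgroup P} :
    Nontrivial (Br O σ Q) ↔ (1 : A) ∉ brKer (conj (O := O) σ) Q := by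
  rw [← not_iff_not, not_not, not_nontrivial_iff_subsingleton, ← subsingleton_iff_zero_eq_one,
    eq_comm, ← map_one (br O σ Q), br_eq_zero_iff]
  rfl

/-- The linear map on `A(Q)` induced by a linear map on `A^Q`. -/
def brLift {σ : P →* Aˣ} {Q : Subgroup P} {W : Type*} [AddCommGroup W] [Module O W]
    [Module (ResidueField O) W] [IsScalarTower O (ResidueField O) W]
    (f : fixAlg O σ Q →ₗ[O] W)
    (hf : ∀ a : fixAlg O σ Q, (a : A) ∈ brKer (conj (O := O) σ) Q → f a = 0) :
    Br O σ Q →ₗ[ResidueField O] W :=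
  LinearMap.extendScalarsOfSurjective (R := O) (by exact residue_surjective)
    (((Submodule.liftQ ((brIdeal O σ Q).restrictScalars O) f hf :
      (fixAlg O σ Q ⧸ (brIdeal O σ Q).restrictScalars O) →ₗ[O] W)) ∘ₗ
      ({ toFun := fun x => x
         map_add' := fun _ _ => rfl
         map_smul' := fun _ _ => rfl } :
        Br O σ Q →ₗ[O] (fixAlg O σ Q ⧸ (brIdeal O σ Q).restrictScalars O)))

/-- The algebra map on `A(Q)` induced by an algebra map on `A^Q`. -/
def brLiftAlg {σ : P →* Aˣ} {Q : Subgroup P} {W : Type*} [Ring W] [Algebra O W]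
    [Algebra (ResidueField O) W] [IsScalarTower O (ResidueField O) W]
    (f : fixAlg O σ Q →ₐ[O] W)
    (hf : ∀ a : fixAlg O σ Q, (a : A) ∈ brKer (conj (O := O) σ) Q → f a = 0) :
    Br O σ Q →ₐ[ResidueField O] W :=
  AlgHom.extendScalarsOfSurjective (R := O) (A := Br O σ Q) (by exact residue_surjective)
    (show Br O σ Q →ₐ[O] W from Ideal.Quotient.liftₐ (brIdeal O σ Q) f hf)

/-- The linear form on `A(Q)` induced by a `Q`-invariant linear form on `A`. -/
def brForm {p : ℕ} [Fact p.Prime] (hP : IsPGroup p P) [CharP (ResidueField O) p] (σ : P →* Aˣ)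
    (Q : Subgroup P) (t : A →ₗ[O] O) (ht : ∀ q ∈ Q, ∀ x, t (conj (O := O) σ q x) = t x) :
    Br O σ Q →ₗ[ResidueField O] ResidueField O :=
  brLift ((Algebra.linearMap O (ResidueField O)) ∘ₗ t ∘ₗ (fixAlg O σ Q).val.toLinearMap)
    fun _ ha => (residue_eq_zero_iff _).mpr (form_mem_maximalIdeal hP ht ha)

theorem brForm_br {p : ℕ} [Fact p.Prime] (hP : IsPGroup p P) [CharP (ResidueField O) p]
    (σ : P →* Aˣ) (Q : Subgroup P) (t : A →ₗ[O] O)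
    (ht : ∀ q ∈ Q, ∀ x, t (conj (O := O) σ q x) = t x) (a : fixAlg O σ Q) :
    brForm hP σ Q t ht (br O σ Q a) = residue O (t a) := rfl

/-- If `A` has a stable basis, the invariant forms separate the elements of `A(Q)`. -/
theorem exists_brForm_ne_zero {p : ℕ} [Fact p.Prime] (hP : IsPGroup p P)
    [CharP (ResidueField O) p] {σ : P →* Aˣ} {Q : Subgroup P} {X : Type*} [MulAction P X]
    [Fintype X] (b : PermBasis X (conj (O := O) σ)) {a : fixAlg O σ Q} (ha : br O σ Q a ≠ 0) :
    ∃ (t : A →ₗ[O] O), (∀ q ∈ Q, ∀ x, t (conj (O := O) σ q x) = t x) ∧ IsUnit (t a) := by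
  rw [Ne, br_eq_zero_iff, b.mem_brKer_iff hP a.2] at ha
  push Not at ha
  obtain ⟨x, hx, hne⟩ := ha
  refine ⟨b.basis.coord x, fun q hq m => b.coord_apply_of_fixed hx hq m, ?_⟩
  by_contra h
  exact hne ((mem_maximalIdeal _).mpr h)

end InteriorAlgebras

/-! ### Primitivity, indecomposability and `A(P) ≠ 0` in terms of idempotents and kernels. -/

section Primitive

variable {O P A : Type*} [CommRing O] [Group P] [Ring A] [Algebra O A]

theorem fixAlg_top (σ : P →* Aˣ) : fixAlg O σ ⊤ = fixedSubalgebra O σ := by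
  ext a
  exact ⟨fun h g => h g (Subgroup.mem_top g), fun h g _ => h g⟩

theorem IsPrimitiveIdempotent.eq_zero_or_eq_one {R : Type*} [Ring R]
    (h : IsPrimitiveIdempotent (1 : R)) (e : R) (he : IsIdempotentElem e) : e = 0 ∨ e = 1 := by
  rcases h.2.2 e (1 - e) he he.one_sub (by rw [mul_sub, mul_one, he.eq, sub_self])
    (by rw [sub_mul, one_mul, he.eq, sub_self]) (by abel) with h | h
  · exact Or.inl h
  · exact Or.inr (sub_eq_zero.mp h).symm

/-- An idempotent of `End(V)^P` splits `V` into its image and its kernel, both `P`-stable. -/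
theorem IsIndecomposable.eq_zero_or_eq_one {V : Type*} [AddCommGroup V] [Module O V]
    {ρ : Representation O P V} (hV : IsIndecomposable ρ) (e : fixAlg O (endStr ρ) ⊤)
    (he : IsIdempotentElem e) : e = 0 ∨ e = 1 := by
  have hcomm : ∀ (f : fixAlg O (endStr ρ) ⊤) (g : P) (v : V),
      (f : Module.End O V) (ρ g v) = ρ g ((f : Module.End O V) v) := by
    intro f g v
    have h := f.2 g (Subgroup.mem_top g)
    rw [conj_apply, Units.mul_inv_eq_iff_eq_mul] at h
    exact (LinearMap.congr_fun h v).symm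
  have he' : ∀ v, (e : Module.End O V) ((e : Module.End O V) v) = (e : Module.End O V) v :=
    fun v => LinearMap.congr_fun (congrArg Subtype.val he.eq) v
  let U : Subrepresentation ρ :=
    ⟨LinearMap.range (e : Module.End O V), by
      rintro g _ ⟨v, rfl⟩
      exact ⟨ρ g v, hcomm e g v⟩⟩
  let W : Subrepresentation ρ :=
    ⟨LinearMap.ker (e : Module.End O V), by
      intro g v hv
      rw [LinearMap.mem_ker] at hv ⊢
      rw [hcomm, hv, map_zero]⟩
  have hUW : IsCompl U W := by
    constructor
    · rw [disjoint_iff]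
      apply Subrepresentation.toSubmodule_injective
      change LinearMap.range (e : Module.End O V) ⊓ LinearMap.ker (e : Module.End O V) = ⊥
      rw [eq_bot_iff]
      rintro _ ⟨⟨v, rfl⟩, hv⟩
      rw [SetLike.mem_coe, LinearMap.mem_ker, he'] at hv
      rw [hv]; exact zero_mem _
    · rw [codisjoint_iff]
      apply Subrepresentation.toSubmodule_injective
      change LinearMap.range (e : Module.End O V) ⊔ LinearMap.ker (e : Module.End O V) = ⊤
      rw [eq_top_iff]
      intro v _
      rw [← add_sub_cancel ((e : Module.End O V) v) v]
      refine add_mem (Submodule.mem_sup_left ⟨v, rfl⟩) (Submodule.mem_sup_right ?_)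
      rw [LinearMap.mem_ker, map_sub, he', sub_self]
  rcases hV.2 U W hUW with h | h
  · left
    have h1 : LinearMap.range (e : Module.End O V) = ⊥ := congrArg Subrepresentation.toSubmodule h
    exact Subtype.ext (LinearMap.range_eq_bot.mp h1)
  · right
    have h1 : LinearMap.ker (e : Module.End O V) = ⊥ := congrArg Subrepresentation.toSubmodule h
    refine Subtype.ext (LinearMap.ext fun v => ?_)
    have h2 : (e : Module.End O V) v - v ∈ LinearMap.ker (e : Module.End O V) := by
      rw [LinearMap.mem_ker, map_sub, he', sub_self]
    rw [h1] at h2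
    exact sub_eq_zero.mp h2

variable [Finite P] [IsLocalRing O]

/-- If the Brauer quotient at `P` is nonzero then `1` is not in the kernel of the Brauer map. -/
theorem one_notMem_brKer_top {σ : P →* Aˣ} (h : Nontrivial (BrauerQuotient (conj (O := O) σ))) :
    (1 : A) ∉ brKer (conj (O := O) σ) ⊤ := by
  intro h1
  have hle : brKer (conj (O := O) σ) ⊤ ≤
      (brauerKer (conj (O := O) σ)).map (conj (O := O) σ).invariants.subtype := by
    intro m hm
    refine brKer_induction ?_ ?_ (fun _ _ => add_mem) (zero_mem _)
      (fun c _ => Submodule.smul_mem _ c) hm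
    · intro R hR m hm
      refine ⟨relTrace _ R ⟨m, hm⟩, ?_, ?_⟩
      · exact Submodule.mem_sup_left (Submodule.mem_iSup_of_mem ⟨R, hR⟩ ⟨_, rfl⟩)
      · rw [tr_apply]
        change cosetSum _ R ⟨m, hm⟩ = _
        rw [cosetSum, LinearMap.sum_apply]
        let _ : Fintype (P ⧸ R) := Fintype.ofFinite _
        refine Finset.sum_bij (fun y _ => y) ?_ (fun _ _ _ _ h => h) ?_ ?_
        · intro y _
          induction y using QuotientGroup.induction_on with
          | _ g => exact mem_cosetsIn.mpr ⟨g, Subgroup.mem_top g, rfl⟩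
        · exact fun y _ => ⟨y, Finset.mem_univ _, rfl⟩
        · exact fun _ _ => rfl
    · intro c hc m hm
      exact ⟨c • ⟨m, fun g => hm g (Subgroup.mem_top g)⟩,
        Submodule.mem_sup_right (Submodule.smul_mem_smul hc trivial), rfl⟩
  obtain ⟨⟨u, hu⟩, hu1, hu2⟩ := hle h1
  change u = 1 at hu2
  subst hu2
  have htop : brauerKer (conj (O := O) σ) = ⊤ := by
    rw [eq_top_iff]
    rintro ⟨a, ha⟩ -
    have ha' : a ∈ brKer (conj (O := O) σ) ⊤ := by
      have := mul_mem_brKer_left (a := a) (fun g _ => ha g) h1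
      rwa [mul_one] at this
    obtain ⟨w, hw1, hw2⟩ := hle ha'
    have : w = ⟨a, ha⟩ := Subtype.ext hw2
    rwa [← this]
  have : Subsingleton (BrauerQuotient (conj (O := O) σ)) :=
    Submodule.Quotient.subsingleton_iff.mpr htop
  exact not_subsingleton _ this

end Primitive

/-! ### Maps induced on Brauer quotients. -/

section Functoriality

open IsLocalRing

variable {O P A A' : Type*} [CommRing O] [IsLocalRing O] [Group P] [Finite P] [Ring A]
  [Algebra O A] [Ring A'] [Algebra O A'] {σ : P →* Aˣ} {σ' : P →* A'ˣ} {Q : Subgroup P}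

/-- The map of Brauer quotients induced by a `Q`-equivariant linear map. -/
def brMap (f : A →ₗ[O] A')
    (hf : ∀ q ∈ Q, ∀ a, f (conj (O := O) σ q a) = conj (O := O) σ' q (f a)) :
    Br O σ Q →ₗ[ResidueField O] Br O σ' Q :=
  brLift ((br O σ' Q).toLinearMap ∘ₗ
    ((f ∘ₗ (fixAlg O σ Q).val.toLinearMap).codRestrict (Subalgebra.toSubmodule (fixAlg O σ' Q))
      fun a => map_mem_fixedBy hf a.2))
    fun _ ha => br_eq_zero_iff.mpr (map_mem_brKer hf ha)

theorem brMap_br (f : A →ₗ[O] A')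
    (hf : ∀ q ∈ Q, ∀ a, f (conj (O := O) σ q a) = conj (O := O) σ' q (f a))
    (a : fixAlg O σ Q) :
    brMap f hf (br O σ Q a) = br O σ' Q ⟨f a, map_mem_fixedBy hf a.2⟩ := rfl

/-- The map of Brauer quotients induced by a `Q`-equivariant algebra map. -/
def brMapAlg (f : A →ₐ[O] A')
    (hf : ∀ q ∈ Q, ∀ a, f (conj (O := O) σ q a) = conj (O := O) σ' q (f a)) :
    Br O σ Q →ₐ[ResidueField O] Br O σ' Q :=
  brLiftAlg ((br O σ' Q).comp
    ((f.comp (fixAlg O σ Q).val).codRestrict (fixAlg O σ' Q)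
      fun a => map_mem_fixedBy (h := f.toLinearMap) hf a.2))
    fun _ ha => br_eq_zero_iff.mpr (map_mem_brKer (h := f.toLinearMap) hf ha)

theorem brMapAlg_br (f : A →ₐ[O] A')
    (hf : ∀ q ∈ Q, ∀ a, f (conj (O := O) σ q a) = conj (O := O) σ' q (f a))
    (a : fixAlg O σ Q) : brMapAlg f hf (br O σ Q a) =
      br O σ' Q ⟨f a, map_mem_fixedBy (h := f.toLinearMap) hf a.2⟩ := rfl

end Functoriality

/-! ### Contracting the second tensor factor with a linear form. -/

section Slice

/-- The map `id ⊗ t : S ⊗ B → S` for a linear form `t` on `B`. -/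
def slice {R S B : Type*} [CommRing R] [AddCommGroup S] [Module R S] [AddCommGroup B]
    [Module R B] (t : B →ₗ[R] R) : S ⊗[R] B →ₗ[R] S :=
  (TensorProduct.rid R S).toLinearMap ∘ₗ LinearMap.lTensor S t

@[simp] theorem slice_tmul {R S B : Type*} [CommRing R] [AddCommGroup S] [Module R S]
    [AddCommGroup B] [Module R B] (t : B →ₗ[R] R) (s : S) (b : B) :
    slice t (s ⊗ₜ[R] b) = t b • s := by
  simp [slice]

theorem sum_slice_tmul {R S B X : Type*} [CommRing R] [AddCommGroup S] [Module R S]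
    [AddCommGroup B] [Module R B] [Fintype X] (b : Module.Basis X R B) (y : S ⊗[R] B) :
    ∑ x, slice (b.coord x) y ⊗ₜ[R] b x = y := by
  induction y with
  | zero => simp
  | add y z hy hz => simp only [map_add, TensorProduct.add_tmul, Finset.sum_add_distrib, hy, hz]
  | tmul s c =>
    simp only [slice_tmul, TensorProduct.smul_tmul, ← TensorProduct.tmul_sum]
    simp [b.sum_repr]

end Slice

/-! ### The isomorphism `S(Q) ⊗ B(Q) → (S ⊗ B)(Q)` for `B` with a stable basis. -/

section Tensor

open IsLocalRing

variable {O P S B : Type*} [CommRing O] [Group P] [Ring S] [Algebra O S] [Ring B] [Algebra O B]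
  (σ : P →* Sˣ) (τ : P →* Bˣ)

theorem conj_tensorStr_tmul (g : P) (s : S) (b : B) :
    conj (O := O) (tensorStr O σ τ) g (s ⊗ₜ[O] b) =
      conj (O := O) σ g s ⊗ₜ[O] conj (O := O) τ g b := by
  have h1 : ((tensorStr O σ τ g : (S ⊗[O] B)ˣ) : S ⊗[O] B) = (σ g : S) ⊗ₜ[O] (τ g : B) := rfl
  have h2 : (((tensorStr O σ τ g)⁻¹ : (S ⊗[O] B)ˣ) : S ⊗[O] B) =
      (((σ g)⁻¹ : Sˣ) : S) ⊗ₜ[O] (((τ g)⁻¹ : Bˣ) : B) := by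
    rw [← map_inv, ← map_inv, ← map_inv]
    rfl
  simp [conj_apply, h1, h2]

theorem slice_conj {g : P} {t t' : B →ₗ[O] O} (h : ∀ b, t' (conj (O := O) τ g b) = t b)
    (y : S ⊗[O] B) :
    slice t' (conj (O := O) (tensorStr O σ τ) g y) = conj (O := O) σ g (slice t y) := by
  induction y with
  | zero => simp
  | add y z hy hz => simp only [map_add, hy, hz]
  | tmul s c => rw [conj_tensorStr_tmul, slice_tmul, slice_tmul, h, map_smul]

theorem tmul_mem_fixedBy {Q : Subgroup P} {s : S} {b : B}
    (hs : s ∈ fixedBy (conj (O := O) σ) Q) (hb : b ∈ fixedBy (conj (O := O) τ) Q) :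
    s ⊗ₜ[O] b ∈ fixedBy (conj (O := O) (tensorStr O σ τ)) Q := fun q hq => by
  rw [conj_tensorStr_tmul, hs q hq, hb q hq]

variable [Finite P] [IsLocalRing O] (Q : Subgroup P)

/-- The canonical map `S(Q) ⊗ B(Q) → (S ⊗ B)(Q)`. -/
def brTensor : Br O σ Q ⊗[ResidueField O] Br O τ Q →ₐ[ResidueField O]
    Br O (tensorStr O σ τ) Q :=
  Algebra.TensorProduct.lift
    (brMapAlg Algebra.TensorProduct.includeLeft fun q _ s => by
      rw [Algebra.TensorProduct.includeLeft_apply, Algebra.TensorProduct.includeLeft_apply,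
        conj_tensorStr_tmul, conj_one])
    (brMapAlg Algebra.TensorProduct.includeRight fun q _ s => by
      rw [Algebra.TensorProduct.includeRight_apply, Algebra.TensorProduct.includeRight_apply,
        conj_tensorStr_tmul, conj_one])
    fun x y => by
      obtain ⟨x, rfl⟩ := br_surjective σ Q x
      obtain ⟨y, rfl⟩ := br_surjective τ Q y
      rw [brMapAlg_br, brMapAlg_br, commute_iff_eq, ← map_mul, ← map_mul]
      congr 1
      exact Subtype.ext (by simp)

theorem brTensor_tmul (s : fixAlg O σ Q) (b : fixAlg O τ Q) :
    brTensor σ τ Q (br O σ Q s ⊗ₜ br O τ Q b) =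
      br O (tensorStr O σ τ) Q ⟨(s : S) ⊗ₜ[O] (b : B), tmul_mem_fixedBy σ τ s.2 b.2⟩ := by
  rw [brTensor, Algebra.TensorProduct.lift_tmul, brMapAlg_br, brMapAlg_br, ← map_mul]
  congr 1
  exact Subtype.ext (by simp)

theorem brMap_slice_brTensor {p : ℕ} [Fact p.Prime] (hP : IsPGroup p P)
    [CharP (ResidueField O) p] (t : B →ₗ[O] O)
    (ht : ∀ q ∈ Q, ∀ x, t (conj (O := O) τ q x) = t x)
    (z : Br O σ Q ⊗[ResidueField O] Br O τ Q) :
    brMap (σ := tensorStr O σ τ) (σ' := σ) (slice t)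
      (fun q hq y => slice_conj σ τ (ht q hq) y) (brTensor σ τ Q z) =
      slice (brForm hP τ Q t ht) z := by
  induction z with
  | zero => simp
  | add y z hy hz => simp only [map_add, hy, hz]
  | tmul s c =>
    obtain ⟨s, rfl⟩ := br_surjective σ Q s
    obtain ⟨c, rfl⟩ := br_surjective τ Q c
    rw [brTensor_tmul, brMap_br, slice_tmul (brForm hP τ Q t ht), brForm_br, residue_smul,
      ← map_smul]
    congr 1

variable {X : Type*} [MulAction P X] [Fintype X] (b : PermBasis X (conj (O := O) τ))

-- Write `y = ∑ y_x ⊗ x` over the permutation basis of `B`. Modulo proper traces only `Q`-fixed `x`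
-- remain, and for these `y_x` lies in `S^Q`. No basis of `S` is needed.
include b in
theorem brTensor_surjective : Function.Surjective (brTensor (O := O) σ τ Q) := by
  classical
  intro y
  obtain ⟨⟨y, hy⟩, rfl⟩ := br_surjective _ Q y
  have hcoord : ∀ q x c, b.basis.coord (q • x) (conj (O := O) τ q c) = b.basis.coord x c :=
    fun q x c => b.repr_apply_smul q c x
  set s : Finset X := Finset.univ.filter fun x => ∀ q ∈ Q, q • x = x
  have hs : ∀ x, x ∈ s ↔ ∀ q ∈ Q, q • x = x := by simp [s]
  have hsl : ∀ q ∈ Q, ∀ x, slice (b.basis.coord (q • x)) y =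
      conj (O := O) σ q (slice (b.basis.coord x) y) := by
    intro q hq x
    rw [← slice_conj σ τ (hcoord q x), hy q hq]
  have h1 := sum_sub_sum_fixed_mem_properTr (conj (O := O) (tensorStr O σ τ)) Q
    (fun x => slice (b.basis.coord x) y ⊗ₜ[O] b.basis x) (fun q hq x => by
      rw [conj_tensorStr_tmul, hsl q hq, b.apply_basis]) s hs
  rw [sum_slice_tmul] at h1
  have hf1 : ∀ x ∈ s, slice (b.basis.coord x) y ∈ fixedBy (conj (O := O) σ) Q := by
    intro x hx q hq
    rw [← hsl q hq, (hs x).mp hx q hq]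
  have hf2 : ∀ x ∈ s, b.basis x ∈ fixedBy (conj (O := O) τ) Q := by
    intro x hx q hq
    rw [b.apply_basis, (hs x).mp hx q hq]
  refine ⟨∑ x : s, br O σ Q ⟨_, hf1 x x.2⟩ ⊗ₜ br O τ Q ⟨_, hf2 x x.2⟩, ?_⟩
  simp only [map_sum, brTensor_tmul]
  rw [← map_sum, eq_comm, br_eq_iff]
  refine properTr_le_brKer _ _ ?_
  convert h1 using 2
  rw [← Finset.sum_coe_sort s]
  simp

-- The coordinate forms at `Q`-fixed basis elements recover `z` from its slices, and these slices
-- can be computed after applying `brTensor`.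
include b in
theorem brTensor_injective {p : ℕ} [Fact p.Prime] (hP : IsPGroup p P)
    [CharP (ResidueField O) p] : Function.Injective (brTensor (O := O) σ τ Q) := by
  classical
  rw [injective_iff_map_eq_zero]
  intro z hz
  set s : Finset X := Finset.univ.filter fun x => ∀ q ∈ Q, q • x = x
  have hs : ∀ x, x ∈ s ↔ ∀ q ∈ Q, q • x = x := by simp [s]
  have hf2 : ∀ x ∈ s, b.basis x ∈ fixedBy (conj (O := O) τ) Q := by
    intro x hx q hq
    rw [b.apply_basis, (hs x).mp hx q hq]
  have ht : ∀ x ∈ s, ∀ q ∈ Q, ∀ y, b.basis.coord x (conj (O := O) τ q y) = b.basis.coord x y :=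
    fun x hx q hq y => b.coord_apply_of_fixed ((hs x).mp hx) hq y
  have key : ∀ z : Br O σ Q ⊗[ResidueField O] Br O τ Q,
      z = ∑ x : s, slice (brForm hP τ Q (b.basis.coord x) (ht x x.2)) z ⊗ₜ
        br O τ Q ⟨_, hf2 x x.2⟩ := by
    intro z
    induction z with
    | zero => simp
    | add y z hy hz =>
      simp only [map_add, TensorProduct.add_tmul, Finset.sum_add_distrib]
      rw [← hy, ← hz]
    | tmul c d =>
      obtain ⟨d, rfl⟩ := br_surjective τ Q d
      simp only [slice_tmul, TensorProduct.smul_tmul, ← TensorProduct.tmul_sum]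
      congr 1
      simp only [brForm_br, residue_smul, ← map_smul]
      rw [← map_sum, br_eq_iff]
      refine properTr_le_brKer _ _ ?_
      convert b.sub_sum_fixed_mem_properTr d.2 s hs using 2
      rw [← Finset.sum_coe_sort s]
      simp
  rw [key z]
  refine Finset.sum_eq_zero fun x _ => ?_
  rw [← brMap_slice_brTensor, hz, map_zero, TensorProduct.zero_tmul]

end Tensor

/-! ### Embeddings of interior algebras and their retractions. -/

section Embedding

variable {O P A W : Type*} [CommRing O] [Group P] [Ring A] [Algebra O A] [Ring W] [Algebra O W]
  {σ : P →* Aˣ} {υ : P →* Wˣ} {g : A →ₙₐ[O] W} (hg : IsInteriorEmbedding σ υ g)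
include hg

theorem IsInteriorEmbedding.map_conj (q : P) (a : A) :
    g (conj (O := O) σ q a) = conj (O := O) υ q (g a) := by
  rw [conj_apply, conj_apply, ← map_inv, ← map_inv, hg.map_right, hg.map_left]

theorem IsInteriorEmbedding.map_one_mem (Q : Subgroup P) :
    g 1 ∈ fixedBy (conj (O := O) υ) Q := fun q _ => by rw [← hg.map_conj, conj_one]

omit hg in
theorem map_one_mul (g : A →ₙₐ[O] W) (a : A) : g 1 * g a = g a := by rw [← map_mul, one_mul]

omit hg in
theorem map_mul_one (g : A →ₙₐ[O] W) (a : A) : g a * g 1 = g a := by rw [← map_mul, mul_one]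

/-- The map `w ↦ g⁻¹(g(1) w g(1))` attached to an embedding `g`. -/
def compress : W →ₗ[O] A :=
  (LinearEquiv.ofInjective (g : A →ₗ[O] W) hg.injective).symm.toLinearMap ∘ₗ
    LinearMap.codRestrict (LinearMap.range (g : A →ₗ[O] W))
      (LinearMap.mulLeftRight O (g 1, g 1)) fun w => by
        have h : g 1 * w * g 1 ∈ Set.range g := by rw [hg.range_eq]; exact ⟨w, rfl⟩
        obtain ⟨a, ha⟩ := h
        exact ⟨a, by simpa using ha⟩

theorem apply_compress (w : W) : g (compress hg w) = g 1 * w * g 1 := by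
  have h : ∀ w : LinearMap.range (g : A →ₗ[O] W),
      g ((LinearEquiv.ofInjective (g : A →ₗ[O] W) hg.injective).symm w) = w := by
    intro w
    exact congrArg Subtype.val
      ((LinearEquiv.ofInjective (g : A →ₗ[O] W) hg.injective).apply_symm_apply w)
  rw [compress, LinearMap.comp_apply, LinearEquiv.coe_coe, h]
  simp

theorem compress_apply (a : A) : compress hg (g a) = a :=
  hg.injective (by rw [apply_compress, map_one_mul, map_mul_one])

theorem compress_one : compress hg 1 = 1 :=
  hg.injective (by rw [apply_compress, mul_one, map_one_mul])

theorem compress_conj (q : P) (w : W) :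
    compress hg (conj (O := O) υ q w) = conj (O := O) σ q (compress hg w) := by
  have h1 := hg.map_one_mem ⊤ q (Subgroup.mem_top q)
  refine hg.injective ?_
  rw [apply_compress, hg.map_conj, apply_compress, conj_mul, conj_mul, h1]

variable [Finite P] [IsLocalRing O]

/-- The retraction `compress` is equivariant, so `g` stays injective on Brauer quotients. -/
theorem mem_brKer_of_apply_mem {Q : Subgroup P} {a : A}
    (h : g a ∈ brKer (conj (O := O) υ) Q) : a ∈ brKer (conj (O := O) σ) Q := by
  rw [← compress_apply hg a]
  exact map_mem_brKer (fun q _ => compress_conj hg q) h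

end Embedding

/-! ### Locality of Brauer quotients and the unit slice at `P`. -/

section Local

open IsLocalRing

variable {O P S : Type*} [CommRing O] [IsLocalRing O] [IsNoetherianRing O]
  [IsAdicComplete (maximalIdeal O) O] [Group P] [Finite P] [Ring S] [Algebra O S]
  [Module.Finite O S] {σ : P →* Sˣ} {Q : Subgroup P}

omit [IsNoetherianRing O] [IsAdicComplete (maximalIdeal O) O] [Module.Finite O S] in
theorem br_pow_eq_zero_of_pow_mem {a : fixAlg O σ Q} {n : ℕ}
    (h : a ^ n ∈ maximalIdeal O • (⊤ : Submodule O (fixAlg O σ Q))) : br O σ Q a ^ n = 0 := by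
  rw [← map_pow, br_eq_zero_iff]
  refine Submodule.smul_induction_on (p := fun x : fixAlg O σ Q =>
    (x : S) ∈ brKer (conj (O := O) σ) Q) h ?_ ?_
  · intro c hc x _
    exact smul_mem_brKer hc x.2
  · intro x y hx hy
    exact add_mem hx hy

theorem isUnit_or_isNilpotent_br
    (h : ∀ e : fixAlg O σ Q, IsIdempotentElem e → e = 0 ∨ e = 1) (a : fixAlg O σ Q) :
    IsUnit a ∨ IsNilpotent (br O σ Q a) :=
  (isUnit_or_pow_mem h a).imp id fun ⟨n, hn⟩ => ⟨n, br_pow_eq_zero_of_pow_mem hn⟩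

theorem br_idempotent_trivial
    (h : ∀ e : fixAlg O σ Q, IsIdempotentElem e → e = 0 ∨ e = 1) (e : Br O σ Q)
    (he : IsIdempotentElem e) : e = 0 ∨ e = 1 := by
  obtain ⟨a, rfl⟩ := br_surjective σ Q e
  rcases isUnit_or_isNilpotent_br h a with ha | ha
  · right
    exact (ha.map (br O σ Q)).mul_left_cancel (he.eq.trans (mul_one _).symm)
  · left
    exact eq_zero_of_isIdempotentElem_of_isNilpotent he ha

variable {A B : Type*} [Ring A] [Algebra O A] [Ring B] [Algebra O B] [Module.Finite O B]
  {σA : P →* Aˣ} {τ : P →* Bˣ}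

/-- For an embedding `g : A → S ⊗ B` with local `S^P` and `B^P` and with `A(P) ≠ 0`, some
`P`-invariant form `t` on `B` is such that `(id ⊗ t)(g(1))` is a unit of `S^P`. -/
theorem exists_slice_isUnit {p : ℕ} [Fact p.Prime] (hP : IsPGroup p P)
    [CharP (ResidueField O) p] [IsAlgClosed (ResidueField O)]
    {g : A →ₙₐ[O] S ⊗[O] B} (hg : IsInteriorEmbedding σA (tensorStr O σ τ) g)
    {X : Type*} [MulAction P X] [Fintype X] (b : PermBasis X (conj (O := O) τ))
    (hS : ∀ e : fixAlg O σ ⊤, IsIdempotentElem e → e = 0 ∨ e = 1)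
    (hB : ∀ e : fixAlg O τ ⊤, IsIdempotentElem e → e = 0 ∨ e = 1)
    (hA : (1 : A) ∉ brKer (conj (O := O) σA) ⊤) :
    ∃ t : B →ₗ[O] O, (∀ q x, t (conj (O := O) τ q x) = t x) ∧
      ∃ u : fixAlg O σ ⊤, IsUnit u ∧ (u : S) = slice t (g 1) := by
  have h1W : (1 : S ⊗[O] B) ∉ brKer (conj (O := O) (tensorStr O σ τ)) ⊤ := by
    intro h
    refine hA ?_
    rw [← compress_one hg]
    exact map_mem_brKer (fun q _ => compress_conj hg q) h
  have h1S : Nontrivial (Br O σ ⊤) := by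
    rw [nontrivial_br_iff]
    intro h
    exact h1W (map_mem_brKer (h := (Algebra.TensorProduct.includeLeft (R := O) (S := O) (A := S)
      (B := B)).toLinearMap) (fun q _ s => by simp [conj_tensorStr_tmul, conj_one]) h)
  have h1B : Nontrivial (Br O τ ⊤) := by
    rw [nontrivial_br_iff]
    intro h
    exact h1W (map_mem_brKer (h := (Algebra.TensorProduct.includeRight (R := O) (A := S)
      (B := B)).toLinearMap) (fun q _ s => by simp [conj_tensorStr_tmul, conj_one]) h)
  obtain ⟨r, hr⟩ := exists_algHom_of_trivial_idempotents (k := ResidueField O)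
    (br_idempotent_trivial hS)
  obtain ⟨r', hr'⟩ := exists_algHom_of_trivial_idempotents (k := ResidueField O)
    (br_idempotent_trivial hB)
  set i : fixAlg O (tensorStr O σ τ) ⊤ := ⟨g 1, hg.map_one_mem ⊤⟩
  obtain ⟨z, hz⟩ := brTensor_surjective σ τ ⊤ b (br O _ ⊤ i)
  -- Here `z` is an idempotent of `S(P) ⊗ B(P)`, whose only idempotents are `0` and `1`; it is not
  -- `0` because `A(P) ≠ 0`.
  have hz1 : z = 1 := by
    have hi : IsIdempotentElem i := Subtype.ext (map_one_mul g 1)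
    have hid : IsIdempotentElem z := by
      refine brTensor_injective σ τ ⊤ b hP ?_
      rw [map_mul, hz, ← map_mul, hi.eq]
    rcases tensor_idempotent_trivial hr hr' z hid with h | h
    · rw [h, map_zero, eq_comm, br_eq_zero_iff] at hz
      exact absurd (mem_brKer_of_apply_mem hg hz) hA
    · exact h
  -- With `t(1)` a unit, the slice of `g(1)` has image `t(1) • 1` in `S(P)`, which is not nilpotent;
  -- by locality of `S^P` the slice is a unit.
  obtain ⟨t, ht, htu⟩ := exists_brForm_ne_zero hP b (Q := ⊤) (a := 1)
    (by rw [map_one]; exact one_ne_zero)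
  refine ⟨t, fun q x => ht q (Subgroup.mem_top q) x, ⟨slice t (g 1), ?_⟩, ?_, rfl⟩
  · exact map_mem_fixedBy (ρ := conj (O := O) (tensorStr O σ τ))
      (fun q hq y => slice_conj σ τ (ht q hq) y) (hg.map_one_mem ⊤)
  · refine (isUnit_or_isNilpotent_br hS _).resolve_right fun hnil => ?_
    have h2 := brMap_slice_brTensor σ τ ⊤ hP t ht z
    rw [hz, hz1, brMap_br, Algebra.TensorProduct.one_def, slice_tmul,
      ← map_one (br O τ ⊤), brForm_br] at h2
    rw [h2] at hnil
    have h3 : IsUnit (residue O (t 1)) := htu.map _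
    obtain ⟨n, hn⟩ := hnil
    rw [smul_pow, one_pow] at hn
    have h4 := (h3.pow n).smul_eq_zero.mp hn
    exact one_ne_zero h4

end Local

/-! ### Comparing Brauer maps at `Q` and at subgroups of its normalizer. -/

section Restriction

open IsLocalRing

variable {P : Type*} [Group P]

theorem smul_fixed_of_mem_normalizer {X : Type*} [MulAction P X] {Q : Subgroup P} {r : P}
    (hr : r ∈ Subgroup.normalizer (Q : Set P)) {x : X} (hx : ∀ q ∈ Q, q • x = x) :
    ∀ q ∈ Q, q • r • x = r • x := by
  intro q hq
  have h : r⁻¹ * q * r ∈ Q := by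
    have := (Subgroup.mem_normalizer_iff.mp (inv_mem hr) q).mp hq
    simpa using this
  have h2 := hx _ h
  rwa [mul_smul, mul_smul, inv_smul_eq_iff] at h2

variable {O A : Type*} [CommRing O] [AddCommGroup A] [Module O A]

theorem apply_mem_fixedBy_of_mem_normalizer {ρ : Representation O P A} {Q : Subgroup P} {r : P}
    (hr : r ∈ Subgroup.normalizer (Q : Set P)) {a : A} (ha : a ∈ fixedBy ρ Q) :
    ρ r a ∈ fixedBy ρ Q := by
  intro q hq
  have h : r⁻¹ * q * r ∈ Q := by
    have := (Subgroup.mem_normalizer_iff.mp (inv_mem hr) q).mp hq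
    simpa using this
  have h2 := ha _ h
  rw [← Module.End.mul_apply, ← map_mul, show q * r = r * (r⁻¹ * q * r) by group, map_mul,
    Module.End.mul_apply, h2]

variable [Finite P]

/-- An equivariant sum over a set all of whose points have stabilizer `Q` in `R` is a trace. -/
theorem exists_tr_eq_sum {Y : Type*} [MulAction P Y] (ρ : Representation O P A)
    (Q R : Subgroup P) (f : Y → A) (hf : ∀ q ∈ R, ∀ y, f (q • y) = ρ q (f y))
    (s : Finset Y) (hs : ∀ q ∈ R, ∀ y ∈ s, q • y ∈ s)
    (hstab : ∀ y ∈ s, MulAction.stabilizer P y ⊓ R = Q) :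
    ∃ d ∈ fixedBy ρ Q, ∑ y ∈ s, f y = tr ρ Q R d := by
  classical
  induction s using Finset.strongInduction with
  | _ s ih =>
  rcases s.eq_empty_or_nonempty with rfl | ⟨y, hy⟩
  · exact ⟨0, zero_mem _, by simp⟩
  set o : Finset Y := s.filter fun z => ∃ q ∈ R, q • y = z
  have ho : ∀ z, z ∈ o ↔ ∃ q ∈ R, q • y = z := by
    intro z
    simp only [o, Finset.mem_filter, and_iff_right_iff_imp]
    rintro ⟨q, hq, rfl⟩
    exact hs q hq y hy
  have hyo : y ∈ o := (ho y).mpr ⟨1, R.one_mem, one_smul _ _⟩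
  have hos : o ⊆ s := Finset.filter_subset _ _
  obtain ⟨d, hd, hsum⟩ := ih _ (Finset.sdiff_ssubset hos ⟨y, hyo⟩) (by
      intro q hq z hz
      rw [Finset.mem_sdiff] at hz ⊢
      refine ⟨hs q hq z hz.1, fun h => hz.2 ?_⟩
      obtain ⟨q', hq', h'⟩ := (ho _).mp h
      exact (ho _).mpr ⟨q⁻¹ * q', R.mul_mem (R.inv_mem hq) hq', by
        rw [mul_smul, h', inv_smul_smul]⟩)
    fun z hz => hstab z (Finset.mem_sdiff.mp hz).1
  refine ⟨d + f y, add_mem hd ?_, ?_⟩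
  · rw [← hstab y hy]
    intro g hg
    rw [← hf g hg.2, hg.1]
  · rw [← Finset.sum_sdiff hos, hsum, sum_orbit_eq_tr ρ R f hf y o ho, hstab y hy, map_add]

variable [IsLocalRing O]

omit [IsLocalRing O] in
/-- `Tr_Q^P` and `Tr_Q^{N(Q)}` agree modulo the kernel of the Brauer map at `Q`. -/
theorem tr_top_sub_tr_normalizer_mem {ρ : Representation O P A} {Q : Subgroup P} {d : A}
    (hd : d ∈ fixedBy ρ Q) :
    tr ρ Q ⊤ d - tr ρ Q (Subgroup.normalizer (Q : Set P)) d ∈ properTr ρ Q := by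
  classical
  let _ : Fintype (P ⧸ Q) := Fintype.ofFinite _
  -- A coset `gQ` is fixed by left multiplication by `Q` exactly when `g⁻¹ Q g ≤ Q`, which by
  -- finiteness means that `g` normalizes `Q`.
  have h := sum_sub_sum_fixed_mem_properTr ρ Q (fun y : P ⧸ Q => ρ y.out d)
    (fun q _ y => apply_out_smul hd q y) (cosetsIn Q (Subgroup.normalizer (Q : Set P))) (by
      intro y
      rw [mem_cosetsIn]
      constructor
      · rintro ⟨r, hr, rfl⟩ q hq
        change (QuotientGroup.mk (q * r) : P ⧸ Q) = _
        refine (QuotientGroup.eq.mpr ?_).symm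
        have := (Subgroup.mem_normalizer_iff.mp (inv_mem hr) q).mp hq
        simpa [mul_assoc] using this
      · induction y using QuotientGroup.induction_on with
        | _ g =>
        intro hq
        refine ⟨g, ?_, rfl⟩
        rw [← inv_mem_iff]
        refine Subgroup.mem_normalizer_fintype fun q hqQ => ?_
        have h1 : (QuotientGroup.mk (q * g) : P ⧸ Q) = QuotientGroup.mk g := hq q hqQ
        have := QuotientGroup.eq.mp h1.symm
        simpa [mul_assoc] using this)
  have h2 : tr ρ Q ⊤ d = ∑ y : P ⧸ Q, ρ y.out d := by
    rw [tr_apply]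
    refine Finset.sum_congr ?_ fun _ _ => rfl
    ext y
    induction y using QuotientGroup.induction_on with
    | _ g => simpa using mem_cosetsIn.mpr ⟨g, Subgroup.mem_top g, rfl⟩
  rwa [h2, tr_apply]

namespace PermBasis

variable {p : ℕ} [Fact p.Prime] (hP : IsPGroup p P) [CharP (ResidueField O) p]
  {X : Type*} [MulAction P X] [Fintype X] {ρ : Representation O P A} (b : PermBasis X ρ)
include hP b

/-- Basis elements fixed by `R` are fixed by `Q`, so fewer coordinates are tested at `R` than at
`Q`. -/
theorem mem_brKer_of_le {Q R : Subgroup P} (h : Q ≤ R) {a : A} (ha : a ∈ fixedBy ρ R)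
    (haQ : a ∈ brKer ρ Q) : a ∈ brKer ρ R := by
  rw [b.mem_brKer_iff hP ha]
  intro x hx
  exact (b.mem_brKer_iff hP (fixedBy_anti ρ h ha)).mp haQ x fun q hq => hx q (h hq)

theorem apply_mem_brKer {Q : Subgroup P} {r : P} (hr : r ∈ Subgroup.normalizer (Q : Set P))
    {a : A} (ha : a ∈ brKer ρ Q) : ρ r a ∈ brKer ρ Q := by
  have hf := brKer_le ρ Q ha
  rw [b.mem_brKer_iff hP (apply_mem_fixedBy_of_mem_normalizer hr hf)]
  intro x hx
  have h := b.repr_apply_smul r a (r⁻¹ • x)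
  rw [smul_inv_smul] at h
  rw [h]
  exact (b.mem_brKer_iff hP hf).mp ha _ (smul_fixed_of_mem_normalizer (inv_mem hr) hx)

/-- Elements of `M^Q` which are `R`-stable in `M(Q)` lift to `M^R`. -/
theorem exists_lift {Q R : Subgroup P} (hQR : Q ≤ R)
    (hR : R ≤ Subgroup.normalizer (Q : Set P)) {a : A} (ha : a ∈ fixedBy ρ Q)
    (hst : ∀ r ∈ R, ρ r a - a ∈ brKer ρ Q) :
    ∃ c ∈ fixedBy ρ R, a - c ∈ brKer ρ Q := by
  classical
  let rep : X → X := fun x => (Quotient.mk (MulAction.orbitRel R X) x).out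
  have hrep : ∀ x, ∃ r ∈ R, r • x = rep x := by
    intro x
    have h : (MulAction.orbitRel R X) (rep x) x :=
      Quotient.exact (Quotient.out_eq (Quotient.mk (MulAction.orbitRel R X) x))
    obtain ⟨r, hr⟩ := h
    exact ⟨r, r.2, hr⟩
  have hreps : ∀ r ∈ R, ∀ x, rep (r • x) = rep x := by
    intro r hr x
    have h : Quotient.mk (MulAction.orbitRel R X) (r • x) = Quotient.mk _ x :=
      Quotient.sound ⟨⟨r, hr⟩, rfl⟩
    exact congrArg Quotient.out h
  have hdiff : ∀ r ∈ R, ∀ x, (∀ q ∈ Q, q • x = x) →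
      b.basis.repr a x - b.basis.repr a (r • x) ∈ maximalIdeal O := by
    intro r hr x hx
    have h := (b.mem_brKer_iff hP (brKer_le ρ Q (hst r hr))).mp (hst r hr) (r • x)
      (smul_fixed_of_mem_normalizer (hR hr) hx)
    rwa [map_sub, Finsupp.sub_apply, b.repr_apply_smul] at h
  -- Stability of `a` means that its coordinates on `Q`-fixed basis elements are constant on
  -- `R`-orbits modulo the maximal ideal. Taking the coordinate at one representative of each orbit
  -- makes them genuinely constant.
  set c : A := ∑ x, (if ∀ q ∈ Q, q • x = x then b.basis.repr a (rep x) else 0) • b.basis x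
  have hc : ∀ x, b.basis.repr c x = if ∀ q ∈ Q, q • x = x then b.basis.repr a (rep x) else 0 :=
    fun x => congrFun (b.basis.repr_sum_self _) x
  have hcR : c ∈ fixedBy ρ R := by
    rw [b.mem_fixedBy_iff]
    intro r hr x
    rw [hc, hc, hreps r hr]
    have h : (∀ q ∈ Q, q • r • x = r • x) ↔ ∀ q ∈ Q, q • x = x := by
      refine ⟨fun h => ?_, smul_fixed_of_mem_normalizer (hR hr)⟩
      have := smul_fixed_of_mem_normalizer (inv_mem (hR hr)) h
      simpa using this
    simp only [h]
  refine ⟨c, hcR, ?_⟩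
  rw [b.mem_brKer_iff hP (sub_mem ha (fixedBy_anti ρ hQR hcR))]
  intro x hx
  rw [map_sub, Finsupp.sub_apply, hc, if_pos hx]
  obtain ⟨r, hr, h⟩ := hrep x
  rw [← h]
  exact hdiff r hr x hx

/-- An `R`-fixed element lying in the kernels of the Brauer maps at all subgroups strictly
between `Q` and its normalizer `R` is a relative trace from `Q` modulo the kernel at `Q`. -/
theorem exists_sub_tr_mem_brKer {Q R : Subgroup P} (hQR : Q ≤ R)
    (hR : R ≤ Subgroup.normalizer (Q : Set P)) {c : A} (hc : c ∈ fixedBy ρ R)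
    (hker : ∀ R', Q < R' → R' ≤ R → c ∈ brKer ρ R') :
    ∃ d ∈ fixedBy ρ Q, c - tr ρ Q R d ∈ brKer ρ Q := by
  classical
  -- Among the `Q`-fixed basis elements, those outside `s` have a stabilizer in `R` strictly larger
  -- than `Q`, so by `hker` their coordinates lie in the maximal ideal. The part of `c` on `s` is a
  -- trace from `Q`.
  set s : Finset X := Finset.univ.filter fun x => MulAction.stabilizer P x ⊓ R = Q
  have hs : ∀ x, x ∈ s ↔ MulAction.stabilizer P x ⊓ R = Q := by simp [s]
  have hsfix : ∀ x ∈ s, ∀ q ∈ Q, q • x = x := by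
    intro x hx q hq
    rw [← (hs x).mp hx] at hq
    exact hq.1
  obtain ⟨d, hd, hsum⟩ := exists_tr_eq_sum ρ Q R (fun x => b.basis.repr c x • b.basis x)
    (fun q hq x => by rw [b.mem_fixedBy_iff.mp hc q hq, (ρ q).map_smul, b.apply_basis]) s (by
      intro r hr x hx
      rw [hs] at hx ⊢
      refine le_antisymm ?_ ?_
      · rintro q ⟨hq, hqR⟩
        have h1 : r⁻¹ * q * r ∈ MulAction.stabilizer P x ⊓ R := by
          refine ⟨?_, R.mul_mem (R.mul_mem (R.inv_mem hr) hqR) hr⟩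
          change (r⁻¹ * q * r) • x = x
          rw [mul_smul, mul_smul, inv_smul_eq_iff]
          exact hq
        rw [hx] at h1
        have := (Subgroup.mem_normalizer_iff.mp (hR hr) _).mp h1
        simpa [mul_assoc] using this
      · intro q hq
        refine ⟨smul_fixed_of_mem_normalizer (hR hr) (fun q hq => ?_) q hq, hQR hq⟩
        rw [← hx] at hq
        exact hq.1)
    (fun x hx => (hs x).mp hx)
  refine ⟨d, hd, ?_⟩
  rw [← hsum]
  have hcQ := fixedBy_anti ρ hQR hc
  have hw : ∑ x ∈ s, b.basis.repr c x • b.basis x ∈ fixedBy ρ Q := by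
    refine sum_mem fun x hx => Submodule.smul_mem _ _ fun q hq => ?_
    rw [b.apply_basis, hsfix x hx q hq]
  rw [b.mem_brKer_iff hP (sub_mem hcQ hw)]
  intro x hx
  have hrepr : b.basis.repr (∑ x ∈ s, b.basis.repr c x • b.basis x) x =
      if x ∈ s then b.basis.repr c x else 0 := by
    rw [map_sum, Finsupp.finsetSum_apply]
    simp [Finsupp.single_apply]
  rw [map_sub, Finsupp.sub_apply, hrepr]
  split_ifs with hxs
  · rw [sub_self]; exact zero_mem _
  · rw [sub_zero]
    have hle : Q ≤ MulAction.stabilizer P x ⊓ R := fun q hq => ⟨hx q hq, hQR hq⟩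
    have hlt : Q < MulAction.stabilizer P x ⊓ R :=
      lt_of_le_of_ne hle fun h => hxs ((hs x).mpr h.symm)
    exact (b.mem_brKer_iff hP (fixedBy_anti ρ inf_le_right hc)).mp (hker _ hlt inf_le_right) x
      fun q hq => hq.1

end PermBasis

end Restriction

/-! ### Indecomposability of the Brauer quotients `A(Q)` as algebras. -/

/-- A ring without central idempotents other than `0` and `1`. -/
def CentrallyIndecomposable (R : Type*) [Ring R] : Prop :=
  ∀ e : R, IsIdempotentElem e → (∀ x, e * x = x * e) → e = 0 ∨ e = 1

/-- Below a nonzero central idempotent of a finite-dimensional algebra there is a minimal one. -/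
theorem exists_minimal_central_idempotent {k R : Type*} [Field k] [Ring R] [Algebra k R]
    [FiniteDimensional k R] {c : R} (hc : IsIdempotentElem c) (hcc : ∀ x, c * x = x * c)
    (hc0 : c ≠ 0) :
    ∃ e : R, IsIdempotentElem e ∧ (∀ x, e * x = x * e) ∧ e ≠ 0 ∧ e * c = e ∧
      ∀ f, IsIdempotentElem f → (∀ x, f * x = x * f) → e * f = 0 ∨ e * f = e := by
  let T : Set R := {e | IsIdempotentElem e ∧ (∀ x, e * x = x * e) ∧ e ≠ 0 ∧ e * c = e}
  -- Minimality is obtained by minimizing the dimension of the right ideal `e R`.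
  let rk : R → ℕ := fun e => Module.finrank k (LinearMap.range (LinearMap.mulLeft k e))
  have hT : T.Nonempty := ⟨c, hc, hcc, hc0, hc⟩
  obtain ⟨e, ⟨he, hec, he0, hece⟩, hmin⟩ :=
    exists_minimalFor_of_wellFoundedLT (· ∈ T) rk hT
  refine ⟨e, he, hec, he0, hece, fun f hf hfc => ?_⟩
  by_contra! h
  have hef : e * f ∈ T := by
    refine ⟨?_, ?_, h.1, ?_⟩
    · change e * f * (e * f) = e * f
      rw [mul_assoc, ← mul_assoc f, hfc e, mul_assoc e f f, hf.eq, ← mul_assoc, he.eq]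
    · intro x
      rw [mul_assoc, hfc, ← mul_assoc, hec, mul_assoc]
    · rw [mul_assoc, hfc, ← mul_assoc, hece]
  have hle : LinearMap.range (LinearMap.mulLeft k (e * f)) ≤
      LinearMap.range (LinearMap.mulLeft k e) := by
    rintro _ ⟨x, rfl⟩
    exact ⟨f * x, by simp⟩
  have heq := Submodule.eq_of_le_of_finrank_le hle (hmin hef (Submodule.finrank_mono hle))
  have hmem : e ∈ LinearMap.range (LinearMap.mulLeft k (e * f)) := by
    rw [heq]
    exact ⟨1, by simp⟩
  obtain ⟨x, hx⟩ := hmem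
  rw [LinearMap.mulLeft_apply] at hx
  apply h.2
  have : e * f * e = e := by
    have h2 : e * f * (e * f * x) = e * f * x := by rw [← mul_assoc, hef.1.eq]
    rwa [hx] at h2
  rw [mul_assoc, hfc, ← mul_assoc, he.eq] at this
  exact this

section Connected

open IsLocalRing

variable {O P A : Type*} [CommRing O] [IsLocalRing O] [IsNoetherianRing O]
  [IsAdicComplete (maximalIdeal O) O] [Group P] [Finite P] [Ring A] [Algebra O A]
  [Module.Finite O A] {σ : P →* Aˣ}
  {p : ℕ} [Fact p.Prime] (hP : IsPGroup p P) [CharP (ResidueField O) p]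
  {X : Type*} [MulAction P X] [Fintype X] (b : PermBasis X (conj (O := O) σ))

include hP b

/-- This treats central idempotents of `A(Q)` having a lift `c` fixed by the normalizer `R` of `Q`.
At the groups strictly above `Q` and inside `R` induction makes `c` equal to `0` or `1`,
consistently, so one may assume that it is `0`. Then `c` agrees in `A(Q)` with an element
`Tr_Q^P(d)` of the local ring `A^P`. This element is not a unit, as `A(P) ≠ 0`, so the idempotent
given by `c` is nilpotent. -/
theorem eq_zero_or_eq_one_of_stable
    (htriv : ∀ e : fixAlg O σ ⊤, IsIdempotentElem e → e = 0 ∨ e = 1)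
    (h1 : (1 : A) ∉ brKer (conj (O := O) σ) ⊤) {Q : Subgroup P} (hQ : Q ≠ ⊤)
    (ih : ∀ R, Q < R → CentrallyIndecomposable (Br O σ R)) {c : A}
    (hc : c ∈ fixedBy (conj (O := O) σ) (Subgroup.normalizer (Q : Set P)))
    (hcc : c * c - c ∈ brKer (conj (O := O) σ) Q)
    (hcen : ∀ a ∈ fixedBy (conj (O := O) σ) Q, c * a - a * c ∈ brKer (conj (O := O) σ) Q) :
    c ∈ brKer (conj (O := O) σ) Q ∨ 1 - c ∈ brKer (conj (O := O) σ) Q := by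
  set R := Subgroup.normalizer (Q : Set P)
  have hQR : Q < R := by
    have : Group.IsNilpotent P := hP.isNilpotent
    exact Group.normalizerCondition_of_isNilpotent Q (lt_top_iff_ne_top.mpr hQ)
  have h1R : (1 : A) ∉ brKer (conj (O := O) σ) R := fun h =>
    h1 (b.mem_brKer_of_le hP le_top (one_mem_fixedBy σ ⊤) h)
  have key : ∀ R', Q < R' → R' ≤ R → c ∈ brKer (conj (O := O) σ) R' ∨
      1 - c ∈ brKer (conj (O := O) σ) R' := by
    intro R' hQR' hR'
    have hcR' := fixedBy_anti (conj (O := O) σ) hR' hc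
    have h := ih R' hQR' (br O σ R' ⟨c, hcR'⟩) (by
        refine (map_mul _ _ _).symm.trans (br_eq_iff.mpr ?_)
        exact b.mem_brKer_of_le hP hQR'.le (sub_mem (mul_mem_fixedBy hcR' hcR') hcR') hcc) (by
        intro x
        obtain ⟨x, rfl⟩ := br_surjective σ R' x
        rw [← map_mul, ← map_mul, br_eq_iff]
        exact b.mem_brKer_of_le hP hQR'.le
          (sub_mem (mul_mem_fixedBy hcR' x.2) (mul_mem_fixedBy x.2 hcR'))
          (hcen x (fixedBy_anti _ hQR'.le x.2)))
    rw [br_eq_zero_iff, eq_comm (b := (1 : Br O σ R')), ← map_one (br O σ R'), br_eq_iff] at h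
    exact h
  -- The hypotheses are symmetric under `c ↦ 1 - c`.
  wlog hcR : c ∈ brKer (conj (O := O) σ) R generalizing c
  · have h2 : (1 - c) * (1 - c) - (1 - c) ∈ brKer (conj (O := O) σ) Q := by
      convert hcc using 1
      noncomm_ring
    have h3 : ∀ a ∈ fixedBy (conj (O := O) σ) Q,
        (1 - c) * a - a * (1 - c) ∈ brKer (conj (O := O) σ) Q := by
      intro a ha
      convert neg_mem (hcen a ha) using 1
      noncomm_ring
    have h := this h2 h3 (sub_mem (one_mem_fixedBy σ R) hc)
      (fun R' h h' => by rw [sub_sub_cancel]; exact (key R' h h').symm)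
      ((key R hQR le_rfl).resolve_left hcR)
    rw [sub_sub_cancel] at h
    exact h.symm
  left
  have hker : ∀ R', Q < R' → R' ≤ R → c ∈ brKer (conj (O := O) σ) R' := by
    intro R' h h'
    -- Being `1` at `R'` would pass up to `R`, where the class of `c` is `0` and the class of `1` is
    -- not.
    refine (key R' h h').resolve_right fun hh => h1R ?_
    have := b.mem_brKer_of_le hP h' (sub_mem (one_mem_fixedBy σ R) hc) hh
    simpa using add_mem this hcR
  obtain ⟨d, hd, hcd⟩ := b.exists_sub_tr_mem_brKer hP hQR.le le_rfl hc hker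
  set T : fixAlg O σ ⊤ := ⟨tr (conj (O := O) σ) Q ⊤ d, tr_mem_fixedBy hd⟩
  -- Modulo the kernel at `Q`, the trace from `Q` to its normalizer may be replaced by the trace to
  -- `P`.
  have hcT : c - T ∈ brKer (conj (O := O) σ) Q := by
    have := sub_mem hcd (properTr_le_brKer _ _ (tr_top_sub_tr_normalizer_mem hd))
    convert this using 1
    simp only [T]
    abel
  have hTQ : (T : A) ∈ fixedBy (conj (O := O) σ) Q := fixedBy_anti _ le_top T.2
  rcases isUnit_or_pow_mem (R := O) htriv T with hT | ⟨n, hn⟩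
  · exfalso
    obtain ⟨u, hu⟩ := hT.exists_left_inv
    apply h1
    have h2 : (u : A) * T = 1 := congrArg Subtype.val hu
    rw [← h2]
    exact mul_mem_brKer_left u.2
      (properTr_le_brKer _ _ (tr_mem_properTr (lt_top_iff_ne_top.mpr hQ) hd))
  · have hcQ := fixedBy_anti (conj (O := O) σ) hQR.le hc
    have hbr : br O σ Q ⟨c, hcQ⟩ = br O σ Q ⟨T, hTQ⟩ := br_eq_iff.mpr hcT
    have hid : IsIdempotentElem (br O σ Q ⟨c, hcQ⟩) :=
      (map_mul _ _ _).symm.trans (br_eq_iff.mpr hcc)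
    have hnil : IsNilpotent (br O σ Q ⟨c, hcQ⟩) := by
      refine ⟨n, ?_⟩
      rw [hbr, ← map_pow, br_eq_zero_iff]
      have h3 : ∀ x : fixAlg O σ ⊤, x ∈ maximalIdeal O • (⊤ : Submodule O (fixAlg O σ ⊤)) →
          (x : A) ∈ brKer (conj (O := O) σ) Q := by
        intro x hx
        refine Submodule.smul_induction_on (p := fun x : fixAlg O σ ⊤ =>
          (x : A) ∈ brKer (conj (O := O) σ) Q) hx ?_ ?_
        · intro c hc x _
          exact smul_mem_brKer hc (fixedBy_anti _ le_top x.2)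
        · intro x y hx hy
          exact add_mem hx hy
      exact h3 _ hn
    exact br_eq_zero_iff.mp (eq_zero_of_isIdempotentElem_of_isNilpotent hid hnil)

/-- The action on `A(Q)` of an element of the normalizer of `Q`. -/
def brConj {Q : Subgroup P} {r : P} (hr : r ∈ Subgroup.normalizer (Q : Set P)) :
    Br O σ Q →ₗ[ResidueField O] Br O σ Q :=
  brLift ((br O σ Q).toLinearMap ∘ₗ
    ((conj (O := O) σ r ∘ₗ (fixAlg O σ Q).val.toLinearMap).codRestrict
      (Subalgebra.toSubmodule (fixAlg O σ Q))
      fun a => apply_mem_fixedBy_of_mem_normalizer hr a.2))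
    fun _ ha => br_eq_zero_iff.mpr (b.apply_mem_brKer hP hr ha)

omit [IsNoetherianRing O] [IsAdicComplete (maximalIdeal O) O] [Module.Finite O A] in
theorem brConj_br {Q : Subgroup P} {r : P} (hr : r ∈ Subgroup.normalizer (Q : Set P))
    (a : fixAlg O σ Q) : brConj hP b hr (br O σ Q a) =
      br O σ Q ⟨conj (O := O) σ r a, apply_mem_fixedBy_of_mem_normalizer hr a.2⟩ := rfl

omit [IsNoetherianRing O] [IsAdicComplete (maximalIdeal O) O] [Module.Finite O A] in
theorem brConj_mul {Q : Subgroup P} {r : P} (hr : r ∈ Subgroup.normalizer (Q : Set P))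
    (x y : Br O σ Q) : brConj hP b hr (x * y) = brConj hP b hr x * brConj hP b hr y := by
  obtain ⟨x, rfl⟩ := br_surjective σ Q x
  obtain ⟨y, rfl⟩ := br_surjective σ Q y
  rw [← map_mul, brConj_br, brConj_br, brConj_br, ← map_mul]
  congr 1
  exact Subtype.ext (conj_mul σ r x y)

omit [IsNoetherianRing O] [IsAdicComplete (maximalIdeal O) O] [Module.Finite O A] in
theorem brConj_comp {Q : Subgroup P} {r s : P} (hr : r ∈ Subgroup.normalizer (Q : Set P))
    (hs : s ∈ Subgroup.normalizer (Q : Set P)) (x : Br O σ Q) :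
    brConj hP b hr (brConj hP b hs x) = brConj hP b (mul_mem hr hs) x := by
  obtain ⟨x, rfl⟩ := br_surjective σ Q x
  rw [brConj_br, brConj_br, brConj_br]
  congr 1
  refine Subtype.ext ?_
  change conj (O := O) σ r (conj (O := O) σ s x) = conj (O := O) σ (r * s) x
  rw [map_mul, Module.End.mul_apply]

omit [IsNoetherianRing O] [IsAdicComplete (maximalIdeal O) O] [Module.Finite O A] in
theorem brConj_eq_self {Q : Subgroup P} {r : P} (hr : r ∈ Subgroup.normalizer (Q : Set P))
    (hrQ : r = 1) (x : Br O σ Q) : brConj hP b hr x = x := by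
  obtain ⟨x, rfl⟩ := br_surjective σ Q x
  subst hrQ
  rw [brConj_br]
  congr 1
  exact Subtype.ext (by simp)

omit [IsNoetherianRing O] [IsAdicComplete (maximalIdeal O) O] [Module.Finite O A] in
theorem brConj_surjective {Q : Subgroup P} {r : P} (hr : r ∈ Subgroup.normalizer (Q : Set P)) :
    Function.Surjective (brConj (O := O) (σ := σ) hP b hr) := fun x =>
  ⟨brConj hP b (inv_mem hr) x, by
    rw [brConj_comp]; exact brConj_eq_self hP b _ (mul_inv_cancel r) x⟩

/-- If `A` has a stable basis, `A^P` is local and `A(P) ≠ 0`, then all Brauer quotients of `A` are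
indecomposable as algebras. -/
theorem br_centrallyIndecomposable
    (htriv : ∀ e : fixAlg O σ ⊤, IsIdempotentElem e → e = 0 ∨ e = 1)
    (h1 : (1 : A) ∉ brKer (conj (O := O) σ) ⊤) (Q : Subgroup P) :
    CentrallyIndecomposable (Br O σ Q) := by
  classical
  induction Q using WellFoundedGT.induction with
  | _ Q ih =>
  by_cases hQ : Q = ⊤
  · subst hQ
    exact fun e he _ => br_idempotent_trivial htriv e he
  intro c hc hcc
  by_cases hc0 : c = 0
  · exact Or.inl hc0
  right
  set R := Subgroup.normalizer (Q : Set P)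
  have hstable := fun c => eq_zero_or_eq_one_of_stable hP b htriv h1 hQ ih (c := c)
  have h1R : (1 : A) ∉ brKer (conj (O := O) σ) R := fun h =>
    h1 (b.mem_brKer_of_le hP le_top (one_mem_fixedBy σ ⊤) h)
  -- for an `R`-fixed lift of a central idempotent
  have hstable' : ∀ a (ha : a ∈ fixedBy (conj (O := O) σ) R),
      IsIdempotentElem (br O σ Q ⟨a, fixedBy_anti _ Subgroup.le_normalizer ha⟩) →
      (∀ x, br O σ Q ⟨a, fixedBy_anti _ Subgroup.le_normalizer ha⟩ * x =
        x * br O σ Q ⟨a, fixedBy_anti _ Subgroup.le_normalizer ha⟩) →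
      a ∈ brKer (conj (O := O) σ) Q ∨ 1 - a ∈ brKer (conj (O := O) σ) Q := by
    intro a ha hid hcen
    refine hstable a ha ?_ ?_
    · exact br_eq_iff.mp ((map_mul _ _ _).trans hid.eq)
    · intro x hx
      have := hcen (br O σ Q ⟨x, hx⟩)
      rw [← map_mul, ← map_mul] at this
      exact br_eq_iff.mp this
  obtain ⟨e, he, hec, he0, hece, hmin⟩ :=
    exists_minimal_central_idempotent (k := ResidueField O) hc hcc hc0
  have hτid : ∀ r (hr : r ∈ R), IsIdempotentElem (brConj hP b hr e) := fun r hr => by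
    rw [IsIdempotentElem, ← brConj_mul, he.eq]
  have hτcen : ∀ r (hr : r ∈ R) x, brConj hP b hr e * x = x * brConj hP b hr e := by
    intro r hr x
    obtain ⟨x, rfl⟩ := brConj_surjective hP b hr x
    rw [← brConj_mul, ← brConj_mul, hec]
  -- Conjugates of a minimal central idempotent are equal or orthogonal to it.
  have hdich : ∀ r (hr : r ∈ R), e * brConj hP b hr e = 0 ∨ brConj hP b hr e = e := by
    intro r hr
    rcases hmin _ (hτid r hr) (hτcen r hr) with h | h
    · exact Or.inl h
    · right
      rcases hmin _ (hτid r⁻¹ (inv_mem hr)) (hτcen r⁻¹ (inv_mem hr)) with h' | h'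
      · exfalso
        have := congrArg (brConj hP b hr) h'
        rw [brConj_mul, brConj_comp, brConj_eq_self hP b _ (mul_inv_cancel r), map_zero,
          ← hec, h] at this
        exact he0 this
      · have := congrArg (brConj hP b hr) h'
        rw [brConj_mul, brConj_comp, brConj_eq_self hP b _ (mul_inv_cancel r), ← hec, h] at this
        exact this.symm
  obtain ⟨a, rfl⟩ := br_surjective σ Q e
  -- The stabilizer of the idempotent in the normalizer `R`. If it is all of `R`, then `e` lifts to
  -- an `R`-fixed element, so `e = 1` and hence `c = 1`.
  let R₁ : Subgroup P :=
    { carrier := {r | r ∈ R ∧ conj (O := O) σ r a - a ∈ brKer (conj (O := O) σ) Q}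
      one_mem' := ⟨one_mem R, by simp⟩
      mul_mem' := by
        rintro r s ⟨hr, hra⟩ ⟨hs, hsa⟩
        refine ⟨mul_mem hr hs, ?_⟩
        have := add_mem (b.apply_mem_brKer hP hr hsa) hra
        rwa [map_sub, sub_add_sub_cancel, ← Module.End.mul_apply, ← map_mul] at this
      inv_mem' := by
        rintro r ⟨hr, hra⟩
        refine ⟨inv_mem hr, ?_⟩
        have := neg_mem (b.apply_mem_brKer hP (inv_mem hr) hra)
        rwa [map_sub, neg_sub, ← Module.End.mul_apply, ← map_mul, inv_mul_cancel, map_one] at this }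
  have hR₁R : R₁ ≤ R := fun r hr => hr.1
  have hQR₁ : Q ≤ R₁ := fun q hq => ⟨Subgroup.le_normalizer hq, by
    rw [(mem_fixAlg.mp a.2) q hq, sub_self]; exact zero_mem _⟩
  have hmemR₁ : ∀ r (hr : r ∈ R), brConj hP b hr (br O σ Q a) = br O σ Q a → r ∈ R₁ :=
    fun r hr h => ⟨hr, br_eq_iff.mp h⟩
  obtain ⟨a', ha', haa'⟩ := b.exists_lift hP hQR₁ hR₁R a.2 fun r hr => hr.2
  have hbr : br O σ Q ⟨a', fixedBy_anti _ hQR₁ ha'⟩ = br O σ Q a := (br_eq_iff.mpr haa').symm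
  rcases eq_or_lt_of_le hR₁R with hR₁ | hR₁
  · have haR : a' ∈ fixedBy (conj (O := O) σ) R := hR₁ ▸ ha'
    have h := hstable' a' haR (by rw [hbr]; exact he) (by rw [hbr]; exact hec)
    rcases h with h | h
    · exact absurd (hbr.symm.trans (br_eq_zero_iff.mpr h)) he0
    · have h2 : br O σ Q 1 = br O σ Q ⟨a', fixedBy_anti _ hQR₁ ha'⟩ := br_eq_iff.mpr h
      rw [hbr, map_one] at h2
      rwa [← h2, one_mul] at hece
  -- If `R₁ < R`, the sum of the conjugates of `e` is an `R`-stable central idempotent, so it is `0`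
  -- or `1`. It is not `0` since its product with `e` is `e`; it is not `1` since it lifts to a
  -- proper trace to `R`, while `A(R) ≠ 0`.
  · exfalso
    have hout : ∀ y ∈ cosetsIn R₁ R, y.out ∈ R := fun y hy => out_mem_of_mem_cosetsIn hR₁.le hy
    set T := tr (conj (O := O) σ) R₁ R a'
    have hT : T ∈ fixedBy (conj (O := O) σ) R := tr_mem_fixedBy ha'
    have hTR : T ∈ brKer (conj (O := O) σ) R := properTr_le_brKer _ _ (tr_mem_properTr hR₁ ha')
    have hbrT : br O σ Q ⟨T, fixedBy_anti _ Subgroup.le_normalizer hT⟩ =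
        ∑ y : cosetsIn R₁ R, brConj hP b (hout y y.2) (br O σ Q a) := by
      rw [← hbr]
      simp only [brConj_br]
      rw [← map_sum]
      congr 1
      refine Subtype.ext ?_
      simp only [T, tr_apply]
      rw [← Finset.sum_coe_sort]
      simp
    have horth : ∀ y y' : cosetsIn R₁ R, y ≠ y' →
        brConj hP b (hout y y.2) (br O σ Q a) * brConj hP b (hout y' y'.2) (br O σ Q a) = 0 := by
      intro y y' hne
      have hmem : (y : P ⧸ R₁).out⁻¹ * (y' : P ⧸ R₁).out ∈ R :=
        mul_mem (inv_mem (hout y y.2)) (hout y' y'.2)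
      have h2 : brConj hP b (hout y' y'.2) (br O σ Q a) =
          brConj hP b (hout y y.2) (brConj hP b hmem (br O σ Q a)) := by
        rw [brConj_comp]
        congr 2
        simp
      rw [h2, ← brConj_mul]
      rcases hdich _ hmem with h | h
      · rw [h, map_zero]
      · exfalso
        apply hne
        have := hmemR₁ _ hmem h
        refine Subtype.ext ?_
        rw [← QuotientGroup.out_eq' (y : P ⧸ R₁), ← QuotientGroup.out_eq' (y' : P ⧸ R₁)]
        exact QuotientGroup.eq.mpr this
    have hTid : IsIdempotentElem (br O σ Q ⟨T, fixedBy_anti _ Subgroup.le_normalizer hT⟩) := by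
      rw [hbrT, IsIdempotentElem, Finset.sum_mul_sum]
      refine Finset.sum_congr rfl fun y _ => ?_
      rw [Finset.sum_eq_single y (fun y' _ h => horth y y' h.symm) (by simp)]
      exact hτid _ _
    have hTcen : ∀ x, br O σ Q ⟨T, fixedBy_anti _ Subgroup.le_normalizer hT⟩ * x =
        x * br O σ Q ⟨T, fixedBy_anti _ Subgroup.le_normalizer hT⟩ := by
      intro x
      rw [hbrT, Finset.sum_mul, Finset.mul_sum]
      exact Finset.sum_congr rfl fun y _ => hτcen _ _ x
    rcases hstable' T hT hTid hTcen with h | h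
    · have h0 : br O σ Q ⟨T, fixedBy_anti _ Subgroup.le_normalizer hT⟩ = 0 := br_eq_zero_iff.mpr h
      rw [hbrT] at h0
      have hy1 : (QuotientGroup.mk 1 : P ⧸ R₁) ∈ cosetsIn R₁ R :=
        mem_cosetsIn.mpr ⟨1, one_mem R, rfl⟩
      have h2 := congrArg (brConj hP b (hout _ hy1) (br O σ Q a) * ·) h0
      simp only [Finset.mul_sum, mul_zero] at h2
      rw [Finset.sum_eq_single ⟨_, hy1⟩ (fun y' _ h => horth _ y' h.symm) (by simp),
        (hτid _ _).eq] at h2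
      have hmem : (QuotientGroup.mk 1 : P ⧸ R₁).out ∈ R₁ := by
        have := QuotientGroup.eq.mp (QuotientGroup.out_eq' (QuotientGroup.mk 1 : P ⧸ R₁)).symm
        simpa using this
      have h3 : brConj hP b (hout _ hy1) (br O σ Q a) = br O σ Q a := br_eq_iff.mpr hmem.2
      exact he0 (h3.symm.trans h2)
    · have := b.mem_brKer_of_le hP Subgroup.le_normalizer (sub_mem (one_mem_fixedBy σ R) hT) h
      exact h1R (by simpa using add_mem this hTR)

end Connected

/-! ### Fixed vectors of `p`-groups and endomorphisms of transitive permutation modules. -/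

section FixedVector

variable {P : Type*} [Group P] {p : ℕ} [Fact p.Prime] (hP : IsPGroup p P) [Finite P]
include hP

/-- A `p`-group acting on a nonzero vector space of characteristic `p` has a nonzero fixed
vector. -/
theorem exists_fixed_vector {k M : Type*} [Field k] [CharP k p] [AddCommGroup M] [Module k M]
    (ρ : Representation k P M) (W : Submodule k M) (hW : ∀ g, ∀ w ∈ W, ρ g w ∈ W) (hW0 : W ≠ ⊥) :
    ∃ w ∈ W, w ≠ 0 ∧ ∀ g, ρ g w = w := by
  obtain ⟨w, hw, hw0⟩ := W.ne_bot_iff.mp hW0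
  have hpM : ∀ x : M, p • x = 0 := fun x => by
    rw [← Nat.cast_smul_eq_nsmul k, CharP.cast_eq_zero, zero_smul]
  have : Module (ZMod p) M := AddCommGroup.zmodModule hpM
  let f : P → (M →ₗ[ZMod p] M) := fun g => (ρ g).toAddMonoidHom.toZModLinearMap p
  -- The span of an orbit over the prime field is finite of order divisible by `p`, so `0` is not
  -- its only fixed point. No finiteness of `M` over `k` is needed.
  let D : Submodule (ZMod p) M := Submodule.span (ZMod p) (Set.range fun g => ρ g w)
  have hfD : ∀ g, ∀ m ∈ D, ρ g m ∈ D := by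
    intro g
    suffices D ≤ D.comap (f g) from this
    refine Submodule.span_le.mpr ?_
    rintro _ ⟨h, rfl⟩
    change ρ g (ρ h w) ∈ D
    rw [← Module.End.mul_apply, ← map_mul]
    exact Submodule.subset_span ⟨_, rfl⟩
  have hDW : ∀ m ∈ D, m ∈ W := by
    suffices D ≤ AddSubgroup.toZModSubmodule p W.toAddSubgroup from this
    refine Submodule.span_le.mpr ?_
    rintro _ ⟨h, rfl⟩
    exact hW h w hw
  let act : MulAction P D :=
    { smul := fun g m => ⟨ρ g m, hfD g m m.2⟩
      one_smul := fun m => Subtype.ext (by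
        change ρ 1 (m : M) = m
        simp)
      mul_smul := fun g h m => Subtype.ext (by
        change ρ (g * h) (m : M) = ρ g (ρ h m)
        simp) }
  have hfin : Module.Finite (ZMod p) D := Module.Finite.span_of_finite _ (Set.finite_range _)
  have : Finite D := Module.finite_of_finite (ZMod p)
  have hwD : w ∈ D := Submodule.subset_span ⟨1, by simp⟩
  have : Nontrivial D := ⟨⟨w, hwD⟩, 0, fun h => hw0 (congrArg Subtype.val h)⟩
  have hdvd : p ∣ Nat.card D := by
    rw [Module.natCard_eq_pow_finrank (K := ZMod p), Nat.card_zmod]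
    exact dvd_pow_self p (Module.finrank_pos).ne'
  obtain ⟨v, hv, hv0⟩ := hP.exists_fixed_point_of_prime_dvd_card_of_fixed_point D hdvd
    (a := 0) (fun g => Subtype.ext (map_zero (ρ g)))
  exact ⟨v, hDW v v.2, fun h => hv0 (Subtype.ext h.symm), fun g => congrArg Subtype.val (hv g)⟩

/-- Over a field of characteristic `p`, an endomorphism of a transitive permutation module with
nonzero row sums is invertible. -/
theorem isUnit_of_row_sum_ne_zero {k Z : Type*} [Field k] [CharP k p] [Fintype Z] [DecidableEq Z]
    [MulAction P Z] [MulAction.IsPretransitive P Z] (m : Matrix Z Z k)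
    (hm : ∀ g : P, ∀ y z, m (g • y) (g • z) = m y z) (y₀ : Z) (h0 : ∑ z, m y₀ z ≠ 0) :
    IsUnit m := by
  let ρ : Representation k P (Z → k) :=
    { toFun := fun g => LinearMap.funLeft k k (g⁻¹ • ·)
      map_one' := by ext; simp [LinearMap.funLeft]
      map_mul' := fun g h => by
        refine LinearMap.ext fun f => funext fun z => ?_
        simp [LinearMap.funLeft_apply, mul_smul] }
  have hρ : ∀ g f z, ρ g f z = f (g⁻¹ • z) := fun _ _ _ => rfl
  have hmρ : ∀ g f, m.mulVec (ρ g f) = ρ g (m.mulVec f) := by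
    intro g f
    ext z
    simp only [Matrix.mulVec, dotProduct, hρ]
    refine Fintype.sum_equiv (MulAction.toPerm g⁻¹) _ _ fun y => ?_
    rw [MulAction.toPerm_apply, hm]
  rw [← Matrix.mulVec_injective_iff_isUnit]
  change Function.Injective (Matrix.mulVecLin m)
  rw [← LinearMap.ker_eq_bot]
  by_contra hker
  -- A fixed vector of the kernel is constant by transitivity, and `m` multiplies the value of a
  -- constant vector at `y₀` by the row sum.
  obtain ⟨f, hf, hf0, hfix⟩ := exists_fixed_vector hP ρ (LinearMap.ker (Matrix.mulVecLin m))
    (fun g f hf => by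
      rw [LinearMap.mem_ker, Matrix.mulVecLin_apply] at hf ⊢
      rw [hmρ, hf, map_zero]) hker
  have hconst : ∀ z, f z = f y₀ := by
    intro z
    obtain ⟨g, rfl⟩ := MulAction.exists_smul_eq P z y₀
    conv_rhs => rw [← hfix g]
    rw [hρ, inv_smul_smul]
  have h1 := congrFun (LinearMap.mem_ker.mp hf) y₀
  rw [Matrix.mulVecLin_apply, Matrix.mulVec, dotProduct, Finset.sum_congr rfl
    fun z _ => by rw [hconst z], ← Finset.sum_mul] at h1
  rcases mul_eq_zero.mp h1 with h | h
  · exact h0 h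
  · exact hf0 (funext fun z => (hconst z).trans h)

/-- The row sums of `m` and `1 - m` at a given index add up to `1`, so one of them is nonzero in the
residue field. Invertibility lifts through the determinant. Thus endomorphisms of a transitive
permutation module form a local ring. -/
theorem isUnit_or_isUnit_one_sub {O Z : Type*} [CommRing O] [IsLocalRing O]
    [CharP (IsLocalRing.ResidueField O) p] [Fintype Z] [DecidableEq Z] [Nonempty Z]
    [MulAction P Z] [MulAction.IsPretransitive P Z] (m : Matrix Z Z O)
    (hm : ∀ g : P, ∀ y z, m (g • y) (g • z) = m y z) : IsUnit m ∨ IsUnit (1 - m) := by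
  have hlift : ∀ m : Matrix Z Z O, IsUnit ((IsLocalRing.residue O).mapMatrix m) → IsUnit m := by
    intro m h
    rw [Matrix.isUnit_iff_isUnit_det, ← RingHom.map_det] at h
    exact (Matrix.isUnit_iff_isUnit_det m).mpr (isUnit_of_map_unit _ _ h)
  let y₀ : Z := Classical.arbitrary Z
  by_cases h0 : ∑ z, (IsLocalRing.residue O).mapMatrix m y₀ z = 0
  · right
    apply hlift
    refine isUnit_of_row_sum_ne_zero hP _ ?_ y₀ ?_
    · intro g y z
      simp [hm, Matrix.one_apply]
    · rw [map_sub, map_one]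
      simp only [Matrix.sub_apply, Finset.sum_sub_distrib, h0]
      simp [Matrix.one_apply]
  · left
    exact hlift m (isUnit_of_row_sum_ne_zero hP _ (fun g y z => by simp [hm]) y₀ h0)

end FixedVector

/-! ### Direct summands of permutation modules. -/

section PermutationSummand

universe u w

variable {P : Type*} [Group P]

theorem PermBasis.hasStableBasis {O M X : Type*} [CommRing O] [Nontrivial O] [AddCommGroup M]
    [Module O M] {ρ : Representation O P M} [MulAction P X] (b : PermBasis X ρ) :
    HasStableBasis ρ := by
  refine ⟨Set.range b.basis, ?_, b.basis.span_eq, ?_⟩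
  · exact b.basis.linearIndependent.linearIndepOn_id
  · rintro g _ ⟨x, rfl⟩
    exact ⟨g • x, (b.apply_basis g x).symm⟩

variable {p : ℕ} [Fact p.Prime] (hP : IsPGroup p P) [Finite P]
include hP

/-- A direct summand of a permutation module of a `p`-group over a local ring is a permutation
module. -/
theorem exists_permBasis_of_sum_eq {O : Type*} {Y : Type u} [CommRing O] [IsLocalRing O]
    [CharP (IsLocalRing.ResidueField O) p] [MulAction P Y] (s : Finset Y)
    (hs : ∀ g : P, ∀ y ∈ s, g • y ∈ s)
    {N : Type w} [AddCommGroup N] [Module O N] (ρ : Representation O P N)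
    (v : Y → N) (ξ : Y → N →ₗ[O] O) (hv : ∀ g y, v (g • y) = ρ g (v y))
    (hξ : ∀ g y n, ξ (g • y) (ρ g n) = ξ y n) (hsum : ∀ n, ∑ y ∈ s, ξ y n • v y = n) :
    ∃ (X : Type u) (_ : MulAction P X), Nonempty (PermBasis X ρ) := by
  classical
  induction s using Finset.strongInduction generalizing N with
  | _ s ih =>
  rcases s.eq_empty_or_nonempty with rfl | ⟨y₀, hy₀⟩
  · have : Subsingleton N := ⟨fun a b => by rw [← hsum a, ← hsum b]; simp⟩
    let act : MulAction P PEmpty.{u + 1} :=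
      { smul := fun _ x => x, one_smul := fun _ => rfl, mul_smul := fun _ _ _ => rfl }
    exact ⟨PEmpty, act, ⟨⟨Module.Basis.empty N, fun _ x => x.elim⟩⟩⟩
  set o : Finset Y := s.filter fun z => z ∈ MulAction.orbit P y₀
  have ho : ∀ z, z ∈ o ↔ z ∈ MulAction.orbit P y₀ := by
    intro z
    simp only [o, Finset.mem_filter, and_iff_right_iff_imp]
    rintro ⟨g, rfl⟩
    exact hs g y₀ hy₀
  have hyo : y₀ ∈ o := (ho y₀).mpr (MulAction.mem_orbit_self y₀)
  have hos : o ⊆ s := Finset.filter_subset _ _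
  have hlt := Finset.sdiff_ssubset hos ⟨y₀, hyo⟩
  have hs' : ∀ g : P, ∀ y ∈ s \ o, g • y ∈ s \ o := by
    intro g y hy
    rw [Finset.mem_sdiff, ho] at hy ⊢
    exact ⟨hs g y hy.1, fun h => hy.2 (by
      obtain ⟨g', h⟩ := h
      exact ⟨g⁻¹ * g', by simpa [mul_smul, inv_smul_eq_iff] using h⟩)⟩
  let Z := MulAction.orbit P y₀
  have : Finite Z := (Set.finite_range fun g : P => g • y₀).to_subtype
  let _ : Fintype Z := Fintype.ofFinite _
  have : Nonempty Z := ⟨⟨y₀, MulAction.mem_orbit_self y₀⟩⟩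
  have hsumZ : ∀ {M : Type _} [AddCommMonoid M] (f : Y → M), ∑ y ∈ o, f y = ∑ z : Z, f z := by
    intro M _ f
    exact Finset.sum_subtype o ho f
  have hsplit : ∀ n, ∑ y ∈ s \ o, ξ y n • v y + ∑ z : Z, ξ z n • v z = n := by
    intro n
    rw [← hsumZ fun y => ξ y n • v y, Finset.sum_sdiff hos, hsum]
  let a : (Z → O) →ₗ[O] N := Fintype.linearCombination O fun z : Z => v z
  let b : N →ₗ[O] (Z → O) := LinearMap.pi fun z : Z => ξ z
  have hab : ∀ n, a (b n) = ∑ z : Z, ξ z n • v z := fun n => by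
    simp [a, b, Fintype.linearCombination_apply]
  have hρab : ∀ g n, ρ g (a (b n)) = a (b (ρ g n)) := by
    intro g n
    rw [hab, hab, map_sum]
    refine Fintype.sum_equiv (MulAction.toPerm g) _ _ fun z => ?_
    rw [MulAction.toPerm_apply, MulAction.orbit.coe_smul, hξ, hv, map_smul]
  let m : Matrix Z Z O := Matrix.of fun z y => ξ z (v y)
  have hm : ∀ (g : P) (y z : Z), m (g • y) (g • z) = m y z := by
    intro g y z
    change ξ (g • y : Z) (v (g • z : Z)) = ξ y (v z)
    rw [MulAction.orbit.coe_smul, MulAction.orbit.coe_smul, hv, hξ]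
  have hmc : Matrix.toLinAlgEquiv' m = b ∘ₗ a := by
    refine LinearMap.ext fun f => funext fun z => ?_
    simp only [m, a, b, Matrix.toLinAlgEquiv'_apply, Matrix.mulVec, dotProduct, Matrix.of_apply,
      LinearMap.comp_apply, Fintype.linearCombination_apply, LinearMap.pi_apply, map_sum, map_smul,
      smul_eq_mul]
    exact Finset.sum_congr rfl fun y _ => mul_comm _ _
  -- Here `m` is the matrix of `b ∘ a`, an equivariant endomorphism of the permutation module on the
  -- orbit `Z`.
  rcases isUnit_or_isUnit_one_sub hP m hm with hu | hu
  · -- the orbit splits off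
    have hu' := hu.map (Matrix.toLinAlgEquiv' (R := O) (n := Z))
    rw [hmc] at hu'
    obtain ⟨c, hc⟩ := hu'.exists_right_inv
    obtain ⟨c', hc'⟩ := hu'.exists_left_inv
    have hcc : c' = c := left_inv_eq_right_inv hc' hc
    subst hcc
    have hc : ∀ f, b (a (c' f)) = f := fun f => LinearMap.congr_fun hc f
    have hc' : ∀ f, c' (b (a f)) = f := fun f => LinearMap.congr_fun hc' f
    have hρa : ∀ g f, ρ g (a f) = a fun z => f (g⁻¹ • z) := by
      intro g f
      simp only [a, Fintype.linearCombination_apply, map_sum, map_smul]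
      refine Fintype.sum_equiv (MulAction.toPerm g) _ _ fun z => ?_
      rw [MulAction.toPerm_apply, inv_smul_smul, MulAction.orbit.coe_smul, hv]
    have hbρ : ∀ g n z, b (ρ g n) z = b n (g⁻¹ • z) := by
      intro g n z
      change ξ z (ρ g n) = ξ (g⁻¹ • z : Z) n
      conv_rhs => rw [← hξ g, ← MulAction.orbit.coe_smul, smul_inv_smul]
    have hker : ∀ g, ∀ n ∈ LinearMap.ker b, ρ g n ∈ LinearMap.ker b := by
      intro g n hn
      rw [LinearMap.mem_ker] at hn ⊢
      ext z
      rw [hbρ, hn]; rfl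
    let ρ' : Representation O P (LinearMap.ker b) :=
      { toFun := fun g => (ρ g).restrict (hker g)
        map_one' := by ext; simp
        map_mul' := fun g h => by ext; simp }
    -- With `c' = (b ∘ a)⁻¹`, this is the projection onto `ker b` along the image of `a`. The kernel
    -- inherits a decomposition of its identity over the remaining orbits.
    let q : N →ₗ[O] LinearMap.ker b :=
      (LinearMap.id - a ∘ₗ c' ∘ₗ b).codRestrict (LinearMap.ker b) fun n => by
        simp [hc]
    have hq : ∀ n, (q n : N) = n - a (c' (b n)) := fun _ => rfl
    have hqa : ∀ f, q (a f) = 0 := fun f => Subtype.ext (by rw [hq, hc', sub_self]; rfl)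
    have hqker : ∀ n : LinearMap.ker b, q n = n := fun n => Subtype.ext (by
      rw [hq, LinearMap.mem_ker.mp n.2, map_zero, map_zero, sub_zero])
    have hqρ : ∀ g n, q (ρ g n) = ρ' g (q n) := by
      intro g n
      have h1 : n = q n + a (c' (b n)) := by rw [hq, sub_add_cancel]
      conv_lhs => rw [h1]
      rw [map_add, hρa, map_add, hqa, add_zero]
      exact hqker (ρ' g (q n))
    obtain ⟨X, act, ⟨B⟩⟩ := ih _ hlt hs' ρ' (fun y => q (v y))
      (fun y => ξ y ∘ₗ (LinearMap.ker b).subtype) (fun g y => by rw [hv, hqρ])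
      (fun g y n => hξ g y n) (fun n => by
        have h1 := congrArg q (hsplit n)
        rw [← hab, map_add, hqa, add_zero, hqker, map_sum] at h1
        simpa using h1)
    let e : ((Z → O) × LinearMap.ker b) ≃ₗ[O] N :=
      LinearEquiv.ofLinearMap (a.coprod (LinearMap.ker b).subtype) ((c' ∘ₗ b).prod q)
        (by
          refine LinearMap.ext fun n => ?_
          simp [hq])
        (by
          refine LinearMap.ext fun x => Prod.ext ?_ ?_
          · have h2 := LinearMap.mem_ker.mp x.2.2
            simp [hc', h2]
          · simp [hqa, hqker])
    refine ⟨Z ⊕ X, inferInstance, ⟨⟨((Pi.basisFun O Z).prod B.basis).map e, ?_⟩⟩⟩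
    rintro g (z | x)
    · have h1 : ∀ z : Z, ((Pi.basisFun O Z).prod B.basis).map e (Sum.inl z) = v z := by
        intro z
        simp [e, a, Fintype.linearCombination_apply, Pi.single_apply]
      rw [h1, ← hv, Sum.smul_inl, h1]
      rfl
    · have h1 : ∀ x : X, ((Pi.basisFun O Z).prod B.basis).map e (Sum.inr x) = B.basis x := by
        intro x
        simp [e]
      rw [h1, Sum.smul_inr, h1, ← B.apply_basis]
      rfl
  · -- the orbit is superfluous
    have hu' := hu.map (Matrix.toLinAlgEquiv' (R := O) (n := Z))
    rw [map_sub, map_one, hmc] at hu'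
    obtain ⟨c, hc⟩ := hu'.exists_right_inv
    obtain ⟨c', hc'⟩ := hu'.exists_left_inv
    have hc : ∀ f, c f - b (a (c f)) = f := fun f => LinearMap.congr_fun hc f
    -- The inverse of `1 - a ∘ b`, by the identity `(1 - a b)⁻¹ = 1 + a (1 - b a)⁻¹ b`. Since `1 - a
    -- ∘ b` is the sum over the other orbits, composing the vectors `v y` with `u` makes that sum
    -- the identity.
    let u : Module.End O N := 1 + a ∘ₗ c ∘ₗ b
    have hu1 : ∀ n, u n - a (b (u n)) = n := by
      intro n
      simp only [u, LinearMap.add_apply, Module.End.one_apply, LinearMap.comp_apply, map_add]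
      have := congrArg a (hc (b n))
      rw [map_sub] at this
      rw [← this]
      abel
    have hinj : ∀ n n', n - a (b n) = n' - a (b n') → n = n' := by
      intro n n' hn
      rw [← sub_eq_zero] at hn ⊢
      rw [sub_sub_sub_comm, ← map_sub, ← map_sub] at hn
      generalize n - n' = n at hn
      have h1 : b n - b (a (b n)) = 0 := by rw [← map_sub, hn, map_zero]
      have h2 : b n = 0 := by
        have h3 : ∀ f, c' (f - b (a f)) = f := fun f => LinearMap.congr_fun hc' f
        rw [← h3 (b n), h1, map_zero]
      rwa [h2, map_zero, sub_zero] at hn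
    have hu2 : ∀ n, u (n - a (b n)) = n := fun n => hinj _ _ (hu1 _)
    refine ih _ hlt hs' ρ (fun y => u (v y)) ξ ?_ hξ ?_
    · intro g y
      rw [hv]
      have h1 := hu1 (ρ g (v y))
      have h2 := congrArg (ρ g) (hu1 (v y))
      rw [map_sub, hρab] at h2
      exact hinj _ _ (h1.trans h2.symm)
    · intro n
      have := hsplit n
      rw [← hab, ← eq_sub_iff_add_eq] at this
      have h2 := congrArg u this
      rw [hu2, map_sum] at h2
      simpa using h2

end PermutationSummand

/-! ### Matrix entries of elements of `A ⊗ C` and the sandwich map. -/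

section MatrixEntries

variable {k A C : Type*} [Field k] [Ring A] [Algebra k A] [Ring C] [Algebra k C]
  {n : Type*} [Fintype n] [DecidableEq n]

/-- The algebra map `A ⊗ C → M_n(C)` given by a matrix representation of `A`. -/
def matEnt (φ : A →ₐ[k] Matrix n n k) : A ⊗[k] C →ₐ[k] Matrix n n C :=
  Algebra.TensorProduct.lift ((AlgHom.mapMatrix (Algebra.ofId k C)).comp φ)
    (Matrix.scalarAlgHom n k) fun x c => by
      rw [commute_iff_eq]
      ext i j
      simp [Matrix.scalar, Algebra.ofId_apply, Algebra.commutes]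

theorem matEnt_tmul (φ : A →ₐ[k] Matrix n n k) (x : A) (c : C) (i j : n) :
    matEnt φ (x ⊗ₜ c) i j = φ x i j • c := by
  rw [matEnt, Algebra.TensorProduct.lift_tmul]
  simp [Matrix.scalar, Algebra.ofId_apply, Algebra.smul_def]

variable {ι : Type*} [Fintype ι] [DecidableEq ι] {d : ι → ℕ}

theorem pi_matrix_eq_sum (m : Π i, Matrix (Fin (d i)) (Fin (d i)) k) :
    ∑ i, ∑ a, ∑ b, m i a b • (Pi.single i (Matrix.single a b 1) :
      Π i, Matrix (Fin (d i)) (Fin (d i)) k) = m := by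
  conv_rhs => rw [← Finset.univ_sum_single m]
  refine Finset.sum_congr rfl fun i _ => ?_
  conv_rhs => rw [Matrix.matrix_eq_sum_single (m i)]
  rw [← AddMonoidHom.single_apply, map_sum]
  refine Finset.sum_congr rfl fun a _ => ?_
  rw [map_sum]
  refine Finset.sum_congr rfl fun b _ => ?_
  rw [AddMonoidHom.single_apply, ← Pi.single_smul, Matrix.smul_single, smul_eq_mul, mul_one]

/-- Expansion of an element of `A ⊗ C` in matrix units of `A`. -/
theorem map_id_eq_sum_matEnt (π : A →ₐ[k] Π i, Matrix (Fin (d i)) (Fin (d i)) k) (z : A ⊗[k] C) :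
    Algebra.TensorProduct.map π (AlgHom.id k C) z =
      ∑ i, ∑ a, ∑ b, (Pi.single i (Matrix.single a b 1) :
        Π i, Matrix (Fin (d i)) (Fin (d i)) k) ⊗ₜ
          matEnt ((Pi.evalAlgHom k _ i).comp π) z a b := by
  induction z with
  | zero => simp
  | add y z hy hz =>
    simp only [map_add, hy, hz, Matrix.add_apply, TensorProduct.tmul_add, Finset.sum_add_distrib]
  | tmul x c =>
    rw [Algebra.TensorProduct.map_tmul]
    conv_lhs => rw [← pi_matrix_eq_sum (π x)]
    simp [TensorProduct.sum_tmul, matEnt_tmul, TensorProduct.smul_tmul]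

/-- The bilinear map `(a ⊗ c₁, a' ⊗ c₂) ↦ t(c₁ c c₂) a ⊗ a'` with values in `A ⊗ Aᵒᵖ`. -/
def sandwich (t : C →ₗ[k] k) (c : C) : (A ⊗[k] C) ⊗[k] (A ⊗[k] C) →ₗ[k] A ⊗[k] Aᵐᵒᵖ :=
  (TensorProduct.rid k (A ⊗[k] Aᵐᵒᵖ)).toLinearMap ∘ₗ
    TensorProduct.map (LinearMap.lTensor A (MulOpposite.opLinearEquiv k).toLinearMap)
      (t ∘ₗ LinearMap.mul' k C ∘ₗ LinearMap.rTensor C (LinearMap.mulRight k c)) ∘ₗ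
    (TensorProduct.tensorTensorTensorComm k A C A C).toLinearMap

theorem sandwich_tmul (t : C →ₗ[k] k) (c : C) (a a' : A) (c₁ c₂ : C) :
    sandwich t c ((a ⊗ₜ c₁) ⊗ₜ (a' ⊗ₜ c₂)) =
      t (c₁ * c * c₂) • (a ⊗ₜ[k] MulOpposite.op a') := by
  simp [sandwich]

omit [Fintype ι] in
/-- Conjugating `sandwich t c (x ⊗ y)` by matrix units gives a multiple of a tensor product of
block identities, the coefficient being a product of matrix entries. -/
theorem sum_map_sandwich (π : A →ₐ[k] Π i, Matrix (Fin (d i)) (Fin (d i)) k)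
    (E : Π i, Fin (d i) → Fin (d i) → A)
    (hE : ∀ i a b, π (E i a b) = Pi.single i (Matrix.single a b 1))
    (t : C →ₗ[k] k) (c : C) (x y : A ⊗[k] C) (i j : ι) (a b : Fin (d i)) (a' b' : Fin (d j)) :
    Algebra.TensorProduct.map π (AlgHom.op π)
        (∑ l, ∑ m, (E i l a ⊗ₜ MulOpposite.op (E j b' m)) * sandwich t c (x ⊗ₜ y) *
          (E i b l ⊗ₜ MulOpposite.op (E j m a'))) =
      t (matEnt ((Pi.evalAlgHom k _ i).comp π) x a b * c *
        matEnt ((Pi.evalAlgHom k _ j).comp π) y a' b') •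
        ((Pi.single i 1) ⊗ₜ[k] MulOpposite.op (Pi.single j 1)) := by
  have hone : ∀ i : ι, (Pi.single i 1 : Π i, Matrix (Fin (d i)) (Fin (d i)) k) =
      ∑ l, Pi.single i (Matrix.single l l 1) := by
    intro i
    simp only [← AddMonoidHom.single_apply]
    rw [← map_sum, Matrix.sum_single_one]
  have hmul : ∀ (i : ι) (l a b : Fin (d i)) (m : Π i, Matrix (Fin (d i)) (Fin (d i)) k),
      (Pi.single i (Matrix.single l a 1) : Π i, Matrix (Fin (d i)) (Fin (d i)) k) * m *
        Pi.single i (Matrix.single b l 1) = m i a b • Pi.single i (Matrix.single l l 1) := by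
    intro i l a b m
    ext j
    by_cases h : j = i
    · subst h
      simp [Matrix.single_mul_mul_single, Matrix.single_apply]
    · simp [Pi.single_eq_of_ne h]
  induction x with
  | zero => simp
  | add x x' hx hx' =>
    simp only [TensorProduct.add_tmul, map_add, mul_add, add_mul, Finset.sum_add_distrib, hx, hx',
      Matrix.add_apply, add_smul]
  | tmul s c₁ =>
    induction y with
    | zero => simp
    | add y y' hy hy' =>
      simp only [TensorProduct.tmul_add, map_add, mul_add, add_mul, Finset.sum_add_distrib, hy,
        hy', Matrix.add_apply, add_smul]
    | tmul s' c₂ =>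
      simp only [sandwich_tmul, matEnt_tmul, map_sum, map_mul, map_smul,
        Algebra.TensorProduct.map_tmul, AlgHom.op_apply_apply, MulOpposite.unop_op, hE,
        mul_smul_comm, smul_mul_assoc, Algebra.TensorProduct.tmul_mul_tmul, hmul,
        ← MulOpposite.op_mul]
      simp only [← mul_assoc, hmul, MulOpposite.op_smul, TensorProduct.tmul_smul,
        TensorProduct.smul_tmul']
      rw [hone i, hone j, Finset.op_sum, Finset.smul_sum, TensorProduct.sum_tmul]
      simp only [TensorProduct.tmul_sum, smul_smul]
      simp only [AlgHom.comp_apply, Pi.evalAlgHom_apply]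
      refine Finset.sum_congr rfl fun l _ => Finset.sum_congr rfl fun m _ => ?_
      congr 2
      simp only [smul_eq_mul]
      ring

end MatrixEntries

/-! ### Annihilating ideals and indecomposable corners. -/

section Blocks

variable {k A C : Type*} [Field k] [Ring A] [Algebra k A] [Ring C] [Algebra k C]

theorem apply_slice {n : Type*} [Fintype n] [DecidableEq n] (φ : A →ₐ[k] Matrix n n k)
    (t : C →ₗ[k] k) (z : A ⊗[k] C) (a b : n) : φ (slice t z) a b = t (matEnt φ z a b) := by
  induction z with
  | zero => simp
  | add y z hy hz => simp only [map_add, Matrix.add_apply, hy, hz]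
  | tmul x c => rw [slice_tmul, matEnt_tmul, map_smul, map_smul, Matrix.smul_apply, smul_eq_mul,
      smul_eq_mul, mul_comm]

/-- An idempotent which is congruent to a nilpotent element modulo an ideal lies in the ideal. -/
theorem mem_of_isIdempotentElem_of_sub_isNilpotent {R : Type*} [Ring R] (I : AddSubgroup R)
    (hl : ∀ x, ∀ y ∈ I, x * y ∈ I) (hr : ∀ x, ∀ y ∈ I, y * x ∈ I) {e z : R}
    (he : IsIdempotentElem e) (hz : z ∈ I) (hn : IsNilpotent (e - z)) : e ∈ I := by
  obtain ⟨n, hn⟩ := hn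
  have h : ∀ m : ℕ, (e - z) ^ (m + 1) - e ∈ I := by
    intro m
    induction m with
    | zero =>
      rw [zero_add, pow_one, sub_sub_cancel_left]
      exact neg_mem hz
    | succ m ih =>
      have h1 : (e - z) ^ (m + 1 + 1) - e = ((e - z) ^ (m + 1) - e) * (e - z) - e * z := by
        rw [pow_succ _ (m + 1), sub_mul, mul_sub e, he.eq]
        abel
      rw [h1]
      exact sub_mem (hr _ _ ih) (hl _ _ hz)
  have h2 := h n
  rw [pow_succ, hn, zero_mul, zero_sub] at h2
  simpa using neg_mem h2

variable {ι : Type*} [Fintype ι]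

/-- Ideals which annihilate each other and whose sum contains the idempotent `e` decompose the
corner of `e`; if the corner is indecomposable, then `e` lies in one of them. -/
theorem exists_mem_of_centrallyIndecomposable {R : Type*} [Ring R] {e : R}
    (he : IsIdempotentElem e) (he0 : e ≠ 0)
    (hconn : ∀ f, IsIdempotentElem f → e * f = f → f * e = f →
      (∀ x, f * (e * x * e) = e * x * e * f) → f = 0 ∨ f = e)
    (I : ι → AddSubgroup R) (hl : ∀ i x, ∀ y ∈ I i, x * y ∈ I i)
    (hr : ∀ i x, ∀ y ∈ I i, y * x ∈ I i)
    (hI : ∀ i j, i ≠ j → ∀ x ∈ I i, ∀ y ∈ I j, x * y = 0)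
    (z : ι → R) (hz : ∀ i, z i ∈ I i) (hez : ∑ i, z i = e) : ∃ i, e ∈ I i := by
  classical
  set f : ι → R := fun i => e * z i * e
  have hf : ∀ i, f i ∈ I i := fun i => hr i _ _ (hl i _ _ (hz i))
  have hsum : ∑ i, f i = e := by
    simp only [f]
    rw [← Finset.sum_mul, ← Finset.mul_sum, hez, he.eq, he.eq]
  have hef : ∀ i, e * f i = f i := fun i => by
    simp only [f]
    rw [← mul_assoc, ← mul_assoc, he.eq]
  have hfe : ∀ i, f i * e = f i := fun i => by
    simp only [f]
    rw [mul_assoc, he.eq]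
  have key : ∀ i x, f i * x * e = f i * x * f i := by
    intro i x
    -- Replacing `e` by `∑ f j`, only `f i` survives next to an element of `I i`. This makes `f i`
    -- idempotent and central in the corner of `e`.
    conv_lhs => rw [← hsum, Finset.mul_sum]
    exact Finset.sum_eq_single i
      (fun j _ hj => hI i j hj.symm _ (hr i _ _ (hf i)) _ (hf j)) (by simp)
  have key' : ∀ i x, e * (x * f i) = f i * x * f i := by
    intro i x
    conv_lhs => rw [← hsum, Finset.sum_mul]
    rw [mul_assoc]
    exact Finset.sum_eq_single i
      (fun j _ hj => hI j i hj _ (hf j) _ (hl i _ _ (hf i))) (by simp)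
  have hdich : ∀ i, f i = 0 ∨ f i = e := by
    intro i
    refine hconn (f i) ?_ (hef i) (hfe i) fun x => ?_
    · have := key i 1
      rw [mul_one, hfe] at this
      exact this.symm
    · have h1 := key i x
      have h2 := key' i x
      rw [mul_assoc (e * x) e, hef, mul_assoc e x (f i), h2, ← h1, ← mul_assoc, ← mul_assoc, hfe]
  by_contra! h
  refine he0 (hsum.symm.trans (Finset.sum_eq_zero fun i _ => ?_))
  refine (hdich i).resolve_right fun hi => h i ?_
  rw [← hi]
  exact hf i

end Blocks

/-! ### The block argument in `S(Q) ⊗ B(Q)`. -/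

section Main

variable {k A C : Type*} [Field k] [IsAlgClosed k] [Ring A] [Algebra k A] [FiniteDimensional k A]
  [Ring C] [Algebra k C]

/-- An abstract criterion for `1 ⊗ 1` to lie in an ideal of `A ⊗ Aᵒᵖ`. -/
theorem one_mem_of_sandwich_mem [Nontrivial A] {e : A ⊗[k] C} (he : IsIdempotentElem e)
    (L : Ideal (A ⊗[k] Aᵐᵒᵖ)) [L.IsTwoSided]
    (hT : ∀ x : C, x ≠ 0 → ∃ t : C →ₗ[k] k, t x ≠ 0 ∧ ∀ c, sandwich t c (e ⊗ₜ e) ∈ L)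
    (hO : ∀ a b, a ⊗ₜ MulOpposite.op b ∈ L → ∀ x, (∀ y, IsNilpotent (x * y)) → a * x * b = 0)
    (hconn : ∀ f, IsIdempotentElem f → e * f = f → f * e = f →
      (∀ x, f * (e * x * e) = e * x * e * f) → f = 0 ∨ f = e)
    {t₀ : C →ₗ[k] k} (hU : IsUnit (slice t₀ e)) : 1 ∈ L := by
  classical
  obtain ⟨n, d, π, hd, hπ, hker⟩ := exists_algHom_pi_matrix (k := k) A
  have he0 : e ≠ 0 := by
    rintro rfl
    rw [map_zero] at hU
    exact not_isUnit_zero hU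
  have hkerπ : ∀ x ∈ RingHom.ker (π : A →+* Π i, Matrix (Fin (d i)) (Fin (d i)) k),
      IsNilpotent x := fun x hx => hker.isNilpotent hx
  -- lifts of the block idempotents and of the matrix units
  have hε : ∀ i, ∃ ε, IsIdempotentElem ε ∧ π ε = Pi.single i 1 := by
    intro i
    refine exists_isIdempotentElem_eq_of_ker_isNilpotent
      (π : A →+* Π i, Matrix (Fin (d i)) (Fin (d i)) k) hkerπ (Pi.single i 1) (hπ _) ?_
    rw [IsIdempotentElem, ← Pi.single_mul, mul_one]
  choose ε hεid hεπ using hε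
  have hE : ∀ (i : Fin n) (a b : Fin (d i)), ∃ x, π x = Pi.single i (Matrix.single a b 1) := fun i a b => hπ _
  choose E hEπ using hE
  let φ : Π i, A →ₐ[k] Matrix (Fin (d i)) (Fin (d i)) k := fun i => (Pi.evalAlgHom k _ i).comp π
  let ent : Π i, Fin (d i) → Fin (d i) → C := fun i a b => matEnt (φ i) e a b
  -- Multiplying the sandwich of `e` by lifted matrix units isolates the product of the two entries.
  -- After scaling, an element of `L` is congruent to the idempotent `ε i ⊗ ε j` modulo a nilpotent,
  -- and then that idempotent itself lies in `L`.
  have hlinked : ∀ i j a b a' b' c, ent i a b * c * ent j a' b' ≠ 0 →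
      ε i ⊗ₜ MulOpposite.op (ε j) ∈ L := by
    intro i j a b a' b' c hne
    obtain ⟨t, ht, hL⟩ := hT _ hne
    have h1 := sum_map_sandwich π E hEπ t c e e i j a b a' b'
    set z := ∑ l, ∑ m, (E i l a ⊗ₜ MulOpposite.op (E j b' m)) * sandwich t c (e ⊗ₜ e) *
          (E i b l ⊗ₜ MulOpposite.op (E j m a'))
    set κ := t (ent i a b * c * ent j a' b')
    have hz : κ⁻¹ • z ∈ L := by
      rw [← one_mul z, ← smul_mul_assoc]
      refine L.mul_mem_left _ ?_
      refine sum_mem fun l _ => sum_mem fun m _ => ?_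
      exact L.mul_mem_right _ (L.mul_mem_left _ (hL c))
    have hnil : IsNilpotent (ε i ⊗ₜ[k] MulOpposite.op (ε j) - κ⁻¹ • z) := by
      refine hker.isNilpotent_tensor hπ hker.op (fun x => ?_) ?_
      · obtain ⟨y, hy⟩ := hπ x.unop
        exact ⟨MulOpposite.op y, congrArg MulOpposite.op hy⟩
      · rw [map_sub, map_smul, h1, Algebra.TensorProduct.map_tmul, AlgHom.op_apply_apply,
          MulOpposite.unop_op, hεπ, hεπ, smul_smul, inv_mul_cancel₀ ht, one_smul, sub_self]
    refine mem_of_isIdempotentElem_of_sub_isNilpotent L.toAddSubgroup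
      (fun x y hy => L.mul_mem_left x hy) (fun x y hy => L.mul_mem_right x hy) ?_ hz hnil
    rw [IsIdempotentElem, Algebra.TensorProduct.tmul_mul_tmul, ← MulOpposite.op_mul,
      (hεid i).eq, (hεid j).eq]
  -- For `i ≠ j` the element `ε i * x * ε j` dies in the semisimple quotient, so `hO` applies to it;
  -- the idempotents reproduce it.
  have horth : ∀ i j, i ≠ j → ε i ⊗ₜ MulOpposite.op (ε j) ∈ L → ∀ x, ε i * x * ε j = 0 := by
    intro i j hij hL x
    have h := hO _ _ hL (ε i * x * ε j) fun y => hker.isNilpotent (by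
      rw [map_mul, map_mul, map_mul, hεπ, hεπ]
      have h0 : (Pi.single i 1 : Π i, Matrix (Fin (d i)) (Fin (d i)) k) * π x *
          Pi.single j 1 = 0 := by
        ext l : 1
        by_cases hl : l = i
        · subst hl
          simp [Pi.single_eq_of_ne hij]
        · simp [Pi.single_eq_of_ne hl]
      rw [h0, zero_mul])
    rwa [mul_assoc (ε i) (ε i * x * ε j), mul_assoc (ε i * x), (hεid j).eq, ← mul_assoc,
      ← mul_assoc, (hεid i).eq] at h
  -- the ideals attached to the blocks
  let I : Fin n → Submodule k (A ⊗[k] C) := fun i => Submodule.span k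
    {w | ∃ x y c c' a b, w = (x * ε i * y) ⊗ₜ (c * ent i a b * c')}
  have hIl : ∀ i x, ∀ y ∈ I i, x * y ∈ I i := by
    intro i x y hy
    refine Submodule.span_induction ?_ (by simp) (fun y z _ _ hy hz => by
      rw [mul_add]; exact add_mem hy hz) (fun c y _ hy => by
      rw [mul_smul_comm]; exact Submodule.smul_mem _ _ hy) hy
    rintro _ ⟨u, v, c, c', a, b, rfl⟩
    induction x with
    | zero => simp
    | add x x' hx hx' => rw [add_mul]; exact add_mem hx hx'
    | tmul x c₁ =>
      rw [Algebra.TensorProduct.tmul_mul_tmul]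
      exact Submodule.subset_span ⟨x * u, v, c₁ * c, c', a, b, by simp only [mul_assoc]⟩
  have hIr : ∀ i x, ∀ y ∈ I i, y * x ∈ I i := by
    intro i x y hy
    refine Submodule.span_induction ?_ (by simp) (fun y z _ _ hy hz => by
      rw [add_mul]; exact add_mem hy hz) (fun c y _ hy => by
      rw [smul_mul_assoc]; exact Submodule.smul_mem _ _ hy) hy
    rintro _ ⟨u, v, c, c', a, b, rfl⟩
    induction x with
    | zero => simp
    | add x x' hx hx' => rw [mul_add]; exact add_mem hx hx'
    | tmul x c₁ =>
      rw [Algebra.TensorProduct.tmul_mul_tmul]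
      exact Submodule.subset_span ⟨u, v * x, c, c' * c₁, a, b, by simp only [mul_assoc]⟩
  have hIorth : ∀ i j, i ≠ j → ∀ x ∈ I i, ∀ y ∈ I j, x * y = 0 := by
    intro i j hij x hx y hy
    refine Submodule.span_induction ?_ (by simp) (fun x z _ _ hx hz => by
      rw [add_mul, hx, hz, add_zero]) (fun c x _ hx => by rw [smul_mul_assoc, hx, smul_zero]) hx
    rintro _ ⟨u, v, c, c', a, b, rfl⟩
    refine Submodule.span_induction ?_ (by simp) (fun x z _ _ hx hz => by
      rw [mul_add, hx, hz, add_zero]) (fun c x _ hx => by rw [mul_smul_comm, hx, smul_zero]) hy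
    rintro _ ⟨u', v', c₁, c₁', a', b', rfl⟩
    rw [Algebra.TensorProduct.tmul_mul_tmul]
    -- Either the product vanishes in the factor `C`, or the blocks are linked and it vanishes in
    -- the factor `A`.
    by_cases h : ent i a b * (c' * c₁) * ent j a' b' = 0
    · have h2 : c * ent i a b * c' * (c₁ * ent j a' b' * c₁') =
          c * (ent i a b * (c' * c₁) * ent j a' b') * c₁' := by simp only [mul_assoc]
      rw [h2, h, mul_zero, zero_mul, TensorProduct.tmul_zero]
    · have h3 := horth i j hij (hlinked i j a b a' b' _ h) (v * u')
      have h2 : u * ε i * v * (u' * ε j * v') = u * (ε i * (v * u') * ε j) * v' := by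
        simp only [mul_assoc]
      rw [h2, h3, mul_zero, zero_mul, TensorProduct.zero_tmul]
  have heI : e ∈ ⨆ i, I i := by
    -- The expansion of `e` in lifted matrix units, equal to `e` up to a nilpotent; the factor `ε i`
    -- is harmless modulo the radical and puts each summand into `I i`.
    let z : A ⊗[k] C := ∑ i, ∑ a, ∑ b, (ε i * (E i a b)) ⊗ₜ ent i a b
    refine mem_of_isIdempotentElem_of_sub_isNilpotent (⨆ i, I i).toAddSubgroup ?_ ?_ he
      (z := z) ?_ ?_
    · intro x y hy
      refine Submodule.iSup_induction I (motive := fun y => x * y ∈ ⨆ i, I i) hy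
        (fun i y hy => Submodule.mem_iSup_of_mem i (hIl i x y hy)) (by simp)
        fun y z hy hz => by rw [mul_add]; exact add_mem hy hz
    · intro x y hy
      refine Submodule.iSup_induction I (motive := fun y => y * x ∈ ⨆ i, I i) hy
        (fun i y hy => Submodule.mem_iSup_of_mem i (hIr i x y hy)) (by simp)
        fun y z hy hz => by rw [add_mul]; exact add_mem hy hz
    · refine sum_mem fun i _ => sum_mem fun a _ => sum_mem fun b _ => ?_
      exact Submodule.mem_iSup_of_mem i
        (Submodule.subset_span ⟨1, E i a b, 1, 1, a, b, by simp⟩)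
    · refine hker.isNilpotent_tensor_id hπ ?_
      rw [map_sub, map_id_eq_sum_matEnt, sub_eq_zero]
      simp only [z, map_sum, Algebra.TensorProduct.map_tmul, map_mul, hεπ, hEπ, AlgHom.id_apply,
        ← Pi.single_mul, one_mul]
      rfl
  obtain ⟨z, hz, hze⟩ := (Submodule.mem_iSup_iff_exists_finsupp I e).mp heI
  rw [Finsupp.sum_fintype _ _ (fun _ => rfl)] at hze
  obtain ⟨j, hj⟩ := exists_mem_of_centrallyIndecomposable he he0 hconn
    (fun i => (I i).toAddSubgroup) hIl hIr hIorth z hz hze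
  -- the entries of `e` in the other blocks vanish
  have hent : ∀ i, i ≠ j → ∀ w ∈ I j, matEnt (φ i) w = 0 := by
    intro i hij w hw
    refine Submodule.span_induction ?_ (by simp) (fun x z _ _ hx hz => by
      rw [map_add, hx, hz, add_zero]) (fun c x _ hx => by rw [map_smul, hx, smul_zero]) hw
    rintro _ ⟨u, v, c, c', a, b, rfl⟩
    ext l m
    have h0 : φ i (u * ε j * v) = 0 := by
      rw [map_mul, map_mul]
      simp [φ, hεπ, Pi.single_eq_of_ne hij]
    rw [matEnt_tmul, h0]
    simp
  -- The slice of `e` is a unit, so its image in every block is nonzero. As the entries of `e`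
  -- vanish outside block `j`, no other block exists.
  have hsl : ∀ i, φ i (slice t₀ e) ≠ 0 := fun i => by
    have := hd i
    have : Nonempty (Fin (d i)) := ⟨0⟩
    exact (hU.map (φ i)).ne_zero
  have hall : ∀ i, i = j := by
    intro i
    by_contra hij
    refine hsl i ?_
    ext a b
    rw [apply_slice, hent i hij e hj]
    simp
  have hεj : ε j = 1 := by
    have h1 : IsNilpotent (1 - ε j) := hker.isNilpotent (by
      rw [map_sub, map_one, hεπ, sub_eq_zero]
      ext i : 1
      obtain rfl := hall i
      simp)
    have := eq_zero_of_isIdempotentElem_of_isNilpotent (hεid j).one_sub h1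
    exact (sub_eq_zero.mp this).symm
  have hentj : matEnt (φ j) e ≠ 0 := by
    intro h
    refine hsl j ?_
    ext a b
    rw [apply_slice, h]
    simp
  obtain ⟨a, b, hab⟩ : ∃ a b, ent j a b ≠ 0 := by
    by_contra! h
    exact hentj (by ext a b; exact h a b)
  -- Since `e = e²`, a nonzero entry is a sum of products of two entries, so the only block is
  -- linked to itself.
  obtain ⟨c, hc⟩ : ∃ c, ent j a c * ent j c b ≠ 0 := by
    by_contra! h
    refine hab ?_
    have : ent j a b = (matEnt (φ j) e * matEnt (φ j) e) a b := by
      rw [← map_mul, he.eq]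
    rw [this, Matrix.mul_apply]
    exact Finset.sum_eq_zero fun c _ => h c
  have := hlinked j j a c c b 1 (by rwa [mul_one])
  rwa [hεj] at this

end Main

/-! ### The conjugation action on endomorphisms. -/

section Endomorphisms

variable {O P M : Type*} [CommRing O] [Group P] [AddCommGroup M] [Module O M]
  {ρ : Representation O P M}

theorem conj_endStr_apply (g : P) (f : Module.End O M) (m : M) :
    conj (O := O) (endStr ρ) g f m = ρ g (f (ρ g⁻¹ m)) := by
  rw [conj_apply, ← map_inv]
  rfl

theorem mem_fixedBy_endStr {Q : Subgroup P} {f : Module.End O M} :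
    f ∈ fixedBy (conj (O := O) (endStr ρ)) Q ↔ ∀ q ∈ Q, ∀ m, f (ρ q m) = ρ q (f m) := by
  constructor
  · intro h q hq m
    have h1 := LinearMap.congr_fun (h q hq) (ρ q m)
    rw [conj_endStr_apply, ← Module.End.mul_apply (ρ q⁻¹), ← map_mul, inv_mul_cancel, map_one,
      Module.End.one_apply] at h1
    exact h1.symm
  · intro h q hq
    ext m
    rw [conj_endStr_apply, ← h q hq, ← Module.End.mul_apply (ρ q), ← map_mul, mul_inv_cancel,
      map_one, Module.End.one_apply]

theorem conj_smulRight (g : P) (ξ : M →ₗ[O] O) (v : M) :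
    conj (O := O) (endStr ρ) g (ξ.smulRight v) = (ξ ∘ₗ ρ g⁻¹).smulRight (ρ g v) := by
  ext m
  rw [conj_endStr_apply]
  simp

theorem smulRight_mem_fixedBy {Q : Subgroup P} {ξ : M →ₗ[O] O} {v : M}
    (hξ : ∀ q ∈ Q, ∀ m, ξ (ρ q m) = ξ m) (hv : v ∈ fixedBy ρ Q) :
    ξ.smulRight v ∈ fixedBy (conj (O := O) (endStr ρ)) Q := by
  rw [mem_fixedBy_endStr]
  intro q hq m
  rw [LinearMap.smulRight_apply, LinearMap.smulRight_apply, hξ q hq, map_smul, hv q hq]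

variable [Finite P] [IsLocalRing O]

theorem apply_mem_brKer_of_fixed {Q : Subgroup P} {f : Module.End O M}
    (hf : f ∈ brKer (conj (O := O) (endStr ρ)) Q) {m : M} (hm : m ∈ fixedBy ρ Q) :
    f m ∈ brKer ρ Q := by
  refine map_mem_brKer (h := (LinearMap.applyₗ m : Module.End O M →ₗ[O] M)) (fun q hq f => ?_) hf
  rw [LinearMap.applyₗ_apply_apply, LinearMap.applyₗ_apply_apply, conj_endStr_apply,
    hm _ (Q.inv_mem hq)]

end Endomorphisms

/-! ### The trace form on `End(V)` and nilpotency in its Brauer quotient. -/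

section TraceForm

variable {O P V : Type*} [CommRing O] [Group P] [AddCommGroup V] [Module O V] [Module.Finite O V]
  [Module.Free O V]

/-- In coordinates, the entry of `y` at `(j, i)` is the value of `ξ` on the matrix unit at `(i, j)`.
-/
theorem exists_eq_trace_mul (ξ : Module.End O V →ₗ[O] O) :
    ∃ y : Module.End O V, ∀ s, ξ s = LinearMap.trace O V (s * y) := by
  classical
  let b := Module.Free.chooseBasis O V
  let e := LinearMap.toMatrixAlgEquiv b
  let Y : Matrix _ _ O := Matrix.of fun j i => ξ (e.symm (Matrix.single i j 1))
  refine ⟨e.symm Y, fun s => ?_⟩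
  have h1 : LinearMap.trace O V (s * e.symm Y) = (e s * Y).trace := by
    rw [LinearMap.trace_eq_matrix_trace O b]
    change (e (s * e.symm Y)).trace = _
    rw [map_mul, AlgEquiv.apply_symm_apply]
  rw [h1, Matrix.trace]
  obtain ⟨m, rfl⟩ := e.symm.surjective s
  rw [AlgEquiv.apply_symm_apply]
  conv_lhs => rw [Matrix.matrix_eq_sum_single m]
  simp only [map_sum, Matrix.diag_apply, Matrix.mul_apply]
  refine Finset.sum_congr rfl fun i _ => Finset.sum_congr rfl fun j _ => ?_
  have h2 : Matrix.single i j (m i j) = m i j • Matrix.single i j 1 := by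
    rw [Matrix.smul_single, smul_eq_mul, mul_one]
  rw [h2, map_smul, map_smul, smul_eq_mul]
  rfl

theorem eq_of_trace_mul_eq {y y' : Module.End O V}
    (h : ∀ s, LinearMap.trace O V (s * y) = LinearMap.trace O V (s * y')) : y = y' := by
  classical
  let b := Module.Free.chooseBasis O V
  let e := LinearMap.toMatrixAlgEquiv b
  apply e.injective
  rw [Matrix.ext_iff_trace_mul_left]
  intro m
  have h1 := h (e.symm m)
  rw [LinearMap.trace_eq_matrix_trace O b, LinearMap.trace_eq_matrix_trace O b] at h1
  change (e (e.symm m * y)).trace = (e (e.symm m * y')).trace at h1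
  simpa using h1

omit [Module.Finite O V] [Module.Free O V] in
theorem trace_conj {ρ : Representation O P V} (g : P) (s : Module.End O V) :
    LinearMap.trace O V (conj (O := O) (endStr ρ) g s) = LinearMap.trace O V s := by
  rw [conj_apply, LinearMap.trace_mul_comm, ← mul_assoc, Units.inv_mul, one_mul]

/-- The invariant linear forms on `End(V)` are given by the trace form and invariant elements. -/
theorem exists_fixed_eq_trace_mul {ρ : Representation O P V} {Q : Subgroup P}
    {ξ : Module.End O V →ₗ[O] O} (hξ : ∀ q ∈ Q, ∀ s, ξ (conj (O := O) (endStr ρ) q s) = ξ s) :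
    ∃ y ∈ fixedBy (conj (O := O) (endStr ρ)) Q, ∀ s, ξ s = LinearMap.trace O V (s * y) := by
  obtain ⟨y, hy⟩ := exists_eq_trace_mul ξ
  refine ⟨y, fun q hq => eq_of_trace_mul_eq fun s => ?_, hy⟩
  have h1 : s * conj (O := O) (endStr ρ) q y = conj (O := O) (endStr ρ) q
      (conj (O := O) (endStr ρ) q⁻¹ s * y) := by
    rw [conj_mul, ← Module.End.mul_apply (conj (O := O) (endStr ρ) q), ← map_mul, mul_inv_cancel,
      map_one, Module.End.one_apply]
  rw [h1, trace_conj, ← hy, ← hy, hξ _ (Q.inv_mem hq)]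

open IsLocalRing

/-- The trace of an element which is nilpotent in the Brauer quotient is not a unit. -/
theorem trace_mem_maximalIdeal [IsLocalRing O] [Finite P] {p : ℕ} [Fact p.Prime]
    (hP : IsPGroup p P) [CharP (ResidueField O) p] {ρ : Representation O P V} {Q : Subgroup P}
    {z : fixAlg O (endStr ρ) Q} (hz : IsNilpotent (br O (endStr ρ) Q z)) :
    LinearMap.trace O V z ∈ maximalIdeal O := by
  classical
  let b := Module.Free.chooseBasis O V
  let e := LinearMap.toMatrixAlgEquiv b
  have htr : ∀ s : Module.End O V, residue O (LinearMap.trace O V s) =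
      ((residue O).mapMatrix (e s)).trace := by
    intro s
    rw [LinearMap.trace_eq_matrix_trace O b]
    exact AddMonoidHom.map_trace (residue O) _
  -- Over the residue field the trace commutes with `p`-power maps, so it is enough to bound the
  -- trace of a high `p`-power of `z`, which lies in the kernel of the Brauer map.
  have hpow : ∀ (n : ℕ) (s : Module.End O V), residue O (LinearMap.trace O V (s ^ p ^ n)) =
      residue O (LinearMap.trace O V s) ^ p ^ n := by
    intro n
    induction n with
    | zero => simp
    | succ n ih =>
      intro s
      rw [pow_succ, pow_mul, htr, map_pow, map_pow, trace_pow_char, ← htr, ih, pow_mul]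
  obtain ⟨m, hm⟩ := hz
  have h1 : br O (endStr ρ) Q (z ^ p ^ m) = 0 := by
    rw [map_pow]
    exact pow_eq_zero_of_le (Nat.lt_pow_self (Fact.out (p := p.Prime)).one_lt).le hm
  have h2 := form_mem_maximalIdeal hP (t := LinearMap.trace O V)
    (fun q _ s => trace_conj (ρ := ρ) q s) (br_eq_zero_iff.mp h1)
  rw [← residue_eq_zero_iff] at h2 ⊢
  rw [Subalgebra.coe_pow, hpow] at h2
  exact eq_zero_of_pow_eq_zero h2

/-- An invariant form on `End(V)` is small on elements all of whose multiples are nilpotent in the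
Brauer quotient. -/
theorem form_mem_maximalIdeal_of_isNilpotent [IsLocalRing O] [Finite P] {p : ℕ} [Fact p.Prime]
    (hP : IsPGroup p P) [CharP (ResidueField O) p] {ρ : Representation O P V} {Q : Subgroup P}
    {ξ : Module.End O V →ₗ[O] O} (hξ : ∀ q ∈ Q, ∀ s, ξ (conj (O := O) (endStr ρ) q s) = ξ s)
    {z : fixAlg O (endStr ρ) Q} (hz : ∀ y, IsNilpotent (br O (endStr ρ) Q z * y)) :
    ξ z ∈ maximalIdeal O := by
  obtain ⟨y, hy, h⟩ := exists_fixed_eq_trace_mul hξ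
  rw [h]
  have h1 := hz (br O (endStr ρ) Q ⟨y, hy⟩)
  rw [← map_mul] at h1
  exact trace_mem_maximalIdeal hP h1

end TraceForm

/-! ### The ideal of rank one maps modulo the Brauer kernel. -/

section RankOne

open IsLocalRing

variable {O P M : Type*} [CommRing O] [Group P] [AddCommGroup M] [Module O M]

/-- The span of the endomorphisms `m ↦ ξ(m) v` with `Q`-invariant `ξ` and `v`. -/
def rankOne (ρ : Representation O P M) (Q : Subgroup P) : Submodule O (Module.End O M) :=
  Submodule.span O {f | ∃ v ∈ fixedBy ρ Q, ∃ ξ : M →ₗ[O] O,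
    (∀ q ∈ Q, ∀ m, ξ (ρ q m) = ξ m) ∧ ξ.smulRight v = f}

theorem mul_mem_rankOne_left {ρ : Representation O P M} {Q : Subgroup P} {f g : Module.End O M}
    (hf : f ∈ fixedBy (conj (O := O) (endStr ρ)) Q) (hg : g ∈ rankOne ρ Q) :
    f * g ∈ rankOne ρ Q := by
  rw [mem_fixedBy_endStr] at hf
  refine Submodule.span_induction ?_ (by simp) (fun x y _ _ hx hy => by
    rw [mul_add]; exact add_mem hx hy) (fun c x _ hx => by
    rw [mul_smul_comm]; exact Submodule.smul_mem _ _ hx) hg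
  rintro _ ⟨v, hv, ξ, hξ, rfl⟩
  exact Submodule.subset_span ⟨f v, fun q hq => by rw [← hf q hq, hv q hq], ξ, hξ, by
    ext m; simp⟩

theorem mul_mem_rankOne_right {ρ : Representation O P M} {Q : Subgroup P} {f g : Module.End O M}
    (hf : f ∈ fixedBy (conj (O := O) (endStr ρ)) Q) (hg : g ∈ rankOne ρ Q) :
    g * f ∈ rankOne ρ Q := by
  rw [mem_fixedBy_endStr] at hf
  refine Submodule.span_induction ?_ (by simp) (fun x y _ _ hx hy => by
    rw [add_mul]; exact add_mem hx hy) (fun c x _ hx => by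
    rw [smul_mul_assoc]; exact Submodule.smul_mem _ _ hx) hg
  rintro _ ⟨v, hv, ξ, hξ, rfl⟩
  exact Submodule.subset_span ⟨v, hv, ξ ∘ₗ f, fun q hq m => by
    rw [LinearMap.comp_apply, hf q hq, hξ q hq]; rfl, by ext m; simp⟩

variable [Finite P] [IsLocalRing O]

/-- The ideal of `End(M)^Q` generated by rank one maps and the kernel of the Brauer map. -/
def rankOneKer (ρ : Representation O P M) (Q : Subgroup P) : Submodule O (Module.End O M) :=
  rankOne ρ Q ⊔ brKer (conj (O := O) (endStr ρ)) Q

theorem brKer_le_rankOneKer (ρ : Representation O P M) (Q : Subgroup P) :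
    brKer (conj (O := O) (endStr ρ)) Q ≤ rankOneKer ρ Q := le_sup_right

theorem smulRight_mem_rankOneKer {ρ : Representation O P M} {Q : Subgroup P} {ξ : M →ₗ[O] O}
    {v : M} (hξ : ∀ q ∈ Q, ∀ m, ξ (ρ q m) = ξ m) (hv : v ∈ fixedBy ρ Q) :
    ξ.smulRight v ∈ rankOneKer ρ Q :=
  Submodule.mem_sup_left (Submodule.subset_span ⟨v, hv, ξ, hξ, rfl⟩)

theorem mul_mem_rankOneKer_left {ρ : Representation O P M} {Q : Subgroup P}
    {f g : Module.End O M} (hf : f ∈ fixedBy (conj (O := O) (endStr ρ)) Q)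
    (hg : g ∈ rankOneKer ρ Q) : f * g ∈ rankOneKer ρ Q := by
  obtain ⟨a, ha, b, hb, rfl⟩ := Submodule.mem_sup.mp hg
  rw [mul_add]
  exact add_mem (Submodule.mem_sup_left (mul_mem_rankOne_left hf ha))
    (Submodule.mem_sup_right (mul_mem_brKer_left hf hb))

theorem mul_mem_rankOneKer_right {ρ : Representation O P M} {Q : Subgroup P}
    {f g : Module.End O M} (hf : f ∈ fixedBy (conj (O := O) (endStr ρ)) Q)
    (hg : g ∈ rankOneKer ρ Q) : g * f ∈ rankOneKer ρ Q := by
  obtain ⟨a, ha, b, hb, rfl⟩ := Submodule.mem_sup.mp hg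
  rw [add_mul]
  exact add_mem (Submodule.mem_sup_left (mul_mem_rankOne_right hf ha))
    (Submodule.mem_sup_right (mul_mem_brKer_right hf hb))

end RankOne

/-! ### The action of `S(Q) ⊗ S(Q)ᵒᵖ` on `S`. -/

section Bimodule

open IsLocalRing

variable {O P S : Type*} [CommRing O] [IsLocalRing O] [Group P] [Finite P] [Ring S] [Algebra O S]
  (σ : P →* Sˣ) (Q : Subgroup P)

omit [IsLocalRing O] [Finite P] in
theorem mulRight_mem_fixedBy {σ : P →* Sˣ} {Q : Subgroup P} {a : S}
    (ha : a ∈ fixedBy (conj (O := O) σ) Q) :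
    LinearMap.mulRight O a ∈ fixedBy (conj (O := O) (endStr (conj (O := O) σ))) Q := by
  rw [mem_fixedBy_endStr]
  intro q hq m
  rw [LinearMap.mulRight_apply, LinearMap.mulRight_apply, conj_mul, ha q hq]

omit [IsLocalRing O] [Finite P] in
theorem mulLeft_mem_fixedBy {σ : P →* Sˣ} {Q : Subgroup P} {a : S}
    (ha : a ∈ fixedBy (conj (O := O) σ) Q) :
    LinearMap.mulLeft O a ∈ fixedBy (conj (O := O) (endStr (conj (O := O) σ))) Q := by
  rw [mem_fixedBy_endStr]
  intro q hq m
  rw [LinearMap.mulLeft_apply, LinearMap.mulLeft_apply, conj_mul, ha q hq]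

omit [IsLocalRing O] [Finite P] in
theorem conj_mulRight (g : P) (a : S) :
    conj (O := O) (endStr (conj (O := O) σ)) g (LinearMap.mulRight O a) =
      LinearMap.mulRight O (conj (O := O) σ g a) := by
  ext s
  rw [conj_endStr_apply, LinearMap.mulRight_apply, LinearMap.mulRight_apply, conj_mul,
    ← Module.End.mul_apply (conj (O := O) σ g), ← map_mul, mul_inv_cancel, map_one,
    Module.End.one_apply]

omit [IsLocalRing O] [Finite P] in
theorem conj_mulLeft (g : P) (a : S) :
    conj (O := O) (endStr (conj (O := O) σ)) g (LinearMap.mulLeft O a) =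
      LinearMap.mulLeft O (conj (O := O) σ g a) := by
  ext s
  rw [conj_endStr_apply, LinearMap.mulLeft_apply, LinearMap.mulLeft_apply, conj_mul,
    ← Module.End.mul_apply (conj (O := O) σ g) (conj (O := O) σ g⁻¹), ← map_mul, mul_inv_cancel,
    map_one, Module.End.one_apply]

/-- The map `S(Q) → End(S)(Q)` given by left multiplications. -/
def brLeft : Br O σ Q →ₐ[ResidueField O] Br O (endStr (conj (O := O) σ)) Q :=
  brMapAlg (Algebra.lmul O S) fun q _ a => (conj_mulLeft σ q a).symm

/-- The map `S(Q)ᵒᵖ → End(S)(Q)` given by right multiplications. -/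
def brRight : (Br O σ Q)ᵐᵒᵖ →ₐ[ResidueField O] Br O (endStr (conj (O := O) σ)) Q :=
  AlgHom.opComm (brLiftAlg (W := (Br O (endStr (conj (O := O) σ)) Q)ᵐᵒᵖ)
    (AlgHom.ofLinearMap
      ((MulOpposite.opLinearEquiv O).toLinearMap ∘ₗ
        (br O (endStr (conj (O := O) σ)) Q).toLinearMap ∘ₗ
        (((LinearMap.mul O S).flip ∘ₗ (fixAlg O σ Q).val.toLinearMap).codRestrict
          (Subalgebra.toSubmodule (fixAlg O (endStr (conj (O := O) σ)) Q))
          fun a => mulRight_mem_fixedBy a.2))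
      (by
        change MulOpposite.op (br O _ Q _) = 1
        rw [MulOpposite.op_eq_one_iff, ← map_one (br O (endStr (conj (O := O) σ)) Q)]
        congr 1
        refine Subtype.ext (LinearMap.ext fun s => ?_)
        exact mul_one s)
      (by
        intro a b
        change MulOpposite.op (br O _ Q _) = MulOpposite.op (br O _ Q _) * MulOpposite.op (br O _ Q _)
        rw [← MulOpposite.op_mul, ← map_mul]
        congr 2
        refine Subtype.ext (LinearMap.ext fun s => ?_)
        exact (mul_assoc s (a : S) b).symm))
    fun a ha => by
      change MulOpposite.op (br O _ Q _) = 0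
      rw [MulOpposite.op_eq_zero_iff, br_eq_zero_iff]
      exact map_mem_brKer (h := (LinearMap.mul O S).flip)
        (fun q _ a => (conj_mulRight σ q a).symm) ha)

theorem brLeft_br (a : fixAlg O σ Q) : brLeft σ Q (br O σ Q a) =
    br O _ Q ⟨LinearMap.mulLeft O (a : S), mulLeft_mem_fixedBy a.2⟩ := rfl

theorem brRight_br (a : fixAlg O σ Q) : brRight σ Q (MulOpposite.op (br O σ Q a)) =
    br O _ Q ⟨LinearMap.mulRight O (a : S), mulRight_mem_fixedBy a.2⟩ := rfl

/-- The action of `S(Q) ⊗ S(Q)ᵒᵖ` by left and right multiplications. -/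
def brBimod : Br O σ Q ⊗[ResidueField O] (Br O σ Q)ᵐᵒᵖ →ₐ[ResidueField O]
    Br O (endStr (conj (O := O) σ)) Q :=
  Algebra.TensorProduct.lift (brLeft σ Q) (brRight σ Q) fun x y => by
    obtain ⟨x, rfl⟩ := br_surjective σ Q x
    obtain ⟨y, rfl⟩ := MulOpposite.op_surjective y
    obtain ⟨y, rfl⟩ := br_surjective σ Q y
    rw [commute_iff_eq, brLeft_br, brRight_br, ← map_mul, ← map_mul]
    congr 1
    refine Subtype.ext (LinearMap.ext fun s => ?_)
    exact (mul_assoc (x : S) s y).symm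

theorem brBimod_tmul (a b : fixAlg O σ Q) :
    brBimod σ Q (br O σ Q a ⊗ₜ MulOpposite.op (br O σ Q b)) =
      br O _ Q ⟨LinearMap.mulLeft O (a : S) * LinearMap.mulRight O (b : S),
        mul_mem_fixedBy (mulLeft_mem_fixedBy a.2) (mulRight_mem_fixedBy b.2)⟩ := by
  rw [brBimod, Algebra.TensorProduct.lift_tmul, brLeft_br, brRight_br, ← map_mul]
  rfl

/-- The preimage in `S(Q) ⊗ S(Q)ᵒᵖ` of the ideal of rank one maps. -/
def rankOneIdeal : Ideal (Br O σ Q ⊗[ResidueField O] (Br O σ Q)ᵐᵒᵖ) where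
  carrier := {z | ∃ f : fixAlg O (endStr (conj (O := O) σ)) Q,
    (f : Module.End O S) ∈ rankOneKer (conj (O := O) σ) Q ∧ br O _ Q f = brBimod σ Q z}
  zero_mem' := ⟨0, zero_mem _, by rw [map_zero, map_zero]⟩
  add_mem' := by
    rintro _ _ ⟨f, hf, hf'⟩ ⟨g, hg, hg'⟩
    exact ⟨f + g, add_mem hf hg, by rw [map_add, map_add, hf', hg']⟩
  smul_mem' := by
    rintro z _ ⟨f, hf, hf'⟩
    obtain ⟨g, hg⟩ := br_surjective _ Q (brBimod σ Q z)
    exact ⟨g * f, mul_mem_rankOneKer_left g.2 hf, by rw [map_mul, smul_eq_mul, map_mul, hf', hg]⟩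

instance : (rankOneIdeal (O := O) σ Q).IsTwoSided := ⟨by
  rintro _ z ⟨f, hf, hf'⟩
  obtain ⟨g, hg⟩ := br_surjective _ Q (brBimod σ Q z)
  exact ⟨f * g, mul_mem_rankOneKer_right g.2 hf, by rw [map_mul, map_mul, hf', hg]⟩⟩

/-- Membership does not depend on the lift `f`, because `rankOneKer` contains the kernel of the
Brauer map. -/
theorem mem_rankOneKer_of_br_mem {z : Br O σ Q ⊗[ResidueField O] (Br O σ Q)ᵐᵒᵖ}
    (hz : z ∈ rankOneIdeal σ Q) {f : fixAlg O (endStr (conj (O := O) σ)) Q}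
    (hf : br O _ Q f = brBimod σ Q z) :
    (f : Module.End O S) ∈ rankOneKer (conj (O := O) σ) Q := by
  obtain ⟨g, hg, hg'⟩ := hz
  have h := br_eq_iff.mp (hf.trans hg'.symm)
  simpa using add_mem (brKer_le_rankOneKer _ _ h) hg

end Bimodule

/-! ### Endomorphisms of `S` built from elements of `S ⊗ B`. -/

section Theta

open IsLocalRing

variable {O P S B : Type*} [CommRing O] [Group P] [Ring S] [Algebra O S] [Ring B] [Algebra O B]
  {σ : P →* Sˣ} {τ : P →* Bˣ}

/-- The map `s ↦ (id ⊗ t)(w (s ⊗ b) w')`, bilinear in `w` and `w'`. -/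
def theta (t : B →ₗ[O] O) (b : B) : S ⊗[O] B →ₗ[O] S ⊗[O] B →ₗ[O] Module.End O S :=
  LinearMap.mk₂ O (fun w w' => slice t ∘ₗ LinearMap.mulLeftRight O (w, w') ∘ₗ
      (TensorProduct.mk O S B).flip b)
    (fun w₁ w₂ w' => by ext s; simp [add_mul])
    (fun c w w' => by ext s; simp)
    (fun w w'₁ w'₂ => by ext s; simp [mul_add])
    (fun c w w' => by ext s; simp)

theorem theta_apply (t : B →ₗ[O] O) (b : B) (w w' : S ⊗[O] B) (s : S) :
    theta t b w w' s = slice t (w * s ⊗ₜ b * w') := by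
  simp [theta]

theorem theta_tmul (t : B →ₗ[O] O) (b c c' : B) (s s' : S) :
    theta t b (s ⊗ₜ c) (s' ⊗ₜ c') =
      t (c * b * c') • (LinearMap.mulLeft O s * LinearMap.mulRight O s') := by
  ext u
  simp [theta_apply, mul_assoc]

theorem conj_theta {q : P} {t : B →ₗ[O] O} (ht : ∀ x, t (conj (O := O) τ q x) = t x) {b : B}
    (hb : conj (O := O) τ q b = b) (w w' : S ⊗[O] B) :
    conj (O := O) (endStr (conj (O := O) σ)) q (theta t b w w') =
      theta t b (conj (O := O) (tensorStr O σ τ) q w) (conj (O := O) (tensorStr O σ τ) q w') := by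
  ext s
  rw [conj_endStr_apply, theta_apply, theta_apply, ← slice_conj σ τ ht, conj_mul, conj_mul,
    conj_tensorStr_tmul, hb, ← Module.End.mul_apply (conj (O := O) σ q), ← map_mul,
    mul_inv_cancel, map_one, Module.End.one_apply]

variable {Q : Subgroup P} {t : B →ₗ[O] O}
  (ht : ∀ q ∈ Q, ∀ x, t (conj (O := O) τ q x) = t x)
  {b : B} (hb : b ∈ fixedBy (conj (O := O) τ) Q) {w w' : S ⊗[O] B}
include ht hb

theorem theta_mem_fixedBy (hw : w ∈ fixedBy (conj (O := O) (tensorStr O σ τ)) Q)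
    (hw' : w' ∈ fixedBy (conj (O := O) (tensorStr O σ τ)) Q) :
    theta t b w w' ∈ fixedBy (conj (O := O) (endStr (conj (O := O) σ))) Q := fun q hq => by
  rw [conj_theta (ht q hq) (hb q hq), hw q hq, hw' q hq]

variable [Finite P] [IsLocalRing O]

theorem theta_mem_brKer_left (hw : w ∈ brKer (conj (O := O) (tensorStr O σ τ)) Q)
    (hw' : w' ∈ fixedBy (conj (O := O) (tensorStr O σ τ)) Q) :
    theta t b w w' ∈ brKer (conj (O := O) (endStr (conj (O := O) σ))) Q :=
  map_mem_brKer (h := (theta t b).flip w') (fun q hq w => by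
    rw [LinearMap.flip_apply, LinearMap.flip_apply, conj_theta (ht q hq) (hb q hq), hw' q hq]) hw

theorem theta_mem_brKer_right (hw : w ∈ fixedBy (conj (O := O) (tensorStr O σ τ)) Q)
    (hw' : w' ∈ brKer (conj (O := O) (tensorStr O σ τ)) Q) :
    theta t b w w' ∈ brKer (conj (O := O) (endStr (conj (O := O) σ))) Q :=
  map_mem_brKer (h := theta t b w) (fun q hq w' => by
    rw [conj_theta (ht q hq) (hb q hq), hw q hq]) hw'

-- On pure tensors both sides are given by a scalar times a left and a right multiplication. The
-- general case follows by additivity in `x` and `y`, since `theta` respects Brauer kernels in both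
-- arguments and so the choice of lifts is immaterial. It translates the factorization through `A`
-- into a statement on `S(Q) ⊗ B(Q)`.
omit ht hb in
theorem brBimod_sandwich {p : ℕ} [Fact p.Prime] (hP : IsPGroup p P) [CharP (ResidueField O) p]
    (ht : ∀ q ∈ Q, ∀ x, t (conj (O := O) τ q x) = t x) (b : fixAlg O τ Q)
    (x y : Br O σ Q ⊗[ResidueField O] Br O τ Q) (w w' : fixAlg O (tensorStr O σ τ) Q)
    (hx : brTensor σ τ Q x = br O _ Q w) (hy : brTensor σ τ Q y = br O _ Q w') :
    brBimod σ Q (sandwich (brForm hP τ Q t ht) (br O τ Q b) (x ⊗ₜ y)) =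
      br O _ Q ⟨theta t b (w : S ⊗[O] B) (w' : S ⊗[O] B), theta_mem_fixedBy ht b.2 w.2 w'.2⟩ := by
  induction x generalizing w with
  | zero =>
    rw [map_zero] at hx
    rw [TensorProduct.zero_tmul, map_zero, map_zero, eq_comm, br_eq_zero_iff]
    exact theta_mem_brKer_left ht b.2 (br_eq_zero_iff.mp hx.symm) w'.2
  | add x₁ x₂ h₁ h₂ =>
    obtain ⟨w₁, hw₁⟩ := br_surjective _ Q (brTensor σ τ Q x₁)
    obtain ⟨w₂, hw₂⟩ := br_surjective _ Q (brTensor σ τ Q x₂)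
    rw [TensorProduct.add_tmul, map_add, map_add, h₁ w₁ hw₁.symm, h₂ w₂ hw₂.symm, ← map_add,
      br_eq_iff]
    have h := theta_mem_brKer_left (w := (w₁ : S ⊗[O] B) + (w₂ : S ⊗[O] B) - (w : S ⊗[O] B)) (w' := w') ht b.2
      (br_eq_iff (a := w₁ + w₂).mp (by rw [map_add, hw₁, hw₂, ← map_add, hx])) w'.2
    rwa [map_sub, map_add] at h
  | tmul s c =>
    induction y generalizing w' with
    | zero =>
      rw [map_zero] at hy
      rw [TensorProduct.tmul_zero, map_zero, map_zero, eq_comm, br_eq_zero_iff]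
      exact theta_mem_brKer_right ht b.2 w.2 (br_eq_zero_iff.mp hy.symm)
    | add y₁ y₂ h₁ h₂ =>
      obtain ⟨w₁, hw₁⟩ := br_surjective _ Q (brTensor σ τ Q y₁)
      obtain ⟨w₂, hw₂⟩ := br_surjective _ Q (brTensor σ τ Q y₂)
      rw [TensorProduct.tmul_add, map_add, map_add, h₁ w₁ hw₁.symm, h₂ w₂ hw₂.symm, ← map_add,
        br_eq_iff]
      have h := theta_mem_brKer_right (w := w) (w' := (w₁ : S ⊗[O] B) + (w₂ : S ⊗[O] B) - (w' : S ⊗[O] B)) ht b.2 w.2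
        (br_eq_iff (a := w₁ + w₂).mp (by rw [map_add, hw₁, hw₂, ← map_add, hy]))
      rwa [map_sub, map_add] at h
    | tmul s' c' =>
      obtain ⟨s, rfl⟩ := br_surjective σ Q s
      obtain ⟨c, rfl⟩ := br_surjective τ Q c
      obtain ⟨s', rfl⟩ := br_surjective σ Q s'
      obtain ⟨c', rfl⟩ := br_surjective τ Q c'
      rw [brTensor_tmul, br_eq_iff] at hx hy
      rw [sandwich_tmul, ← map_mul, ← map_mul, brForm_br, map_smul, brBimod_tmul, residue_smul,
        ← map_smul, br_eq_iff]
      have h1 := theta_mem_brKer_left ht b.2 hx (tmul_mem_fixedBy σ τ s'.2 c'.2)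
      have h2 := theta_mem_brKer_right ht b.2 w.2 hy
      have h3 := add_mem h1 h2
      rw [map_sub, LinearMap.sub_apply, map_sub, sub_add_sub_cancel, theta_tmul] at h3
      exact h3

end Theta

/-! ### Consequences of the embedding: factorization through `A` and the corner of `e`. -/

section Factor

open IsLocalRing

variable {O P A S B : Type*} [CommRing O] [IsLocalRing O] [Group P] [Finite P] [Ring A]
  [Algebra O A] [Ring S] [Algebra O S] [Ring B] [Algebra O B]
  {σA : P →* Aˣ} {σ : P →* Sˣ} {τ : P →* Bˣ} {g : A →ₙₐ[O] S ⊗[O] B}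
  (hg : IsInteriorEmbedding σA (tensorStr O σ τ) g)
include hg

/-- The maps `theta` attached to `g(1)` factor through the permutation module `A`. -/
theorem theta_map_one_mem_rankOneKer {X : Type*} [MulAction P X] [Fintype X]
    (a : PermBasis X (conj (O := O) σA)) {Q : Subgroup P} {t : B →ₗ[O] O}
    (ht : ∀ q ∈ Q, ∀ x, t (conj (O := O) τ q x) = t x) {b : B}
    (hb : b ∈ fixedBy (conj (O := O) τ) Q) :
    theta t b (g 1) (g 1) ∈ rankOneKer (conj (O := O) σ) Q := by
  classical
  -- The map is the composite of `s ↦ g⁻¹(g(1) (s ⊗ b) g(1))` from `S` to `A` with `a ↦ (id ⊗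
  -- t)(g(a))` from `A` to `S`. Expanding in the permutation basis of `A` gives an equivariant
  -- family of rank one maps, of which only the `Q`-fixed members matter.
  let v : X → S := fun x => slice t (g (a.basis x))
  let ξ : X → S →ₗ[O] O := fun x => a.basis.coord x ∘ₗ compress hg ∘ₗ (TensorProduct.mk O S B).flip b
  have hξ : ∀ x s, ξ x s = a.basis.repr (compress hg (s ⊗ₜ b)) x := fun _ _ => rfl
  have hv : ∀ q ∈ Q, ∀ x, v (q • x) = conj (O := O) σ q (v x) := by
    intro q hq x
    simp only [v]
    rw [← a.apply_basis, hg.map_conj, slice_conj σ τ (ht q hq)]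
  have hξq : ∀ q ∈ Q, ∀ x s, ξ (q • x) (conj (O := O) σ q s) = ξ x s := by
    intro q hq x s
    have h : conj (O := O) σ q s ⊗ₜ[O] b = conj (O := O) (tensorStr O σ τ) q (s ⊗ₜ b) := by
      rw [conj_tensorStr_tmul, hb q hq]
    rw [hξ, hξ, h, compress_conj, a.repr_apply_smul]
  have hsum : theta t b (g 1) (g 1) = ∑ x, (ξ x).smulRight (v x) := by
    ext s
    rw [theta_apply, ← apply_compress hg, LinearMap.sum_apply]
    have h := congrArg (fun z => slice t (g z)) (a.basis.sum_repr (compress hg (s ⊗ₜ b))).symm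
    simp only [LinearMap.smulRight_apply, hξ, v]
    simpa only [map_sum, map_smul] using h
  set s : Finset X := Finset.univ.filter fun x => ∀ q ∈ Q, q • x = x
  have hs : ∀ x, x ∈ s ↔ ∀ q ∈ Q, q • x = x := by simp [s]
  have h := sum_sub_sum_fixed_mem_properTr (conj (O := O) (endStr (conj (O := O) σ))) Q
    (fun x => (ξ x).smulRight (v x)) (fun q hq x => by
      rw [conj_smulRight, hv q hq]
      congr 1
      ext s
      have h1 := hξq q hq x (conj (O := O) σ q⁻¹ s)
      rwa [← Module.End.mul_apply, ← map_mul, mul_inv_cancel, map_one,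
        Module.End.one_apply] at h1) s hs
  rw [hsum, ← sub_add_cancel (∑ x, (ξ x).smulRight (v x)) (∑ x ∈ s, (ξ x).smulRight (v x))]
  refine add_mem (brKer_le_rankOneKer _ _ (properTr_le_brKer _ _ h)) (sum_mem fun x hx => ?_)
  rw [hs] at hx
  refine smulRight_mem_rankOneKer (fun q hq m => ?_) fun q hq => ?_
  · have := hξq q hq x m
    rwa [hx q hq] at this
  · rw [← hv q hq, hx q hq]

/-- If `A(Q)` is indecomposable as an algebra, so is the corresponding corner of `S(Q) ⊗ B(Q)`. -/
theorem corner_centrallyIndecomposable {p : ℕ} [Fact p.Prime] (hP : IsPGroup p P)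
    [CharP (ResidueField O) p] {X : Type*} [MulAction P X] [Fintype X]
    (b : PermBasis X (conj (O := O) τ)) {Q : Subgroup P}
    (hA : CentrallyIndecomposable (Br O σA Q)) {e : Br O σ Q ⊗[ResidueField O] Br O τ Q}
    (he : brTensor σ τ Q e = br O _ Q ⟨g 1, hg.map_one_mem Q⟩)
    (f : Br O σ Q ⊗[ResidueField O] Br O τ Q) (hf : IsIdempotentElem f) (hef : e * f = f)
    (hfe : f * e = f) (hcen : ∀ x, f * (e * x * e) = e * x * e * f) : f = 0 ∨ f = e := by
  have hgmem : ∀ {a : A}, a ∈ fixedBy (conj (O := O) σA) Q →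
      g a ∈ fixedBy (conj (O := O) (tensorStr O σ τ)) Q := fun ha q hq => by
    rw [← hg.map_conj, ha q hq]
  obtain ⟨w, hw⟩ := br_surjective _ Q (brTensor σ τ Q f)
  -- The element of `A(Q)` corresponding to `f`: compress a lift of `f` to `A`.
  let a : fixAlg O σA Q := ⟨compress hg w, map_mem_fixedBy (fun q _ => compress_conj hg q) w.2⟩
  have hga : br O (tensorStr O σ τ) Q ⟨g a, hgmem a.2⟩ = brTensor σ τ Q f := by
    have h1 : (⟨g a, hgmem a.2⟩ : fixAlg O (tensorStr O σ τ) Q) =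
        ⟨g 1, hg.map_one_mem Q⟩ * w * ⟨g 1, hg.map_one_mem Q⟩ :=
      Subtype.ext (apply_compress hg w)
    rw [h1, map_mul, map_mul, hw, ← he, ← map_mul, ← map_mul, hef, hfe]
  have hcomm : ∀ (a a' : fixAlg O σA Q), br O (tensorStr O σ τ) Q ⟨g a, hgmem a.2⟩ =
      br O (tensorStr O σ τ) Q ⟨g a', hgmem a'.2⟩ → br O σA Q a = br O σA Q a' := by
    intro a a' h
    rw [br_eq_iff] at h ⊢
    refine mem_brKer_of_apply_mem hg ?_
    rwa [map_sub]
  have hgmul : ∀ a a' : fixAlg O σA Q,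
      br O (tensorStr O σ τ) Q ⟨g ((a * a' : fixAlg O σA Q) : A), hgmem (a * a').2⟩ =
      br O (tensorStr O σ τ) Q ⟨g a, hgmem a.2⟩ * br O (tensorStr O σ τ) Q ⟨g a', hgmem a'.2⟩ := by
    intro a a'
    rw [← map_mul]
    congr 1
    exact Subtype.ext (map_mul g (a : A) a')
  have hid : IsIdempotentElem (br O σA Q a) := by
    rw [IsIdempotentElem, ← map_mul]
    refine hcomm _ _ ?_
    rw [hgmul, hga, ← map_mul, hf.eq]
  have hacen : ∀ x, br O σA Q a * x = x * br O σA Q a := by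
    intro x
    obtain ⟨x, rfl⟩ := br_surjective σA Q x
    obtain ⟨z, hz⟩ := brTensor_surjective σ τ Q b (br O _ Q ⟨g x, hgmem x.2⟩)
    rw [← map_mul, ← map_mul]
    refine hcomm _ _ ?_
    rw [hgmul, hgmul, hga]
    have h1 : br O (tensorStr O σ τ) Q ⟨g x, hgmem x.2⟩ = brTensor σ τ Q (e * z * e) := by
      rw [map_mul, map_mul, hz, he, ← map_mul, ← map_mul]
      congr 1
      refine Subtype.ext ?_
      change g x = g 1 * g x * g 1
      rw [map_one_mul, map_mul_one]
    rw [h1, ← map_mul, ← map_mul, hcen]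
  rcases hA _ hid hacen with h | h
  · left
    refine brTensor_injective σ τ Q b hP ?_
    rw [map_zero, ← hga, br_eq_zero_iff]
    exact map_mem_brKer (h := (g : A →ₗ[O] S ⊗[O] B)) (fun q _ a => hg.map_conj q a)
      (br_eq_zero_iff.mp h)
  · right
    refine brTensor_injective σ τ Q b hP ?_
    rw [← hga, he, br_eq_iff]
    have h1 : (a : A) - 1 ∈ brKer (conj (O := O) σA) Q :=
      br_eq_iff (b := (1 : fixAlg O σA Q)).mp (by rw [h, map_one])
    have h2 := map_mem_brKer (h := (g : A →ₗ[O] S ⊗[O] B))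
      (ρ' := conj (O := O) (tensorStr O σ τ)) (fun q _ a => hg.map_conj q a) h1
    rw [map_sub] at h2
    exact h2

end Factor

/-! ### The identity of `S` is a sum of rank one maps modulo each Brauer kernel. -/

section RankOneMain

open IsLocalRing

variable {O P A B V : Type*} [CommRing O] [IsLocalRing O] [Group P] [Finite P]
  [AddCommGroup V] [Module O V] [Module.Finite O V] [Module.Free O V]
  {p : ℕ} [Fact p.Prime] (hP : IsPGroup p P) [CharP (ResidueField O) p]
  {ρ : Representation O P V} {Q : Subgroup P}

-- A rank one map sends `x` to `ξ(x) v`, where `ξ(x)` lies in the maximal ideal by the trace form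
-- argument. So maps in the ideal kill the radical of `S(Q)`.
include hP in
theorem apply_mem_brKer_of_mem_rankOneKer {f : Module.End O (Module.End O V)}
    (hf : f ∈ rankOneKer (conj (O := O) (endStr ρ)) Q) {x : fixAlg O (endStr ρ) Q}
    (hx : ∀ y, IsNilpotent (br O (endStr ρ) Q x * y)) :
    f x ∈ brKer (conj (O := O) (endStr ρ)) Q := by
  obtain ⟨f₁, hf₁, f₂, hf₂, rfl⟩ := Submodule.mem_sup.mp hf
  rw [LinearMap.add_apply]
  refine add_mem ?_ (apply_mem_brKer_of_fixed hf₂ x.2)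
  refine Submodule.span_induction ?_ (by simp) (fun f g _ _ hf hg => by
    rw [LinearMap.add_apply]; exact add_mem hf hg) (fun c f _ hf => by
    rw [LinearMap.smul_apply]; exact Submodule.smul_mem _ _ hf) hf₁
  rintro _ ⟨v, hv, ξ, hξ, rfl⟩
  exact smul_mem_brKer (form_mem_maximalIdeal_of_isNilpotent hP hξ hx) hv

variable [IsNoetherianRing O] [IsAdicComplete (maximalIdeal O) O] [IsAlgClosed (ResidueField O)]
  [Ring A] [Algebra O A] [Module.Finite O A] [Ring B] [Algebra O B] [Module.Finite O B]
  {σA : P →* Aˣ} {τ : P →* Bˣ} {g : A →ₙₐ[O] Module.End O V ⊗[O] B}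

-- The block criterion `one_mem_of_sandwich_mem`, applied to `S(Q)`, `B(Q)` and the class of `g(1)`.
include hP in
theorem one_mem_rankOneKer (hg : IsInteriorEmbedding σA (tensorStr O (endStr ρ) τ) g)
    {X Y : Type*} [MulAction P X] [Fintype X] [MulAction P Y] [Fintype Y]
    (a : PermBasis X (conj (O := O) σA)) (b : PermBasis Y (conj (O := O) τ))
    (htrivA : ∀ e : fixAlg O σA ⊤, IsIdempotentElem e → e = 0 ∨ e = 1)
    (htrivB : ∀ e : fixAlg O τ ⊤, IsIdempotentElem e → e = 0 ∨ e = 1)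
    (htrivS : ∀ e : fixAlg O (endStr ρ) ⊤, IsIdempotentElem e → e = 0 ∨ e = 1)
    (h1A : (1 : A) ∉ brKer (conj (O := O) σA) ⊤) (Q : Subgroup P) :
    1 ∈ rankOneKer (conj (O := O) (endStr ρ)) Q := by
  suffices h : 1 ∈ rankOneIdeal (endStr ρ) Q from
    mem_rankOneKer_of_br_mem (endStr ρ) Q h (f := 1) (by rw [map_one, map_one])
  rcases subsingleton_or_nontrivial (Br O (endStr ρ) Q) with hs | hs
  · have h0 : (1 : Br O (endStr ρ) Q ⊗[ResidueField O] (Br O (endStr ρ) Q)ᵐᵒᵖ) = 0 := by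
      rw [Algebra.TensorProduct.one_def, Subsingleton.elim (1 : Br O (endStr ρ) Q) 0,
        TensorProduct.zero_tmul]
    rw [h0]
    exact zero_mem _
  obtain ⟨e, he⟩ := brTensor_surjective (endStr ρ) τ Q b (br O _ Q ⟨g 1, hg.map_one_mem Q⟩)
  have hid : IsIdempotentElem e := by
    refine brTensor_injective (endStr ρ) τ Q b hP ?_
    rw [map_mul, he, ← map_mul]
    congr 1
    exact Subtype.ext (map_one_mul g 1)
  obtain ⟨t₀, ht₀, u, hu, hu'⟩ := exists_slice_isUnit hP hg b htrivS htrivB h1A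
  refine one_mem_of_sandwich_mem hid (rankOneIdeal (endStr ρ) Q) ?_ ?_
    (corner_centrallyIndecomposable hg hP b (br_centrallyIndecomposable hP a htrivA h1A Q) he)
    (t₀ := brForm hP τ Q t₀ fun q _ => ht₀ q) ?_
  · intro x hx
    obtain ⟨x, rfl⟩ := br_surjective τ Q x
    obtain ⟨t, ht, htx⟩ := exists_brForm_ne_zero hP b hx
    refine ⟨brForm hP τ Q t ht, ?_, fun c => ?_⟩
    · rw [brForm_br]
      exact (htx.map (residue O)).ne_zero
    · obtain ⟨c, rfl⟩ := br_surjective τ Q c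
      exact ⟨_, theta_map_one_mem_rankOneKer hg a ht c.2,
        (brBimod_sandwich hP ht c e e ⟨g 1, hg.map_one_mem Q⟩ ⟨g 1, hg.map_one_mem Q⟩ he he).symm⟩
  · intro c d hcd x hx
    obtain ⟨c, rfl⟩ := br_surjective _ Q c
    obtain ⟨d, rfl⟩ := br_surjective _ Q d
    obtain ⟨x, rfl⟩ := br_surjective _ Q x
    have h := apply_mem_brKer_of_mem_rankOneKer hP
      (mem_rankOneKer_of_br_mem (endStr ρ) Q hcd (brBimod_tmul (endStr ρ) Q c d).symm) hx
    rw [← map_mul, ← map_mul, br_eq_zero_iff]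
    simpa [mul_assoc] using h
  · rw [← brMap_slice_brTensor, he, brMap_br]
    -- The slice is a unit already in `S^P`, hence in `S^Q` and in `S(Q)`.
    have h := (hu.map (Subalgebra.inclusion
      (show fixAlg O (endStr ρ) ⊤ ≤ fixAlg O (endStr ρ) Q from fixedBy_anti _ le_top))).map
      (br O (endStr ρ) Q)
    convert h using 2
    exact Subtype.ext hu'.symm

end RankOneMain

/-! ### From the Brauer quotients back to `End_O(S)`. -/

section TraceRankOne

open IsLocalRing

variable {O P M : Type*} [CommRing O] [Group P] [Finite P] [AddCommGroup M] [Module O M]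

theorem tr_self {ρ : Representation O P M} {Q : Subgroup P} {m : M} (hm : m ∈ fixedBy ρ Q) :
    tr ρ Q Q m = m := by
  have h : cosetsIn Q Q = {QuotientGroup.mk 1} := by
    ext y
    rw [mem_cosetsIn, Finset.mem_singleton]
    constructor
    · rintro ⟨q, hq, rfl⟩
      exact QuotientGroup.eq.mpr (by simpa using hq)
    · rintro rfl
      exact ⟨1, Q.one_mem, rfl⟩
  rw [tr_apply, h, Finset.sum_singleton, apply_out hm, map_one, Module.End.one_apply]

/-- The span of the traces to `Q` of rank one maps fixed by subgroups of `Q`. -/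
def traceRankOne (ρ : Representation O P M) (Q : Subgroup P) : Submodule O (Module.End O M) :=
  Submodule.span O {f | ∃ R ≤ Q, ∃ v ∈ fixedBy ρ R, ∃ ξ : M →ₗ[O] O,
    (∀ q ∈ R, ∀ m, ξ (ρ q m) = ξ m) ∧ tr (conj (O := O) (endStr ρ)) R Q (ξ.smulRight v) = f}

theorem rankOne_le_traceRankOne (ρ : Representation O P M) (Q : Subgroup P) :
    rankOne ρ Q ≤ traceRankOne ρ Q := by
  refine Submodule.span_le.mpr ?_
  rintro _ ⟨v, hv, ξ, hξ, rfl⟩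
  exact Submodule.subset_span ⟨Q, le_rfl, v, hv, ξ, hξ, tr_self (smulRight_mem_fixedBy hξ hv)⟩

theorem tr_mem_traceRankOne {ρ : Representation O P M} {R Q : Subgroup P} (h : R ≤ Q)
    {f : Module.End O M} (hf : f ∈ traceRankOne ρ R) :
    tr (conj (O := O) (endStr ρ)) R Q f ∈ traceRankOne ρ Q := by
  suffices traceRankOne ρ R ≤
      (traceRankOne ρ Q).comap (tr (conj (O := O) (endStr ρ)) R Q) from this hf
  refine Submodule.span_le.mpr ?_
  rintro _ ⟨R', hR', v, hv, ξ, hξ, rfl⟩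
  rw [SetLike.mem_coe, Submodule.mem_comap, tr_trans hR' h (smulRight_mem_fixedBy hξ hv)]
  exact Submodule.subset_span ⟨R', hR'.trans h, v, hv, ξ, hξ, rfl⟩

variable [IsLocalRing O] [IsNoetherianRing O] [Module.Finite O M]

/-- Multiplying `f` by the identity shows that `f` is a sum of rank one maps, proper traces and an
element of `J(O) End(M)^Q`. The proper traces are covered by induction and transitivity, the last
term by Nakayama's lemma. -/
theorem fixedBy_le_traceRankOne {ρ : Representation O P M} (h1 : ∀ Q, 1 ∈ rankOneKer ρ Q)
    (Q : Subgroup P) : fixedBy (conj (O := O) (endStr ρ)) Q ≤ traceRankOne ρ Q := by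
  induction Q using WellFoundedLT.induction with
  | _ Q ih =>
  have hproper : properTr (conj (O := O) (endStr ρ)) Q ≤ traceRankOne ρ Q := by
    refine Submodule.span_le.mpr ?_
    rintro _ ⟨R, hR, m, hm, rfl⟩
    exact tr_mem_traceRankOne hR.le (ih R hR hm)
  refine Submodule.le_of_le_smul_of_le_jacobson_bot (I := maximalIdeal O)
    (IsNoetherian.noetherian _) (IsLocalRing.maximalIdeal_le_jacobson _) fun f hf => ?_
  have h := mul_mem_rankOneKer_left hf (h1 Q)
  rw [mul_one] at h
  refine sup_le ((rankOne_le_traceRankOne ρ Q).trans le_sup_left)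
    (sup_le (hproper.trans le_sup_left) le_sup_right) h

end TraceRankOne

/-! ### Traces of rank one maps exhibit a summand of a permutation module. -/

section Summand

open IsLocalRing

variable {O P M : Type*} [CommRing O] [IsLocalRing O] [Group P] [Finite P] [AddCommGroup M]
  [Module O M] {p : ℕ} [Fact p.Prime] [CharP (ResidueField O) p]

omit [IsLocalRing O] in
theorem tr_top_apply (ρ : Representation O P M) (R : Subgroup P) [Fintype (P ⧸ R)] (m : M) :
    tr ρ R ⊤ m = ∑ y : P ⧸ R, ρ y.out m := by
  rw [tr_apply]
  refine Finset.sum_congr ?_ fun _ _ => rfl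
  ext y
  induction y using QuotientGroup.induction_on with
  | _ g => simpa using mem_cosetsIn.mpr ⟨g, Subgroup.mem_top g, rfl⟩

/-- A module whose identity map is a sum of traces of rank one maps is a direct summand of a
permutation module. -/
theorem hasStableBasis_of_one_mem_traceRankOne (hP : IsPGroup p P) {ρ : Representation O P M}
    (h : 1 ∈ traceRankOne ρ ⊤) : HasStableBasis ρ := by
  obtain ⟨n, c, f, hf⟩ := Submodule.mem_span_set'.mp h
  choose R _ v hv ξ hξ hR using fun i => (f i).2
  have : ∀ i, Fintype (P ⧸ R i) := fun i => Fintype.ofFinite _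
  -- Spelled out, the traces express the identity as a sum of rank one maps indexed by the `P`-set
  -- `⨆ P/R_i` (disjoint union), with equivariant vectors `w` and forms `ζ`.
  let w : (Σ i, P ⧸ R i) → M := fun y => ρ y.2.out (c y.1 • v y.1)
  let ζ : (Σ i, P ⧸ R i) → M →ₗ[O] O := fun y => ξ y.1 ∘ₗ ρ y.2.out⁻¹
  have hw : ∀ g y, w (g • y) = ρ g (w y) := by
    rintro g ⟨i, y⟩
    exact apply_out_smul (Submodule.smul_mem _ _ (hv i)) g y
  have hζ : ∀ g y m, ζ (g • y) (ρ g m) = ζ y m := by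
    rintro g ⟨i, y⟩ m
    have h1 : (QuotientGroup.mk (g * y.out) : P ⧸ R i) = QuotientGroup.mk (g • y).out := by
      rw [QuotientGroup.out_eq']
      conv_rhs => rw [← QuotientGroup.out_eq' y]
      rfl
    have h2 := hξ i _ (inv_mem (QuotientGroup.eq.mp h1)) (ρ y.out⁻¹ m)
    rw [← Module.End.mul_apply, ← map_mul] at h2
    change ξ i (ρ (g • y).out⁻¹ (ρ g m)) = ξ i (ρ y.out⁻¹ m)
    rw [← Module.End.mul_apply, ← map_mul, ← h2]
    congr 3
    group
  have hsum : ∀ m, ∑ y, ζ y m • w y = m := by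
    intro m
    rw [← Finset.univ_sigma_univ, Finset.sum_sigma]
    have h1 := LinearMap.congr_fun hf m
    rw [LinearMap.sum_apply, Module.End.one_apply] at h1
    refine Eq.trans (Finset.sum_congr rfl fun i _ => ?_) h1
    rw [LinearMap.smul_apply, ← hR i, tr_top_apply, LinearMap.sum_apply, Finset.smul_sum]
    refine Finset.sum_congr rfl fun y _ => ?_
    rw [conj_smulRight, LinearMap.smulRight_apply]
    simp only [w, ζ, map_smul]
    rw [smul_comm]
  obtain ⟨X, _, ⟨b⟩⟩ := exists_permBasis_of_sum_eq hP Finset.univ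
    (fun _ _ _ => Finset.mem_univ _) ρ w ζ hw hζ hsum
  exact b.hasStableBasis

end Summand

theorem HasStableBasis.exists_finite_permBasis {O P M : Type*} [CommRing O] [Nontrivial O]
    [Group P] [AddCommGroup M] [Module O M] [Module.Finite O M] {ρ : Representation O P M}
    (h : HasStableBasis ρ) :
    ∃ (X : Set M) (_ : MulAction P X) (_ : Fintype X), Nonempty (PermBasis X ρ) := by
  obtain ⟨X, hX, ⟨b⟩⟩ := h.exists_permBasis
  have := Module.Finite.finite_basis b.basis
  exact ⟨X, hX, Fintype.ofFinite X, ⟨b⟩⟩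

end GAlg
end

/-- `O` is a complete local principal ideal domain, that is, a complete discrete valuation ring
or a field, with algebraically closed residue field of characteristic `p`. -/
theorem theorem3p5 {O P A B V : Type*} (p : ℕ) [Fact p.Prime]
    [CommRing O] [IsDomain O] [IsLocalRing O] [IsPrincipalIdealRing O]
    [IsAdicComplete (IsLocalRing.maximalIdeal O) O]
    [CharP (IsLocalRing.ResidueField O) p] [IsAlgClosed (IsLocalRing.ResidueField O)]
    [Group P] [Finite P] (hP : IsPGroup p P)
    [Ring A] [Algebra O A] [Module.Finite O A] [Module.Free O A] (σA : P →* Aˣ)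
    [Ring B] [Algebra O B] [Module.Finite O B] [Module.Free O B] (σB : P →* Bˣ)
    (hA : GAlg.IsPrimitiveIdempotent (1 : GAlg.fixedSubalgebra O σA))
    (hB : GAlg.IsPrimitiveIdempotent (1 : GAlg.fixedSubalgebra O σB))
    [AddCommGroup V] [Module O V] [Module.Finite O V] [Module.Free O V]
    (ρ : Representation O P V) (hV : GAlg.IsIndecomposable ρ)
    (g : A →ₙₐ[O] TensorProduct O (Module.End O V) B)
    (hg : GAlg.IsInteriorEmbedding σA (GAlg.tensorStr O (GAlg.endStr ρ) σB) g)
    (hA_basis : GAlg.HasStableBasis (GAlg.conj (O := O) σA))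
    (hB_basis : GAlg.HasStableBasis (GAlg.conj (O := O) σB))
    (hA_symm : GAlg.IsSymmetricAlgebra O A)
    (hA_brauer : Nontrivial (GAlg.BrauerQuotient (GAlg.conj (O := O) σA))) :
    GAlg.IsEndopermutation ρ := by
  obtain ⟨X, _, _, ⟨a⟩⟩ := hA_basis.exists_finite_permBasis
  obtain ⟨Y, _, _, ⟨b⟩⟩ := hB_basis.exists_finite_permBasis
  -- The module to be split is `End_O(V)` under conjugation; `1` is its identity map, fixed by all
  -- of `P`.
  refine GAlg.hasStableBasis_of_one_mem_traceRankOne hP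
    (GAlg.fixedBy_le_traceRankOne (fun Q => ?_) ⊤ (GAlg.one_mem_fixedBy _ ⊤))
  refine GAlg.one_mem_rankOneKer hP hg a b ?_ ?_ hV.eq_zero_or_eq_one
    (GAlg.one_notMem_brKer_top hA_brauer) Q
  · rw [GAlg.fixAlg_top]
    exact hA.eq_zero_or_eq_one
  · rw [GAlg.fixAlg_top]
    exact hB.eq_zero_or_eq_one
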